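/- Let $\mathbb K=\mathbb R$ or $\mathbb C$ and let $M\subset\mathbb K^n$ be a non-empty open convex set (e.g. a ball) with coordinates $v^1,\dots,v^n$; smooth means $C^\infty$ over $\mathbb K$, and "quadratic" means "polynomial in $v$ of degree at most two". Summation over repeated indices is understood. Consider on the loop space of $M$ a bihamiltonian structure of hydrodynamic type, written in flat coordinates of the first metric, $$\{v^\alpha(x),v^\beta(y)\}_1=\eta^{\alpha\beta}\delta'(x-y),\qquad \{v^\alpha(x),v^\beta(y)\}_2=g^{\alpha\beta}(v)\delta'(x-y)+\Gamma^{\alpha\beta}_\gamma(v)v^\gamma_x\delta(x-y),$$ with $\eta$ constant, $\det\eta\ne0$, $g,\Gamma$ smooth, all linear combinations of the two brackets being Poisson brackets. Indices are raised and lowered by $\eta$, $(\eta_{\alpha\beta})=(\eta^{\alpha\beta})^{-1}$, $\partial^\alpha=\eta^{\alpha\lambda}\partial_\lambda$, $v_\alpha=\eta_{\alpha\epsilon}v^\epsilon$. A *tau-structure* consists of functions $\phi_{\alpha,p}(v)$, $p\ge-1$, with $\phi_{\alpha,-1}=v_\alpha$ such that $\sum_p\lambda^{-p-1}\int\phi_{\alpha,p}\,dx$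 is a Casimir of $\{\,,\}_2-\lambda\{\,,\}_1$, and of densities $h_{\alpha,p}=\sum_{q=-1}^p a_{\alpha\beta,pq}\phi_{\beta,q}+\mathrm{const}$ with constants $a_{\alpha\beta,pq}$, $\det(a_{\alpha\beta,pp})\neq0$, such that, for the flows $\partial/\partial t^{\alpha,p}=\{\cdot,\int h_{\alpha,p}dx\}_1$, one has $\partial h_{\alpha,p-1}/\partial t^{\beta,q}=\partial h_{\beta,q-1}/\partial t^{\alpha,p}$ for all $p,q\ge0$. (0) Every tau-structure becomes, after a transformation $h_{\alpha,p}\mapsto A_\alpha^\beta h_{\beta,p}$ with a constant invertible matrix $A$, a tau-structure (with the same $\phi_{\alpha,p}$) that is normalized by $h_{\alpha,-1}=v_\alpha+\mathrm{const}$. Fix a normalized tau-structure and put $a=(a_\alpha^\beta)=(a_{\alpha\beta,00})$, $b=a^{-1}$, $b^{\alpha\beta}=\eta^{\alpha\lambda}b_\lambda^\beta$, $\bar b^\alpha_\beta=\eta^{\alpha\lambda}b_\lambda^\mu\eta_{\mu\beta}$. (1) There is a smooth function $F$ on $M$ and a constant matrix $g_0$ with $$\Gamma^{\alpha\beta}_\gamma=b^{\beta\epsilon}\partial^\alpha\partial_\gamma\partial_\epsilon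 F,\qquad g^{\alpha\beta}=b^{\alpha\epsilon}\partial_\epsilon\partial^\beta F+b^{\beta\epsilon}\partial_\epsilon\partial^\alpha F+g_0^{\alpha\beta}.$$ Every such $F$ satisfies the associativity equations $\partial_\alpha\partial_\beta\partial_\lambda F\,\eta^{\lambda\mu}\,\partial_\mu\partial_\gamma\partial_\delta F=\partial_\delta\partial_\beta\partial_\lambda F\,\eta^{\lambda\mu}\,\partial_\mu\partial_\gamma\partial_\alpha F$, and, $F$ being one such function, a smooth function $F'$ is another one (possibly with another $g_0$) if and only if $F'-F$ is quadratic. Write $c_{\alpha\beta\gamma}=\partial_\alpha\partial_\beta\partial_\gamma F$ and $\partial_\alpha\cdot\partial_\beta=c_{\alpha\beta}^\gamma\partial_\gamma$. A solution $F$ of the associativity equations with a constant unity $e$ (that is, $e^\epsilon c_{\epsilon\alpha\beta}=\eta_{\alpha\beta}$) together with a linear (possibly inhomogeneous) vector field $E$ is a *Frobenius manifold* of charge $d$ if $\partial_EF=(3-d)F+\text{quadratic}$ and $[e,E]=e$, and a *degenerate Frobenius manifold* if $\partial_EF=kF+\text{quadratic}$, $[e,E]=0$ for a constant $k$. The solution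 is *rigid* if every constant symmetric bilinear form that is invariant for all the algebras $T_vM$ is proportional to $\eta_{\alpha\beta}$. For a constant vector $w$ with $\partial_wF$ quadratic, $F^w$ denotes a function with $\nabla F^w=w\cdot\nabla F+\frac12\rho(v)$, where $\rho$ is a constant antisymmetric linear operator. (2) Suppose that the tau-structure is compatible with spatial translations, $\{\cdot,\int h_{1,0}dx\}_1=a_{11,00}\{\cdot,\int\phi_{1,0}dx\}_1=\partial/\partial x$ (the index $1$ may be any fixed index). Put $e=\partial/\partial v^1$ and $E^\alpha=g^{\alpha\epsilon}\eta_{1\epsilon}$. Then $b_1^\alpha=c\,\delta_1^\alpha$ with a constant $c\ne0$, $E^\alpha=c\,v^\alpha+\bar b^\alpha_\beta v^\beta+\mathrm{const}$, and for $w^\alpha=2c\,\delta^\alpha_1+\bar b^\alpha_1$ one has $[e,E]=w-c\,e$. For every $F$ as in (1), $e$ is the unity, $g^{\alpha\beta}=E^\epsilon c_\epsilon^{\alpha\beta}$, $\partial_wF$ is quadratic, and $\partial_EF=2F^w+\text{quadratic}$ for some $F^w$. (3) In the situation of (2), if $F$ is rigid, then $w=(c+\kappa)e$ for some constant $\kappa$.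 Whenever $w=(c+\kappa)e$: if $\kappa\ne0$, then the potential $\kappa F$, the unity $\kappa^{-1}e$ and the Euler field $\kappa^{-1}E$ define on $M$ (with the metric $\eta$) a Frobenius manifold of charge $d=1-2c/\kappa$, and, with $F,E$ replaced by $\kappa F,\kappa^{-1}E$, $g^{\alpha\beta}=E^\epsilon c_\epsilon^{\alpha\beta}$, $\Gamma^{\alpha\beta}_\gamma=c^{\alpha\epsilon}_\gamma(\frac12-\mu)^\beta_\epsilon$, $\mu=\frac{2-d}2-\nabla E$; if $\kappa=0$, then $(F,e,E)$ is a degenerate Frobenius manifold with $k=2c$ and $g^{\alpha\beta}=E^\epsilon c_\epsilon^{\alpha\beta}$, $\Gamma^{\alpha\beta}_\gamma=-c^{\alpha\epsilon}_\gamma\mu^\beta_\epsilon$, $\mu=\frac k2-\nabla E$. (4) Let $F$ be a solution of the associativity equations on $M$ (for some constant symmetric nondegenerate $\eta$) with constant unity $e$, semisimple in the sense that every algebra $T_vM$ is isomorphic to $\mathbb K^n$, and let $E$ be a linear vector field, $w$ a constant vector with $\partial_wF$ quadratic, $c$ a constant, such that $\partial_EF=2F^w+\text{quadratic}$ for some $F^w$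 and $[e,E]=w-c\,e$. Then there is a linear change of coordinates $\mathbb K^n\cong\mathbb K^{n_1}\times\dots\times\mathbb K^{n_m}$, $n_s\ge1$, which identifies $M$ with an open subset of the product $M_1\times\dots\times M_m$ of its projections, such that the metric is an orthogonal direct sum, $F(v)=\sum_sF_s(v_s)+\text{quadratic}$ with $F_s$ a smooth rigid solution on $M_s$ with unity $e_s=\mathrm{pr}_s e$, $\mathrm{pr}_sE$ depends only on $v_s$, and $w=c\,e+\sum_s\kappa_se_s$ with constants $\kappa_s$. The factors with $\kappa_s\ne0$ are Frobenius manifolds of charge $d_s=1-2c/\kappa_s$ with potential $\kappa_sF_s$, unity $\kappa_s^{-1}e_s$ and Euler field $\kappa_s^{-1}\mathrm{pr}_sE$; the factors with $\kappa_s=0$ are degenerate Frobenius manifolds with potential $F_s$, unity $e_s$, field $\mathrm{pr}_sE$ and $k=2c$. (5) In the situation of (2), if $\det(g^{\alpha\beta}(v)-\lambda\eta^{\alpha\beta})=0$ has $n$ pairwise distinct roots $\lambda\in\mathbb K$ at every $v\in M$, then the algebras $T_vM$ are semisimple (isomorphic to $\mathbb K^n$), $M$ decomposes as in (4), and in the coordinates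 of the decomposition both Poisson brackets are direct sums of brackets on the factors, the second one being on each factor of the corresponding normal form of (3). -/

import Mathlib

open scoped ContDiff

noncomputable section

namespace TauFrobenius

variable {𝕜 : Type} [RCLike 𝕜] {ι : Type} [Fintype ι] [DecidableEq ι]

/-! ### Coordinate calculus on `ι → 𝕜` -/

/-- The partial derivative `∂_α f` at `v`. -/
def pd (α : ι) (f : (ι → 𝕜) → 𝕜) (v : ι → 𝕜) : 𝕜 :=
  fderiv 𝕜 f v (Pi.single α 1)

/-- `f` is on `M` a polynomial of degree at most two in the coordinates. -/
def IsQuadraticOn (M : Set (ι → 𝕜)) (f : (ι → 𝕜) → 𝕜) : Prop :=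
  ∃ (Q : ι → ι → 𝕜) (q : ι → 𝕜) (r : 𝕜), ∀ v ∈ M,
    f v = (∑ α, ∑ β, Q α β * v α * v β) + (∑ α, q α * v α) + r

/-- `E` is on `M` a linear (possibly inhomogeneous) vector field. -/
def IsLinearFieldOn (M : Set (ι → 𝕜)) (E : (ι → 𝕜) → (ι → 𝕜)) : Prop :=
  ∃ (A : Matrix ι ι 𝕜) (r : ι → 𝕜), ∀ v ∈ M, E v = A.mulVec v + r

/-! ### Brackets of hydrodynamic type on the loop space -/

/-- The coefficients of a bracket
`{u^i(x), u^j(y)} = g^{ij}(u(x)) δ'(x-y) + Γ^{ij}_k(u(x)) u^k_x δ(x-y)`;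
`Γ u i j k` stands for `Γ^{ij}_k(u)`. -/
structure HydroBracket (𝕜 : Type) (ι : Type) where
  g : (ι → 𝕜) → Matrix ι ι 𝕜
  Γ : (ι → 𝕜) → ι → ι → ι → 𝕜

/-- The linear combination `s {,}_1 + t {,}_2`. -/
def HydroBracket.comb (s t : 𝕜) (B₁ B₂ : HydroBracket 𝕜 ι) : HydroBracket 𝕜 ι where
  g := fun v => s • B₁.g v + t • B₂.g v
  Γ := fun v i j k => s * B₁.Γ v i j k + t * B₂.Γ v i j k

/-- The constant bracket `{v^α(x), v^β(y)} = η^{αβ} δ'(x-y)`. -/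
def flatBracket (η : Matrix ι ι 𝕜) : HydroBracket 𝕜 ι where
  g := fun _ => η
  Γ := fun _ _ _ _ => 0

/-- The coefficients of the bracket are smooth on `M`. -/
def HydroBracket.SmoothOn (B : HydroBracket 𝕜 ι) (M : Set (ι → 𝕜)) : Prop :=
  (∀ i j, ContDiffOn 𝕜 ∞ (fun v => B.g v i j) M) ∧
    ∀ i j k, ContDiffOn 𝕜 ∞ (fun v => B.Γ v i j k) M

/-- Smooth maps from the circle `ℝ/ℤ`. -/
def IsLoop (u : ℝ → ι → 𝕜) : Prop :=
  ContDiff ℝ ∞ u ∧ Function.Periodic u 1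

/-- The Hamiltonian vector field at the loop `u` of the functional `∫ c_j(x) u^j(x) dx`:
`X^i = g^{ij}(u) c_j' + Γ^{ij}_k(u) u^k_x c_j`. -/
def HydroBracket.ham (B : HydroBracket 𝕜 ι) (u c : ℝ → ι → 𝕜) (x : ℝ) (i : ι) : 𝕜 :=
  ∑ j, (B.g (u x) i j * deriv c x j + (∑ k, B.Γ (u x) i j k * deriv u x k) * c x j)

/-- The bracket of the functionals `∫ a_i u^i dx` and `∫ b_j u^j dx`, evaluated at the loop `u`. -/
def HydroBracket.bracket (B : HydroBracket 𝕜 ι) (a b u : ℝ → ι → 𝕜) : 𝕜 :=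
  ∫ x in (0 : ℝ)..1, ∑ i, a x i * B.ham u b x i

/-- The derivative of the local functional `u ↦ B.bracket a b u` along the variation `w` of the
loop `u`: the density is differentiated with respect to `u^l` (in direction `w^l`) and with respect
to `u^k_x` (in direction `w^k_x`). -/
def HydroBracket.dbracket (B : HydroBracket 𝕜 ι) (a b u w : ℝ → ι → 𝕜) : 𝕜 :=
  ∫ x in (0 : ℝ)..1, ∑ i, ∑ j, a x i *
    ((∑ l, pd l (fun v => B.g v i j) (u x) * w x l) * deriv b x j
      + (∑ k, ((∑ l, pd l (fun v => B.Γ v i j k) (u x) * w x l) * deriv u x k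
          + B.Γ (u x) i j k * deriv w x k)) * b x j)

/-- The bracket is a Poisson bracket on the loop space of `M`: it is skew-symmetric and satisfies the
Jacobi identity `{{A,B},C} + {{B,C},A} + {{C,A},B} = 0` (both tested, as distributions in the
variables `x, y, z`, on smooth functions `a, b, c` on the circle). -/
def HydroBracket.IsPoissonOn (B : HydroBracket 𝕜 ι) (M : Set (ι → 𝕜)) : Prop :=
  (∀ u a b : ℝ → ι → 𝕜, IsLoop u → (∀ x, u x ∈ M) → IsLoop a → IsLoop b →
      B.bracket a b u = - B.bracket b a u) ∧
  ∀ u a b c : ℝ → ι → 𝕜, IsLoop u → (∀ x, u x ∈ M) → IsLoop a → IsLoop b → IsLoop c →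
      B.dbracket a b u (B.ham u c) + B.dbracket b c u (B.ham u a)
        + B.dbracket c a u (B.ham u b) = 0

/-- A bihamiltonian structure: all linear combinations of the two brackets are Poisson. -/
def IsBihamiltonianOn (M : Set (ι → 𝕜)) (B₁ B₂ : HydroBracket 𝕜 ι) : Prop :=
  B₁.SmoothOn M ∧ B₂.SmoothOn M ∧ ∀ s t : 𝕜, (HydroBracket.comb s t B₁ B₂).IsPoissonOn M

/-! ### Hamiltonian flows and tau-structures -/

/-- The evolutionary vector field `u^i_t = {u^i(x), ∫ f(u) dx}`, a function of the jet variables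
`u = v` and `u_x = ξ`:
`g^{ij} ∂_x ∂_j f + Γ^{ij}_k u^k_x ∂_j f`. -/
def HydroBracket.flow (B : HydroBracket 𝕜 ι) (f : (ι → 𝕜) → 𝕜) (v ξ : ι → 𝕜) (i : ι) : 𝕜 :=
  ∑ j, (B.g v i j * (∑ k, pd k (pd j f) v * ξ k) + (∑ k, B.Γ v i j k * ξ k) * pd j f v)

/-- The time derivative of the density `h(u)` along the flow with Hamiltonian `∫ f(u) dx`. -/
def HydroBracket.timeDeriv (B : HydroBracket 𝕜 ι) (h f : (ι → 𝕜) → 𝕜) (v ξ : ι → 𝕜) : 𝕜 :=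
  ∑ i, pd i h v * B.flow f v ξ i

/-- A tau-structure of the pencil `{,}_2 - λ {,}_1`, where `{,}_1 = η^{αβ} δ'(x-y)`.
The levels `p = -1, 0, 1, …` are shifted by one: `φ α p`, `h α p`, `a p q` stand for
`φ_{α,p-1}`, `h_{α,p-1}`, `(a_{αβ,p-1,q-1})`.

* `∑_p φ_{α,p} λ^{-p-1}` is a Casimir of the pencil with leading coefficient
  `φ_{α,-1} = v_α = η_{αε} v^ε`;
* the densities `h_{α,p}` are obtained from the `φ_{β,q}` by an invertible triangular
  transformation with constant coefficients (and are defined up to constants);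
* with `∂/∂t^{i,p} = { · , ∫ h_{i,p} dx}_1` for `p ≥ 0`, one has
  `∂h_{i,p-1}/∂t^{j,q} = ∂h_{j,q-1}/∂t^{i,p}`. -/
structure TauStructure (M : Set (ι → 𝕜)) (η : Matrix ι ι 𝕜) (B₂ : HydroBracket 𝕜 ι) where
  φ : ι → ℕ → (ι → 𝕜) → 𝕜
  a : ℕ → ℕ → Matrix ι ι 𝕜
  h : ι → ℕ → (ι → 𝕜) → 𝕜
  φ_smooth : ∀ α p, ContDiffOn 𝕜 ∞ (φ α p) M
  φ_init : ∀ α, ∀ v ∈ M, φ α 0 v = ∑ ε, η⁻¹ α ε * v ε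
  casimir_init : ∀ α, ∀ v ∈ M, ∀ ξ, (flatBracket η).flow (φ α 0) v ξ = 0
  casimir_succ : ∀ α p, ∀ v ∈ M, ∀ ξ,
    (flatBracket η).flow (φ α (p + 1)) v ξ = B₂.flow (φ α p) v ξ
  a_nondeg : ∀ p, (a p p).det ≠ 0
  h_eq : ∀ α p, ∃ k : 𝕜, ∀ v ∈ M,
    h α p v = (∑ q ∈ Finset.range (p + 1), ∑ β, a p q α β * φ β q v) + k
  symmetric : ∀ i j p q, ∀ v ∈ M, ∀ ξ,
    (flatBracket η).timeDeriv (h i p) (h j (q + 1)) v ξ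
      = (flatBracket η).timeDeriv (h j q) (h i (p + 1)) v ξ

/-- The flat coordinates are the normal coordinates of the tau-structure: `h_{α,-1} = v_α`
(up to constants). -/
def TauStructure.IsNormalized {M : Set (ι → 𝕜)} {η : Matrix ι ι 𝕜} {B₂ : HydroBracket 𝕜 ι}
    (T : TauStructure M η B₂) : Prop :=
  ∀ α, ∃ k : 𝕜, ∀ v ∈ M, T.h α 0 v = (∑ ε, η⁻¹ α ε * v ε) + k

/-- Compatibility with spatial translations, `o` being the distinguished index:
`{ · , h_{o,0}}_1 = a_{oo,00} { · , φ_{o,0}}_1 = ∂/∂x`. -/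
def TauStructure.IsTranslationCompatible {M : Set (ι → 𝕜)} {η : Matrix ι ι 𝕜}
    {B₂ : HydroBracket 𝕜 ι} (T : TauStructure M η B₂) (o : ι) : Prop :=
  ∀ v ∈ M, ∀ ξ, (flatBracket η).flow (T.h o 1) v ξ = ξ ∧
    T.a 1 1 o o • (flatBracket η).flow (T.φ o 1) v ξ = ξ

/-- The matrix `b = a⁻¹`, where `h_{α,0} = a_α^β φ_{β,0} + linear`; `b α β` is `b_α^β`. -/
def TauStructure.b {M : Set (ι → 𝕜)} {η : Matrix ι ι 𝕜} {B₂ : HydroBracket 𝕜 ι}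
    (T : TauStructure M η B₂) : Matrix ι ι 𝕜 :=
  (T.a 1 1)⁻¹

/-- The bihamiltonian structure is semisimple: `det (g_2 - λ g_1) = 0` has pairwise distinct roots,
as many as the dimension, at every point. -/
def IsSemisimplePencil (M : Set (ι → 𝕜)) (η : Matrix ι ι 𝕜) (B₂ : HydroBracket 𝕜 ι) : Prop :=
  ∀ v ∈ M, ∃ r : ι → 𝕜, Function.Injective r ∧ ∀ i, (B₂.g v - r i • η).det = 0

/-! ### Solutions of the associativity equations -/

/-- `c_{αβγ} = ∂_α ∂_β ∂_γ F`. -/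
def c₃ (F : (ι → 𝕜) → 𝕜) (α β γ : ι) (v : ι → 𝕜) : 𝕜 :=
  pd α (pd β (pd γ F)) v

/-- `c^{αβ}_γ = η^{αμ} η^{βν} ∂_μ ∂_ν ∂_γ F`. -/
def cUp (η : Matrix ι ι 𝕜) (F : (ι → 𝕜) → 𝕜) (α β γ : ι) (v : ι → 𝕜) : 𝕜 :=
  ∑ μ, ∑ ν, η α μ * η β ν * c₃ F μ ν γ v

/-- The product on tangent vectors at `v`: `(x·y)^γ = η^{γμ} c_{μαβ} x^α y^β`. -/
def mulAt (η : Matrix ι ι 𝕜) (F : (ι → 𝕜) → 𝕜) (v x y : ι → 𝕜) (γ : ι) : 𝕜 :=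
  ∑ μ, ∑ α, ∑ β, η γ μ * c₃ F μ α β v * x α * y β

/-- The associativity equations. -/
def IsWDVVOn (M : Set (ι → 𝕜)) (η : Matrix ι ι 𝕜) (F : (ι → 𝕜) → 𝕜) : Prop :=
  ∀ v ∈ M, ∀ α β γ δ,
    (∑ l, ∑ m, c₃ F α β l v * η l m * c₃ F m γ δ v)
      = ∑ l, ∑ m, c₃ F δ β l v * η l m * c₃ F m γ α v

/-- `F` is a potential of the second bracket:
`Γ^{αβ}_γ = b^{βε} ∂^α ∂_γ ∂_ε F` and
`g^{αβ} = b^{αε} ∂_ε ∂^β F + b^{βε} ∂_ε ∂^α F + g_0^{αβ}` with a constant `g_0`,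
where `b^{αβ} = η^{αλ} b_λ^β` and `∂^α = η^{αλ} ∂_λ`. -/
def IsPotential (M : Set (ι → 𝕜)) (η b : Matrix ι ι 𝕜) (B₂ : HydroBracket 𝕜 ι)
    (F : (ι → 𝕜) → 𝕜) : Prop :=
  ContDiffOn 𝕜 ∞ F M ∧
  (∀ v ∈ M, ∀ α β γ,
    B₂.Γ v α β γ = ∑ ε, ∑ l, (η * b) β ε * η α l * c₃ F l γ ε v) ∧
  ∃ g₀ : Matrix ι ι 𝕜, ∀ v ∈ M, ∀ α β,
    B₂.g v α β = (∑ ε, ∑ l, (η * b) α ε * η β l * pd ε (pd l F) v)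
      + (∑ ε, ∑ l, (η * b) β ε * η α l * pd ε (pd l F) v) + g₀ α β

/-- A solution `F` of the associativity equations on a domain `M`, in flat coordinates of the
metric `η_{αβ} = (η⁻¹)_{αβ}`, with the constant unity vector field `e`. -/
structure IsUnitalSolution (M : Set (ι → 𝕜)) (η : Matrix ι ι 𝕜) (F : (ι → 𝕜) → 𝕜)
    (e : ι → 𝕜) : Prop where
  isOpen : IsOpen M
  isConnected : IsConnected M
  metric_symm : η.IsSymm
  metric_nondeg : η.det ≠ 0
  smooth : ContDiffOn 𝕜 ∞ F M
  wdvv : IsWDVVOn M η F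
  unity : ∀ v ∈ M, ∀ α β, ∑ ε, e ε * c₃ F ε α β v = η⁻¹ α β

/-- The solution is rigid: every constant invariant symmetric bilinear form is proportional to the
metric. -/
def IsRigidOn (M : Set (ι → 𝕜)) (η : Matrix ι ι 𝕜) (F : (ι → 𝕜) → 𝕜) : Prop :=
  ∀ S : Matrix ι ι 𝕜, S.IsSymm →
    (∀ v ∈ M, ∀ x y z : ι → 𝕜,
      (mulAt η F v x y) ⬝ᵥ (S.mulVec z) = x ⬝ᵥ (S.mulVec (mulAt η F v y z))) →
    ∃ k : 𝕜, S = k • η⁻¹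

/-- The algebras on the tangent spaces are semisimple: each has a basis of idempotents with
pairwise zero products. -/
def IsSemisimpleOn (M : Set (ι → 𝕜)) (η : Matrix ι ι 𝕜) (F : (ι → 𝕜) → 𝕜) : Prop :=
  ∀ v ∈ M, ∃ π : ι → (ι → 𝕜), LinearIndependent 𝕜 π ∧
    ∀ i j, mulAt η F v (π i) (π j) = if i = j then π i else 0

/-- `∂_w F` is a polynomial of degree at most two, for a constant vector field `w`. -/
def IsQuadraticDirection (M : Set (ι → 𝕜)) (F : (ι → 𝕜) → 𝕜) (w : ι → 𝕜) : Prop :=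
  IsQuadraticOn M (fun v => fderiv 𝕜 F v w)

/-- `G = F^w`, that is, `∇G = w·∇F + (1/2) ρ(v)` with a constant antisymmetric operator `ρ`
(written with lower indices). -/
def IsTwist (M : Set (ι → 𝕜)) (η : Matrix ι ι 𝕜) (F : (ι → 𝕜) → 𝕜) (w : ι → 𝕜)
    (G : (ι → 𝕜) → 𝕜) : Prop :=
  ContDiffOn 𝕜 ∞ G M ∧ ∃ ρ : Matrix ι ι 𝕜, ρ.transpose = -ρ ∧ ∀ v ∈ M, ∀ γ,
    pd γ G v = (∑ ε, ∑ ν, ∑ μ, w ε * c₃ F ε γ ν v * η ν μ * pd μ F v)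
      + (1 / 2) * ∑ ν, ρ γ ν * v ν

/-- Frobenius manifold with potential `F`, unity `e`, Euler vector field `E` and charge `d`. -/
structure IsFrobenius (M : Set (ι → 𝕜)) (η : Matrix ι ι 𝕜) (F : (ι → 𝕜) → 𝕜) (e : ι → 𝕜)
    (E : (ι → 𝕜) → (ι → 𝕜)) (d : 𝕜) : Prop extends IsUnitalSolution M η F e where
  linear : IsLinearFieldOn M E
  quasihomogeneous : IsQuadraticOn M (fun v => fderiv 𝕜 F v (E v) - (3 - d) * F v)
  lie : ∀ v ∈ M, VectorField.lieBracket 𝕜 (fun _ => e) E v = e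

/-- Degenerate Frobenius manifold with potential `F`, unity `e`, vector field `E` and
constant `k`. -/
structure IsDegenerateFrobenius (M : Set (ι → 𝕜)) (η : Matrix ι ι 𝕜) (F : (ι → 𝕜) → 𝕜)
    (e : ι → 𝕜) (E : (ι → 𝕜) → (ι → 𝕜)) (k : 𝕜) : Prop extends IsUnitalSolution M η F e where
  linear : IsLinearFieldOn M E
  quasihomogeneous : IsQuadraticOn M (fun v => fderiv 𝕜 F v (E v) - k * F v)
  lie : ∀ v ∈ M, VectorField.lieBracket 𝕜 (fun _ => e) E v = 0

/-- `(∇E)^β_ε = ∂_ε E^β`. -/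
def nablaField (E : (ι → 𝕜) → (ι → 𝕜)) (v : ι → 𝕜) : Matrix ι ι 𝕜 :=
  fun β ε => pd ε (fun y => E y β) v

/-- The metric of the bracket is the intersection form `g^{αβ} = E^ε c_ε^{αβ}`. -/
def IsIntersectionForm (M : Set (ι → 𝕜)) (η : Matrix ι ι 𝕜) (F : (ι → 𝕜) → 𝕜)
    (E : (ι → 𝕜) → (ι → 𝕜)) (B : HydroBracket 𝕜 ι) : Prop :=
  ∀ v ∈ M, ∀ α β, B.g v α β = ∑ ε, E v ε * cUp η F α β ε v

/-- First normal form: a Frobenius manifold with `g^{αβ} = E^ε c_ε^{αβ}` and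
`Γ^{αβ}_γ = c^{αε}_γ (1/2 - μ)^β_ε`, `μ = (2-d)/2 - ∇E`. -/
def IsFrobeniusNormalForm (M : Set (ι → 𝕜)) (η : Matrix ι ι 𝕜) (F : (ι → 𝕜) → 𝕜) (e : ι → 𝕜)
    (E : (ι → 𝕜) → (ι → 𝕜)) (d : 𝕜) (B : HydroBracket 𝕜 ι) : Prop :=
  IsFrobenius M η F e E d ∧ IsIntersectionForm M η F E B ∧
  ∀ v ∈ M, ∀ α β γ, B.Γ v α β γ = ∑ ε, cUp η F α ε γ v *
    ((1 / 2 : 𝕜) • (1 : Matrix ι ι 𝕜)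
      - (((2 - d) / 2) • (1 : Matrix ι ι 𝕜) - nablaField E v)) β ε

/-- Second normal form: a degenerate Frobenius manifold with `g^{αβ} = E^ε c_ε^{αβ}` and
`Γ^{αβ}_γ = - c^{αε}_γ μ^β_ε`, `μ = k/2 - ∇E`. -/
def IsDegenerateNormalForm (M : Set (ι → 𝕜)) (η : Matrix ι ι 𝕜) (F : (ι → 𝕜) → 𝕜) (e : ι → 𝕜)
    (E : (ι → 𝕜) → (ι → 𝕜)) (k : 𝕜) (B : HydroBracket 𝕜 ι) : Prop :=
  IsDegenerateFrobenius M η F e E k ∧ IsIntersectionForm M η F E B ∧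
  ∀ v ∈ M, ∀ α β γ, B.Γ v α β γ = - ∑ ε, cUp η F α ε γ v *
    ((k / 2) • (1 : Matrix ι ι 𝕜) - nablaField E v) β ε

/-! ### Direct products -/

section Product

variable {m : ℕ} {N : Fin m → ℕ}

/-- The component in the `s`-th factor `𝕜^{N s}` of the vector `v`, where `ψ` is a linear change of
coordinates onto the product of the factors. -/
def comp (ψ : (ι → 𝕜) ≃ₗ[𝕜] ((Σ s : Fin m, Fin (N s)) → 𝕜)) (s : Fin m) (v : ι → 𝕜) :
    Fin (N s) → 𝕜 :=
  fun a => ψ v ⟨s, a⟩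

/-- The `s`-th factor `M_s`: the projection of `M`. -/
def factor (ψ : (ι → 𝕜) ≃ₗ[𝕜] ((Σ s : Fin m, Fin (N s)) → 𝕜)) (M : Set (ι → 𝕜)) (s : Fin m) :
    Set (Fin (N s) → 𝕜) :=
  comp ψ s '' M

/-- The coefficients `g` of the bracket in the coordinates `ψ v`, at the point `v`. -/
def gNew (ψ : (ι → 𝕜) ≃ₗ[𝕜] ((Σ s : Fin m, Fin (N s)) → 𝕜)) (B : HydroBracket 𝕜 ι) (v : ι → 𝕜)
    (x y : Σ s : Fin m, Fin (N s)) : 𝕜 :=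
  ∑ α, ∑ β, ψ (Pi.single α 1) x * ψ (Pi.single β 1) y * B.g v α β

/-- The coefficients `Γ` of the bracket in the coordinates `ψ v`, at the point `v`. -/
def ΓNew (ψ : (ι → 𝕜) ≃ₗ[𝕜] ((Σ s : Fin m, Fin (N s)) → 𝕜)) (B : HydroBracket 𝕜 ι) (v : ι → 𝕜)
    (x y z : Σ s : Fin m, Fin (N s)) : 𝕜 :=
  ∑ α, ∑ β, ∑ γ, ψ (Pi.single α 1) x * ψ (Pi.single β 1) y
    * ψ.symm (Pi.single z 1) γ * B.Γ v α β γ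

/-- In the coordinates `ψ v` the bracket `B` is the direct sum of the brackets `Bs s` on the
factors. -/
def IsDirectSum (ψ : (ι → 𝕜) ≃ₗ[𝕜] ((Σ s : Fin m, Fin (N s)) → 𝕜)) (M : Set (ι → 𝕜))
    (B : HydroBracket 𝕜 ι) (Bs : ∀ s, HydroBracket 𝕜 (Fin (N s))) : Prop :=
  ∀ v ∈ M,
    (∀ s a b, gNew ψ B v ⟨s, a⟩ ⟨s, b⟩ = (Bs s).g (comp ψ s v) a b) ∧
    (∀ x y, x.1 ≠ y.1 → gNew ψ B v x y = 0) ∧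
    (∀ s a b c, ΓNew ψ B v ⟨s, a⟩ ⟨s, b⟩ ⟨s, c⟩ = (Bs s).Γ (comp ψ s v) a b c) ∧
    (∀ x y z, ¬ (x.1 = y.1 ∧ y.1 = z.1) → ΓNew ψ B v x y z = 0)

/-- The linear change of coordinates `ψ` identifies `M` with an open domain in the product of the
`M_s = factor ψ M s`, in such a way that the metric, the potential `F` (up to a quadratic
polynomial), the unity `e`, the vector field `E` and the vector `w = c e + ∑ κ_s e_s` decompose,
every factor is rigid, the factors with `κ_s ≠ 0` are Frobenius manifolds of charge
`1 - 2c/κ_s` (with potential `κ_s F_s`, unity `κ_s⁻¹ e_s` and Euler vector field `κ_s⁻¹ pr_s E`), and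
the factors with `κ_s = 0` are degenerate Frobenius manifolds. -/
structure IsDecomposition (M : Set (ι → 𝕜)) (η : Matrix ι ι 𝕜) (F : (ι → 𝕜) → 𝕜) (e : ι → 𝕜)
    (E : (ι → 𝕜) → (ι → 𝕜)) (w : ι → 𝕜) (c : 𝕜)
    (ψ : (ι → 𝕜) ≃ₗ[𝕜] ((Σ s : Fin m, Fin (N s)) → 𝕜))
    (ηs : ∀ s, Matrix (Fin (N s)) (Fin (N s)) 𝕜)
    (Fs : ∀ s, (Fin (N s) → 𝕜) → 𝕜)
    (Es : ∀ s, (Fin (N s) → 𝕜) → (Fin (N s) → 𝕜))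
    (κ : Fin m → 𝕜) : Prop where
  dim_pos : ∀ s, 0 < N s
  metric : IsDirectSum ψ M (flatBracket η) (fun s => flatBracket (ηs s))
  potential : IsQuadraticOn M (fun v => F v - ∑ s, Fs s (comp ψ s v))
  euler : ∀ v ∈ M, ∀ s, comp ψ s (E v) = Es s (comp ψ s v)
  w_eq : ∀ s, comp ψ s w = c • comp ψ s e + κ s • comp ψ s e
  rigid : ∀ s, IsRigidOn (factor ψ M s) (ηs s) (Fs s)
  frobenius : ∀ s, κ s ≠ 0 →
    IsFrobenius (factor ψ M s) (ηs s) (fun y => κ s * Fs s y) ((κ s)⁻¹ • comp ψ s e)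
      (fun y => (κ s)⁻¹ • Es s y) (1 - 2 * c / κ s)
  degenerate : ∀ s, κ s = 0 →
    IsDegenerateFrobenius (factor ψ M s) (ηs s) (Fs s) (comp ψ s e) (Es s) (2 * c)

end Product

end TauFrobenius

end

noncomputable section

namespace TauFrobenius

/-! ### Smooth functions on open sets: derivatives of order two and three -/

section Calculus

set_option maxSynthPendingDepth 6

variable {𝕜 : Type} [RCLike 𝕜] {X Y : Type*} [NormedAddCommGroup X] [NormedSpace 𝕜 X]
  [NormedAddCommGroup Y] [NormedSpace 𝕜 Y] {M : Set X} {f g : X → 𝕜} {v : X}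

/-! Everything is phrased through the third derivative `D3 F v`, a symmetric trilinear form, and the
lowered metric `low η`: the product of tangent vectors is determined by `low η z (x·y) = D3 F v z x
y`. Tau-structure levels below are the mathematical ones; the code shifts them by one, so `T.h j 1`
is h_{j,0}.

Existence of the potential. As φ_{α,-1} is linear, the first Casimir recursion says that Γ is, up to
raising indices, the Hessian of the φ_{α,0}, and after the constant change of basis b, the Hessian
of the h_{ε,0}. Tau-symmetry at the lowest level makes the Hessian of h_{j,0} at (ξ, ∂_i) equal to
that of h_{i,0} at (ξ, ∂_j). So the form Σ h_{j,0} dv^j is closed up to constants; corrected by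
linear terms it has a primitive F on the convex set M. Skew-symmetry of the second bracket gives ∂_k
g^{ij} = Γ^{ij}_k + Γ^{ji}_k, which integrates to the formula for g. Tau-symmetry one level up
expresses the Hessian of h_{β,1} through F; symmetry of the third derivatives of h_{β,1} is
associativity (`isWDVVOn_of_isPotential`).

The field E. Compatibility with translations says that the Hessian of h_{o,0} is the lowered metric,
so e = ∂_o is the unity. Differentiating E with the formula for ∂g shows that E is affine with
linear part A = c + b̄. The second Casimir recursion yields a symmetry of the second metric against
the structure constants (`torsion_free`), which at e becomes g = E^ε c_ε. Comparing this with g as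
an expression in the Hessian of F, one finds that the Hessian of ∂_E F is D2F(Wx, y) + D2F(x, Wy) +
const with W = A + bᵀ. Symmetry of third derivatives makes W self-adjoint for the structure
constants, so W is multiplication by We = w, and the third derivative of ∂_E F is 2 D3F(x, y, w·z)
(`D3_fderiv_euler`, `prodAt_direction`). This is ∂_E F = 2F^w up to quadratics; if w is a multiple
of e it is quasihomogeneity. If F is rigid, w must be such a multiple, because D3F(w) is a constant
invariant form.

Decomposition. The vectors whose multiplication operator does not depend on the point form a
subalgebra of T_{v₀}M ≅ 𝕜^n, hence consist of the functions constant on the classes of a partition;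
let e_s be the indicators. Fourth derivatives of F drop out as soon as one argument is such a
vector, which gives a formula for (Au)·z (`prodAt_mulVec`). It shows that A preserves the subalgebra
and the blocks, that A e_s = κ_s e_s, and hence that w = c e + Σ κ_s e_s. Mixed second derivatives
of F between blocks are constant, so F splits up to a quadratic polynomial. A factor is rigid
because an invariant constant form on it comes from a constant direction inside the block, hence
from a multiple of e_s. Finally, if the pencil has distinct roots, multiplication by E has simple
spectrum and its eigenvectors are, after scaling, orthogonal idempotents. -/

theorem smoothOn_fderiv {f : X → Y} (hM : IsOpen M) (hf : ContDiffOn 𝕜 ∞ f M) :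
    ContDiffOn 𝕜 ∞ (fderiv 𝕜 f) M :=
  ((contDiffOn_infty_iff_fderiv_of_isOpen hM).1 hf).2

theorem differentiableAt_of_smoothOn {f : X → Y} (hM : IsOpen M) (hf : ContDiffOn 𝕜 ∞ f M)
    (hv : v ∈ M) : DifferentiableAt 𝕜 f v :=
  (hf.contDiffAt (hM.mem_nhds hv)).differentiableAt (by simp)

theorem smoothOn_of_fderiv_eq {f : X → Y} {f' : X → X →L[𝕜] Y} (hM : IsOpen M)
    (hf : ∀ v ∈ M, HasFDerivAt f (f' v) v) (hf' : ContDiffOn 𝕜 ∞ f' M) : ContDiffOn 𝕜 ∞ f M :=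
  (contDiffOn_infty_iff_fderiv_of_isOpen hM).2
    ⟨fun v hv => (hf v hv).differentiableAt.differentiableWithinAt,
      hf'.congr fun v hv => (hf v hv).fderiv⟩

theorem fderiv_congr_of_isOpen {f g : X → Y} (hM : IsOpen M) (h : ∀ v ∈ M, f v = g v)
    (hv : v ∈ M) : fderiv 𝕜 f v = fderiv 𝕜 g v :=
  Filter.EventuallyEq.fderiv_eq (Filter.eventuallyEq_of_mem (hM.mem_nhds hv) h)

theorem smoothOn_fderiv_apply (hM : IsOpen M) (hf : ContDiffOn 𝕜 ∞ f M) (x : X) :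
    ContDiffOn 𝕜 ∞ (fun u => fderiv 𝕜 f u x) M :=
  (smoothOn_fderiv hM hf).clm_apply contDiffOn_const

theorem fderiv_fderiv_apply {f : X → X →L[𝕜] Y} (hf : DifferentiableAt 𝕜 f v) (x y : X) :
    fderiv 𝕜 (fun u => f u y) v x = fderiv 𝕜 f v x y := by
  rw [(hf.hasFDerivAt.clm_apply (hasFDerivAt_const y v)).fderiv]
  simp

/-- The second derivative. -/
def D2 (f : X → 𝕜) (v : X) : X →L[𝕜] X →L[𝕜] 𝕜 := fderiv 𝕜 (fderiv 𝕜 f) v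

/-- The third derivative. -/
def D3 (f : X → 𝕜) (v : X) : X →L[𝕜] X →L[𝕜] X →L[𝕜] 𝕜 := fderiv 𝕜 (D2 f) v

theorem smoothOn_D2 (hM : IsOpen M) (hf : ContDiffOn 𝕜 ∞ f M) : ContDiffOn 𝕜 ∞ (D2 f) M :=
  smoothOn_fderiv hM (smoothOn_fderiv hM hf)

theorem fderiv_fderiv_eq_D2 (hM : IsOpen M) (hf : ContDiffOn 𝕜 ∞ f M) (hv : v ∈ M) (x y : X) :
    fderiv 𝕜 (fun u => fderiv 𝕜 f u y) v x = D2 f v x y :=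
  fderiv_fderiv_apply (differentiableAt_of_smoothOn hM (smoothOn_fderiv hM hf) hv) x y

theorem fderiv_D2_eq_D3 (hM : IsOpen M) (hf : ContDiffOn 𝕜 ∞ f M) (hv : v ∈ M) (x y z : X) :
    fderiv 𝕜 (fun u => D2 f u y z) v x = D3 f v x y z := by
  have h := differentiableAt_of_smoothOn hM (smoothOn_D2 hM hf) hv
  rw [fderiv_fderiv_apply (f := fun u => D2 f u y) (h.clm_apply (differentiableAt_const y)),
    fderiv_fderiv_apply h]
  rfl

theorem D2_symm (hM : IsOpen M) (hf : ContDiffOn 𝕜 ∞ f M) (hv : v ∈ M) (x y : X) :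
    D2 f v x y = D2 f v y x :=
  (hf.contDiffAt (hM.mem_nhds hv)).isSymmSndFDerivAt
    (by rw [minSmoothness_of_isRCLikeNormedField]; exact WithTop.coe_le_coe.2 le_top) x y

theorem D3_symm_right (hM : IsOpen M) (hf : ContDiffOn 𝕜 ∞ f M) (hv : v ∈ M) (x y z : X) :
    D3 f v x y z = D3 f v x z y := by
  rw [← fderiv_D2_eq_D3 hM hf hv, ← fderiv_D2_eq_D3 hM hf hv,
    fderiv_congr_of_isOpen hM (fun u hu => D2_symm hM hf hu y z) hv]

/-- For a fixed last argument `z`, the third derivative is the Hessian of `∂_z f`, so symmetry of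
second derivatives applies. -/
theorem D3_symm_left (hM : IsOpen M) (hf : ContDiffOn 𝕜 ∞ f M) (hv : v ∈ M) (x y z : X) :
    D3 f v x y z = D3 f v y x z := by
  have key : ∀ x y z, D3 f v x y z = D2 (fun u => fderiv 𝕜 f u z) v x y := by
    intro x y z
    rw [← fderiv_D2_eq_D3 hM hf hv, ← fderiv_fderiv_eq_D2 hM (smoothOn_fderiv_apply hM hf z) hv,
      fderiv_congr_of_isOpen hM (fun u hu => (fderiv_fderiv_eq_D2 hM hf hu y z).symm) hv]
  rw [key, key, D2_symm hM (smoothOn_fderiv_apply hM hf z) hv]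

theorem fderiv3_eq_D3 (hM : IsOpen M) (hf : ContDiffOn 𝕜 ∞ f M) (hv : v ∈ M) (x y z : X) :
    fderiv 𝕜 (fun u => fderiv 𝕜 (fun u' => fderiv 𝕜 f u' z) u y) v x = D3 f v x y z := by
  rw [← fderiv_D2_eq_D3 hM hf hv,
    fderiv_congr_of_isOpen hM (fun u hu => fderiv_fderiv_eq_D2 hM hf hu y z) hv]

theorem D2_congr (hM : IsOpen M) (h : ∀ v ∈ M, f v = g v) (hv : v ∈ M) : D2 f v = D2 g v :=
  fderiv_congr_of_isOpen hM (fun _ hu => fderiv_congr_of_isOpen hM h hu) hv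

theorem D3_congr (hM : IsOpen M) (h : ∀ v ∈ M, f v = g v) (hv : v ∈ M) : D3 f v = D3 g v :=
  fderiv_congr_of_isOpen (f := D2 f) (g := D2 g) hM (fun _ hu => D2_congr hM h hu) hv

theorem D2_add (hM : IsOpen M) (hf : ContDiffOn 𝕜 ∞ f M) (hg : ContDiffOn 𝕜 ∞ g M) (hv : v ∈ M) :
    D2 (fun u => f u + g u) v = D2 f v + D2 g v := by
  unfold D2
  rw [fderiv_congr_of_isOpen hM (fun u hu => fderiv_fun_add (differentiableAt_of_smoothOn hM hf hu)
    (differentiableAt_of_smoothOn hM hg hu)) hv]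
  exact fderiv_fun_add (differentiableAt_of_smoothOn hM (smoothOn_fderiv hM hf) hv)
    (differentiableAt_of_smoothOn hM (smoothOn_fderiv hM hg) hv)

theorem D3_add (hM : IsOpen M) (hf : ContDiffOn 𝕜 ∞ f M) (hg : ContDiffOn 𝕜 ∞ g M) (hv : v ∈ M) :
    D3 (fun u => f u + g u) v = D3 f v + D3 g v := by
  unfold D3
  rw [fderiv_congr_of_isOpen (f := D2 fun u => f u + g u) hM (fun u hu => D2_add hM hf hg hu) hv]
  exact fderiv_fun_add (differentiableAt_of_smoothOn hM (smoothOn_D2 hM hf) hv)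
    (differentiableAt_of_smoothOn hM (smoothOn_D2 hM hg) hv)

theorem D2_const_mul (hM : IsOpen M) (hf : ContDiffOn 𝕜 ∞ f M) (k : 𝕜) (hv : v ∈ M) :
    D2 (fun u => k * f u) v = k • D2 f v := by
  unfold D2
  rw [fderiv_congr_of_isOpen hM (fun u hu => fderiv_const_mul
    (differentiableAt_of_smoothOn hM hf hu) k) hv]
  exact fderiv_fun_const_smul (differentiableAt_of_smoothOn hM (smoothOn_fderiv hM hf) hv) k

theorem D3_const_mul (hM : IsOpen M) (hf : ContDiffOn 𝕜 ∞ f M) (k : 𝕜) (hv : v ∈ M) :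
    D3 (fun u => k * f u) v = k • D3 f v := by
  unfold D3
  rw [fderiv_congr_of_isOpen (f := D2 fun u => k * f u) hM (fun u hu => D2_const_mul hM hf k hu) hv]
  exact fderiv_fun_const_smul (differentiableAt_of_smoothOn hM (smoothOn_D2 hM hf) hv) k

theorem D3_sub (hM : IsOpen M) (hf : ContDiffOn 𝕜 ∞ f M) (hg : ContDiffOn 𝕜 ∞ g M) (hv : v ∈ M) :
    D3 (fun u => f u - g u) v = D3 f v - D3 g v := by
  have h := D3_add hM hf (contDiffOn_const.mul hg : ContDiffOn 𝕜 ∞ (fun u => (-1 : 𝕜) * g u) M) hv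
  rw [D3_const_mul hM hg (-1) hv] at h
  simpa [sub_eq_add_neg, neg_smul] using h

theorem D2_sub (hM : IsOpen M) (hf : ContDiffOn 𝕜 ∞ f M) (hg : ContDiffOn 𝕜 ∞ g M) (hv : v ∈ M) :
    D2 (fun u => f u - g u) v = D2 f v - D2 g v := by
  have h := D2_add hM hf (contDiffOn_const.mul hg : ContDiffOn 𝕜 ∞ (fun u => (-1 : 𝕜) * g u) M) hv
  rw [D2_const_mul hM hg (-1) hv] at h
  simpa [sub_eq_add_neg, neg_smul] using h

/-- A function whose second derivative is constant has an affine first derivative. -/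
theorem exists_affine_of_fderiv_const [NormedSpace ℝ X] (hM : IsOpen M) (hMc : IsPreconnected M)
    {f : X → Y}
    (hf : DifferentiableOn 𝕜 f M) {L : X →L[𝕜] Y} (h : ∀ v ∈ M, fderiv 𝕜 f v = L) :
    ∃ k, ∀ v ∈ M, f v = L v + k := by
  obtain ⟨k, hk⟩ := hM.exists_eq_add_of_fderiv_eq hMc hf (L.differentiable.differentiableOn)
    (fun v hv => by rw [h v hv, L.fderiv])
  exact ⟨k, hk⟩

/-- The derivative of a quadratic polynomial. -/
theorem hasFDerivAt_quadratic (C : X →L[𝕜] X →L[𝕜] 𝕜) (l : X →L[𝕜] 𝕜) (r : 𝕜) (v : X) :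
    HasFDerivAt (fun u => C u u + l u + r) (C v + C.flip v + l) v := by
  have h := ((C.hasFDerivAt.clm_apply (hasFDerivAt_id v)).add l.hasFDerivAt).add_const r
  refine h.congr_fderiv ?_
  ext x
  simp

theorem fderiv_quadratic (C : X →L[𝕜] X →L[𝕜] 𝕜) (l : X →L[𝕜] 𝕜) (r : 𝕜) :
    fderiv 𝕜 (fun u => C u u + l u + r) = fun v => C v + C.flip v + l :=
  funext fun v => (hasFDerivAt_quadratic C l r v).fderiv

theorem D2_quadratic (C : X →L[𝕜] X →L[𝕜] 𝕜) (l : X →L[𝕜] 𝕜) (r : 𝕜) (v : X) :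
    D2 (fun u => C u u + l u + r) v = C + C.flip := by
  unfold D2
  rw [fderiv_quadratic]
  exact ((C.hasFDerivAt.add C.flip.hasFDerivAt).add_const l).fderiv

theorem D3_quadratic (C : X →L[𝕜] X →L[𝕜] 𝕜) (l : X →L[𝕜] 𝕜) (r : 𝕜) (v : X) :
    D3 (fun u => C u u + l u + r) v = 0 := by
  unfold D3
  rw [show D2 (fun u => C u u + l u + r) = fun _ => C + C.flip from
    funext fun v => D2_quadratic C l r v]
  simp

theorem smooth_quadratic (C : X →L[𝕜] X →L[𝕜] 𝕜) (l : X →L[𝕜] 𝕜) (r : 𝕜) :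
    ContDiff 𝕜 ∞ (fun u => C u u + l u + r) := by
  fun_prop

/-- A function with vanishing third derivative is a quadratic polynomial. -/
theorem exists_quadratic_of_D3_eq_zero [NormedSpace ℝ X] (hM : IsOpen M) (hMc : IsPreconnected M)
    (hf : ContDiffOn 𝕜 ∞ f M) (h : ∀ v ∈ M, D3 f v = 0) :
    ∃ (C : X →L[𝕜] X →L[𝕜] 𝕜) (l : X →L[𝕜] 𝕜) (r : 𝕜), ∀ v ∈ M, f v = C v v + l v + r := by
  rcases M.eq_empty_or_nonempty with rfl | ⟨v₀, hv₀⟩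
  · exact ⟨0, 0, 0, by simp⟩
  obtain ⟨C, hC⟩ := hM.exists_is_const_of_fderiv_eq_zero hMc
    ((smoothOn_D2 hM hf).differentiableOn (by simp)) h
  obtain ⟨l, hl⟩ := exists_affine_of_fderiv_const hM hMc
    ((smoothOn_fderiv hM hf).differentiableOn (by simp)) hC
  -- The candidate is half of `C v v` plus an affine part; its gradient is `C v + l` only because
  -- the Hessian `C` is symmetric.
  have hsymm : C.flip = C := by
    ext x y
    rw [← hC v₀ hv₀, ContinuousLinearMap.flip_apply, D2_symm hM hf hv₀]
  obtain ⟨r, hr⟩ := hM.exists_eq_add_of_fderiv_eq (g := fun u => ((1 / 2 : 𝕜) • C) u u + l u + 0)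
    hMc (hf.differentiableOn (by simp))
    ((smooth_quadratic _ l 0).differentiable (by simp)).differentiableOn
    (fun v hv => by
      rw [fderiv_quadratic, hl v hv]
      ext x
      have : C.flip v x = C v x := by rw [hsymm]
      rw [ContinuousLinearMap.flip_apply] at this
      simp [this]
      ring)
  exact ⟨(1 / 2 : 𝕜) • C, l, r, fun v hv => by simpa using hr hv⟩

/-- The Poincaré lemma for smooth closed forms of degree one on convex open sets. -/
theorem exists_primitive_of_closed [NormedSpace ℝ X] [IsScalarTower ℝ 𝕜 X] (hM : IsOpen M)
    (hMc : Convex ℝ M)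
    {θ : X → X →L[𝕜] 𝕜} (hθ : ContDiffOn 𝕜 ∞ θ M)
    (hclosed : ∀ v ∈ M, ∀ x y, fderiv 𝕜 θ v x y = fderiv 𝕜 θ v y x) :
    ∃ f : X → 𝕜, ContDiffOn 𝕜 ∞ f M ∧ ∀ v ∈ M, HasFDerivAt f (θ v) v := by
  have hd : ∀ v ∈ M, HasFDerivAt θ ((fderiv 𝕜 θ v).restrictScalars ℝ) v := fun v hv =>
    (differentiableAt_of_smoothOn hM hθ hv).hasFDerivAt.restrictScalars ℝ
  obtain ⟨f, hf⟩ := hMc.exists_forall_hasFDerivAt_of_fderiv_symmetric hM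
    (fun v hv => (hd v hv).differentiableAt.differentiableWithinAt)
    (fun v hv x y => by
      rw [(hd v hv).fderiv]
      exact hclosed v hv x y)
  exact ⟨f, smoothOn_of_fderiv_eq hM hf hθ, hf⟩

/-- The first two derivatives of `∂_E f` for an affine vector field `E`. -/
theorem fderiv_apply_affine (hM : IsOpen M) (hf : ContDiffOn 𝕜 ∞ f M) (A : X →L[𝕜] X) (r : X)
    (hv : v ∈ M) (x : X) :
    fderiv 𝕜 (fun u => fderiv 𝕜 f u (A u + r)) v x = D2 f v x (A v + r) + fderiv 𝕜 f v (A x) := by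
  have h := (differentiableAt_of_smoothOn hM (smoothOn_fderiv hM hf) hv).hasFDerivAt.clm_apply
    (A.hasFDerivAt.add_const r (x := v))
  rw [h.fderiv]
  simp [D2, add_comm]

theorem smoothOn_fderiv_apply_affine (hM : IsOpen M) (hf : ContDiffOn 𝕜 ∞ f M) (A : X →L[𝕜] X)
    (r : X) : ContDiffOn 𝕜 ∞ (fun u => fderiv 𝕜 f u (A u + r)) M :=
  (smoothOn_fderiv hM hf).clm_apply (A.contDiff.add contDiff_const).contDiffOn

theorem D2_apply_affine (hM : IsOpen M) (hf : ContDiffOn 𝕜 ∞ f M) (A : X →L[𝕜] X) (r : X)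
    (hv : v ∈ M) (x y : X) :
    D2 (fun u => fderiv 𝕜 f u (A u + r)) v x y
      = D3 f v (A v + r) x y + D2 f v (A x) y + D2 f v x (A y) := by
  rw [← fderiv_fderiv_eq_D2 hM (smoothOn_fderiv_apply_affine hM hf A r) hv,
    fderiv_congr_of_isOpen hM (fun u hu => fderiv_apply_affine hM hf A r hu y) hv]
  have h2 := (differentiableAt_of_smoothOn hM (smoothOn_D2 hM hf) hv).hasFDerivAt
  have h1 := (differentiableAt_of_smoothOn hM (smoothOn_fderiv hM hf) hv).hasFDerivAt
  have h := ((h2.clm_apply (hasFDerivAt_const y v)).clm_apply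
    (A.hasFDerivAt.add_const r (x := v))).add (h1.clm_apply (hasFDerivAt_const (A y) v))
  have h' := h.fderiv
  simp only [Pi.add_def] at h'
  rw [h']
  have e1 : fderiv 𝕜 (D2 f) v x y (A v + r) = D3 f v (A v + r) x y := by
    change D3 f v x y (A v + r) = _
    rw [D3_symm_right hM hf hv, D3_symm_left hM hf hv]
  have e2 : fderiv 𝕜 (fderiv 𝕜 f) v x (A y) = D2 f v x (A y) := rfl
  simp only [add_apply, ContinuousLinearMap.comp_apply,
    ContinuousLinearMap.flip_apply, zero_apply, map_zero, zero_add]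
  simp only [e1, e2, D2_symm hM hf hv y (A x)]
  ring

end Calculus

/-! ### Coordinates -/

section Coordinates

set_option maxSynthPendingDepth 6

open Matrix

variable {𝕜 : Type} [RCLike 𝕜] {ι : Type} [Fintype ι] [DecidableEq ι]
  {M : Set (ι → 𝕜)} {η : Matrix ι ι 𝕜} {F f : (ι → 𝕜) → 𝕜} {v e : ι → 𝕜}

theorem clm_eq_sum {Y : Type*} [NormedAddCommGroup Y] [NormedSpace 𝕜 Y] (L : (ι → 𝕜) →L[𝕜] Y)
    (x : ι → 𝕜) : L x = ∑ α, x α • L (Pi.single α 1) := by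
  conv_lhs => rw [pi_eq_sum_univ' x]
  rw [map_sum]
  refine Finset.sum_congr rfl fun α _ => ?_
  rw [← map_smul]

/-- Nested uses of this principle reduce multilinear identities in several vectors to basis vectors,
that is, to their coordinate form. -/
theorem vec_induction {p : (ι → 𝕜) → Prop} (hb : ∀ α, p (Pi.single α 1)) (h0 : p 0)
    (ha : ∀ x y, p x → p y → p (x + y)) (hs : ∀ (k : 𝕜) x, p x → p (k • x)) (x : ι → 𝕜) : p x := by
  have h : x ∈ Submodule.span 𝕜 (Set.range (Pi.basisFun 𝕜 ι)) := by
    rw [(Pi.basisFun 𝕜 ι).span_eq]; trivial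
  induction h using Submodule.span_induction with
  | mem x hx =>
    obtain ⟨α, rfl⟩ := hx
    simpa using hb α
  | zero => exact h0
  | add x y _ _ hx hy => exact ha x y hx hy
  | smul k x _ hx => exact hs k x hx

theorem pd_pd_eq_D2 (hM : IsOpen M) (hf : ContDiffOn 𝕜 ∞ f M) (hv : v ∈ M) (α β : ι) :
    pd α (pd β f) v = D2 f v (Pi.single α 1) (Pi.single β 1) :=
  fderiv_fderiv_eq_D2 hM hf hv _ _

theorem c₃_eq_D3 (hM : IsOpen M) (hf : ContDiffOn 𝕜 ∞ f M) (hv : v ∈ M) (α β γ : ι) :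
    c₃ f α β γ v = D3 f v (Pi.single α 1) (Pi.single β 1) (Pi.single γ 1) :=
  fderiv3_eq_D3 hM hf hv _ _ _

theorem pd_congr {g : (ι → 𝕜) → 𝕜} (hM : IsOpen M) (h : ∀ u ∈ M, f u = g u) (hv : v ∈ M) (α : ι) :
    pd α f v = pd α g v := by
  unfold pd
  rw [fderiv_congr_of_isOpen hM h hv]

theorem smoothOn_pd (hM : IsOpen M) (hf : ContDiffOn 𝕜 ∞ f M) (α : ι) :
    ContDiffOn 𝕜 ∞ (pd α f) M :=
  smoothOn_fderiv_apply hM hf _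

theorem isQuadraticOn_iff : IsQuadraticOn M f ↔ ∃ (C : (ι → 𝕜) →L[𝕜] (ι → 𝕜) →L[𝕜] 𝕜)
    (l : (ι → 𝕜) →L[𝕜] 𝕜) (r : 𝕜), ∀ v ∈ M, f v = C v v + l v + r := by
  constructor
  · rintro ⟨Q, q, r, h⟩
    refine ⟨∑ α, ∑ β, Q α β • (ContinuousLinearMap.proj (R := 𝕜) (φ := fun _ : ι => 𝕜) α).smulRight
      (ContinuousLinearMap.proj (R := 𝕜) (φ := fun _ : ι => 𝕜) β),
      ∑ α, q α • ContinuousLinearMap.proj (R := 𝕜) (φ := fun _ : ι => 𝕜) α, r, fun v hv => ?_⟩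
    rw [h v hv]
    simp [mul_assoc]
  · rintro ⟨C, l, r, h⟩
    refine ⟨fun α β => C (Pi.single α 1) (Pi.single β 1), fun α => l (Pi.single α 1), r,
      fun v hv => ?_⟩
    rw [h v hv, clm_eq_sum l v, clm_eq_sum C v]
    simp only [_root_.sum_apply, _root_.smul_apply, smul_eq_mul]
    congr 2
    · refine Finset.sum_congr rfl fun α _ => ?_
      rw [clm_eq_sum (C (Pi.single α 1)) v, Finset.mul_sum]
      refine Finset.sum_congr rfl fun β _ => ?_
      rw [smul_eq_mul]; ring
    · exact Finset.sum_congr rfl fun α _ => mul_comm _ _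

theorem isQuadraticOn_of_D3 (hM : IsOpen M) (hMc : IsPreconnected M) (hf : ContDiffOn 𝕜 ∞ f M)
    (h : ∀ v ∈ M, D3 f v = 0) : IsQuadraticOn M f :=
  isQuadraticOn_iff.2 (exists_quadratic_of_D3_eq_zero hM hMc hf h)

theorem IsQuadraticOn.D3_eq_zero (hM : IsOpen M) (h : IsQuadraticOn M f) (hv : v ∈ M) :
    D3 f v = 0 := by
  obtain ⟨C, l, r, h⟩ := isQuadraticOn_iff.1 h
  rw [D3_congr hM h hv, D3_quadratic]

theorem IsQuadraticOn.exists_D2_eq (hM : IsOpen M) (h : IsQuadraticOn M f) :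
    ∃ C, ∀ v ∈ M, D2 f v = C := by
  obtain ⟨C, l, r, h⟩ := isQuadraticOn_iff.1 h
  exact ⟨C + C.flip, fun v hv => by rw [D2_congr hM h hv, D2_quadratic]⟩

theorem D3_eq_of_c₃_eq {g : (ι → 𝕜) → 𝕜} (hM : IsOpen M) (hf : ContDiffOn 𝕜 ∞ f M)
    (hg : ContDiffOn 𝕜 ∞ g M) (hv : v ∈ M) (h : ∀ α β γ, c₃ f α β γ v = c₃ g α β γ v) :
    D3 f v = D3 g v := by
  ext x y z
  simp only [c₃_eq_D3 hM hf hv, c₃_eq_D3 hM hg hv] at h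
  revert x y z
  refine vec_induction (fun α => vec_induction (fun β => vec_induction (fun γ => h α β γ)
    ?_ ?_ ?_) ?_ ?_ ?_) ?_ ?_ ?_ <;> intros <;> simp_all

/-- The lowered metric as a bilinear form. -/
def low (η : Matrix ι ι 𝕜) : (ι → 𝕜) →ₗ[𝕜] (ι → 𝕜) →ₗ[𝕜] 𝕜 := Matrix.toLinearMap₂' 𝕜 η⁻¹

theorem low_apply (x y : ι → 𝕜) : low η x y = x ⬝ᵥ (η⁻¹ *ᵥ y) :=
  Matrix.toLinearMap₂'_apply' _ _ _

theorem low_single (α β : ι) : low η (Pi.single α 1) (Pi.single β 1) = η⁻¹ α β := by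
  simp [low_apply]

theorem low_symm (hη : η.IsSymm) (x y : ι → 𝕜) : low η x y = low η y x := by
  have h : (η⁻¹)ᵀ = η⁻¹ := by rw [Matrix.transpose_nonsing_inv, hη.eq]
  rw [low_apply, low_apply, dotProduct_comm, Matrix.dotProduct_mulVec, ← Matrix.mulVec_transpose,
    h, dotProduct_comm, dotProduct_comm]

/-- Nondegeneracy of the metric. Identities between tangent vectors are proved below by pairing them
with an arbitrary `z`. -/
theorem eq_of_low_eq (hη : η.det ≠ 0) {x y : ι → 𝕜} (h : ∀ z, low η z x = low η z y) : x = y := by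
  have h' : η⁻¹ *ᵥ x = η⁻¹ *ᵥ y := by
    ext α
    simpa [low_apply] using h (Pi.single α 1)
  have := congrArg (η *ᵥ ·) h'
  simpa [Matrix.mulVec_mulVec, Matrix.mul_nonsing_inv _ (isUnit_iff_ne_zero.2 hη)] using this

/-- The product of tangent vectors, as a bilinear map. -/
def prodAt (η : Matrix ι ι 𝕜) (F : (ι → 𝕜) → 𝕜) (v : ι → 𝕜) :
    (ι → 𝕜) →ₗ[𝕜] (ι → 𝕜) →ₗ[𝕜] (ι → 𝕜) :=
  LinearMap.mk₂ 𝕜 (fun x y => η *ᵥ fun μ => D3 F v (Pi.single μ 1) x y)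
    (fun x x' y => by rw [← Matrix.mulVec_add]; congr 1; ext μ; simp)
    (fun k x y => by rw [← Matrix.mulVec_smul]; congr 1; ext μ; simp)
    (fun x y y' => by rw [← Matrix.mulVec_add]; congr 1; ext μ; simp)
    (fun k x y => by rw [← Matrix.mulVec_smul]; congr 1; ext μ; simp)

theorem prodAt_apply (x y : ι → 𝕜) :
    prodAt η F v x y = η *ᵥ fun μ => D3 F v (Pi.single μ 1) x y := rfl

theorem D3_eq_sum (T : (ι → 𝕜) →L[𝕜] (ι → 𝕜) →L[𝕜] 𝕜) (x y : ι → 𝕜) :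
    T x y = ∑ α, ∑ β, T (Pi.single α 1) (Pi.single β 1) * x α * y β := by
  rw [clm_eq_sum T x, _root_.sum_apply]
  refine Finset.sum_congr rfl fun α _ => ?_
  rw [_root_.smul_apply, clm_eq_sum (T (Pi.single α 1)) y, Finset.smul_sum]
  refine Finset.sum_congr rfl fun β _ => ?_
  simp only [smul_eq_mul]; ring

theorem mulAt_eq_prodAt (hM : IsOpen M) (hF : ContDiffOn 𝕜 ∞ F M) (hv : v ∈ M) (x y : ι → 𝕜) :
    mulAt η F v x y = prodAt η F v x y := by
  ext γ
  simp only [mulAt, prodAt_apply, Matrix.mulVec, dotProduct]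
  refine Finset.sum_congr rfl fun μ _ => ?_
  rw [D3_eq_sum (D3 F v (Pi.single μ 1)) x y, Finset.mul_sum]
  refine Finset.sum_congr rfl fun α _ => ?_
  rw [Finset.mul_sum]
  refine Finset.sum_congr rfl fun β _ => ?_
  rw [c₃_eq_D3 hM hF hv]; ring

/-- Lowering the free index of the product cancels `η`. This is the bridge between the algebra on
tangent vectors and the symmetric form `D3 F v`. -/
theorem low_prodAt (hη : η.det ≠ 0) (x y z : ι → 𝕜) :
    low η z (prodAt η F v x y) = D3 F v z x y := by
  rw [low_apply, prodAt_apply, Matrix.mulVec_mulVec,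
    Matrix.nonsing_inv_mul _ (isUnit_iff_ne_zero.2 hη), Matrix.one_mulVec, clm_eq_sum (D3 F v) z]
  simp [dotProduct]

theorem sum_D3_mul_D3 (x y z u : ι → 𝕜) :
    ∑ l, ∑ m, D3 F v x y (Pi.single l 1) * η l m * D3 F v (Pi.single m 1) z u
      = D3 F v x y (prodAt η F v z u) := by
  rw [clm_eq_sum (D3 F v x y) (prodAt η F v z u)]
  refine Finset.sum_congr rfl fun l _ => ?_
  simp only [prodAt_apply, Matrix.mulVec, dotProduct, Finset.sum_mul, smul_eq_mul]
  exact Finset.sum_congr rfl fun m _ => by ring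

theorem isWDVVOn_iff (hM : IsOpen M) (hF : ContDiffOn 𝕜 ∞ F M) : IsWDVVOn M η F ↔
    ∀ v ∈ M, ∀ x y z u, D3 F v x y (prodAt η F v z u) = D3 F v u y (prodAt η F v z x) := by
  have key : ∀ v ∈ M, ∀ α β γ δ, (∑ l, ∑ m, c₃ F α β l v * η l m * c₃ F m γ δ v)
      = D3 F v (Pi.single α 1) (Pi.single β 1) (prodAt η F v (Pi.single γ 1) (Pi.single δ 1)) := by
    intro v hv α β γ δ
    simp only [c₃_eq_D3 hM hF hv]
    exact sum_D3_mul_D3 _ _ _ _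
  constructor
  · intro h v hv
    refine vec_induction (fun α => vec_induction (fun β => vec_induction (fun γ =>
      vec_induction (fun δ => ?_) ?_ ?_ ?_) ?_ ?_ ?_) ?_ ?_ ?_) ?_ ?_ ?_
    · rw [← key v hv, ← key v hv, h v hv]
    all_goals intros; simp_all
  · intro h v hv α β γ δ
    rw [key v hv, key v hv, h v hv]

/-! ### Solutions with a unity -/

theorem prodAt_comm (hM : IsOpen M) (hF : ContDiffOn 𝕜 ∞ F M) (hv : v ∈ M) (x y : ι → 𝕜) :
    prodAt η F v x y = prodAt η F v y x := by
  rw [prodAt_apply, prodAt_apply]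
  congr 1
  ext μ
  exact D3_symm_right hM hF hv _ _ _

theorem unity_iff (hM : IsOpen M) (hF : ContDiffOn 𝕜 ∞ F M) (hv : v ∈ M) :
    (∀ α β, ∑ ε, e ε * c₃ F ε α β v = η⁻¹ α β) ↔ ∀ x y, D3 F v e x y = low η x y := by
  have key : ∀ α β, ∑ ε, e ε * c₃ F ε α β v = D3 F v e (Pi.single α 1) (Pi.single β 1) := by
    intro α β
    rw [clm_eq_sum (D3 F v) e]
    simp [c₃_eq_D3 hM hF hv]
  constructor
  · intro h
    refine vec_induction (fun α => vec_induction (fun β => ?_) ?_ ?_ ?_) ?_ ?_ ?_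
    · rw [← key, h, low_single]
    all_goals intros; simp_all
  · intro h α β
    rw [key, h, low_single]

namespace IsUnitalSolution

theorem D3_unity (h : IsUnitalSolution M η F e) (hv : v ∈ M) (x y : ι → 𝕜) :
    D3 F v e x y = low η x y :=
  (unity_iff h.isOpen h.smooth hv).1 (h.unity v hv) x y

theorem prod_comm (h : IsUnitalSolution M η F e) (hv : v ∈ M) (x y : ι → 𝕜) :
    prodAt η F v x y = prodAt η F v y x :=
  prodAt_comm h.isOpen h.smooth hv x y

theorem unity_prod (h : IsUnitalSolution M η F e) (hv : v ∈ M) (x : ι → 𝕜) : prodAt η F v e x = x :=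
  eq_of_low_eq h.metric_nondeg fun z => by
    rw [low_prodAt h.metric_nondeg, D3_symm_left h.isOpen h.smooth hv, h.D3_unity hv]

theorem prod_unity (h : IsUnitalSolution M η F e) (hv : v ∈ M) (x : ι → 𝕜) :
    prodAt η F v x e = x := by
  rw [h.prod_comm hv, h.unity_prod hv]

/-- After pairing with `u`, both bracketings are values of `D3 F v` on a product; WDVV exchanges the
outer arguments of such a value, and the rest is symmetry. -/
theorem prod_assoc (h : IsUnitalSolution M η F e) (hv : v ∈ M) (x y z : ι → 𝕜) :
    prodAt η F v (prodAt η F v x y) z = prodAt η F v x (prodAt η F v y z) :=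
  eq_of_low_eq h.metric_nondeg fun u => by
    have hw := (isWDVVOn_iff h.isOpen h.smooth).1 h.wdvv v hv
    rw [low_prodAt h.metric_nondeg, low_prodAt h.metric_nondeg,
      D3_symm_right h.isOpen h.smooth hv, h.prod_comm hv x y, hw u z y x, hw u x y z,
      D3_symm_left h.isOpen h.smooth hv]

end IsUnitalSolution

end Coordinates

/-! ### Skew-symmetric brackets -/

section Skew

variable {𝕜 : Type} [RCLike 𝕜] {ι : Type} [Fintype ι] [DecidableEq ι]
  {M : Set (ι → 𝕜)} {B : HydroBracket 𝕜 ι}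

theorem contDiff_ofReal {f : ℝ → ℝ} (hf : ContDiff ℝ ∞ f) :
    ContDiff ℝ ∞ fun x => (f x : 𝕜) :=
  (RCLike.ofRealCLM (K := 𝕜)).contDiff.comp hf

theorem intervalIntegral_ofReal {f : ℝ → ℝ} (hf : Continuous f) (a b : ℝ) :
    ∫ x in a..b, (f x : 𝕜) = ((∫ x in a..b, f x : ℝ) : 𝕜) :=
  (RCLike.ofRealCLM (K := 𝕜)).intervalIntegral_comp_comm (hf.intervalIntegrable a b)

theorem hasDerivAt_ofReal {f : ℝ → ℝ} {f' x : ℝ} (hf : HasDerivAt f f' x) :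
    HasDerivAt (fun x => (f x : 𝕜)) (f' : 𝕜) x :=
  (RCLike.ofRealCLM (K := 𝕜)).hasFDerivAt.comp_hasDerivAt x hf

/-- The loop `p(x) ∂_i` of a scalar loop `p`. -/
theorem isLoop_smul_single {p : ℝ → 𝕜} (hp : ContDiff ℝ ∞ p) (hp' : Function.Periodic p 1)
    (i : ι) : IsLoop (fun x => p x • (Pi.single i 1 : ι → 𝕜)) :=
  ⟨hp.smul contDiff_const, fun x => by simp only [hp' x]⟩

theorem bracket_smul_single {p q : ℝ → 𝕜} (hq : ContDiff ℝ ∞ q) (u : ℝ → ι → 𝕜) (i j : ι) :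
    B.bracket (fun x => p x • Pi.single i 1) (fun x => q x • Pi.single j 1) u
      = ∫ x in (0 : ℝ)..1, p x * (B.g (u x) i j * deriv q x
          + (∑ k, B.Γ (u x) i j k * deriv u x k) * q x) := by
  unfold HydroBracket.bracket HydroBracket.ham
  congr 1
  ext x
  have hd : deriv (fun x => q x • (Pi.single j 1 : ι → 𝕜)) x = deriv q x • Pi.single j 1 :=
    deriv_smul_const (hq.differentiable (by simp) x) _
  rw [Finset.sum_eq_single i]
  · rw [Finset.sum_eq_single j]
    · simp [hd]
    · intro j' _ hj'
      simp [hd, hj']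
    · simp
  · intro i' _ hi'
    simp [hi']
  · simp

/-- The test function is the conjugate of `W`: it turns the integrand into `‖W‖²`, a continuous
nonnegative function with positive integral as soon as `W 0 ≠ 0`. -/
theorem eq_zero_of_forall_integral_mul {W : ℝ → 𝕜} (hW : ContDiff ℝ ∞ W)
    (hW' : Function.Periodic W 1)
    (h : ∀ p : ℝ → 𝕜, ContDiff ℝ ∞ p → Function.Periodic p 1 → ∫ x in (0 : ℝ)..1, p x * W x = 0) :
    W 0 = 0 := by
  by_contra hne
  have h1 := h (fun x => (starRingEnd 𝕜) (W x))
    ((RCLike.conjCLE (K := 𝕜)).contDiff.comp hW)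
    (fun x => by simp only [hW' x])
  have h2 : (fun x => (starRingEnd 𝕜) (W x) * W x) = fun x => ((‖W x‖ ^ 2 : ℝ) : 𝕜) := by
    ext x
    rw [RCLike.conj_mul]
    push_cast
    rfl
  have hc : Continuous fun x => ‖W x‖ ^ 2 := (hW.continuous.norm).pow 2
  rw [h2, intervalIntegral_ofReal hc] at h1
  have h3 : 0 < ∫ x in (0 : ℝ)..1, ‖W x‖ ^ 2 :=
    intervalIntegral.integral_pos one_pos hc.continuousOn (fun x _ => by positivity)
      ⟨0, by simp, by positivity⟩
  exact h3.ne' (by exact_mod_cast h1)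

/-- A skew-symmetric bracket of hydrodynamic type has a symmetric leading coefficient. -/
theorem g_symm_of_skew (hskew : ∀ u a b : ℝ → ι → 𝕜, IsLoop u → (∀ x, u x ∈ M) → IsLoop a →
    IsLoop b → B.bracket a b u = - B.bracket b a u) {v : ι → 𝕜} (hv : v ∈ M) (i j : ι) :
    B.g v i j = B.g v j i := by
  -- On the constant loop at `v` only `g` contributes. With `p` a cosine and `q` a sine, `∫ p q' =
  -- π` and `∫ q p' = -π`, so skew-symmetry becomes symmetry of `g`.
  set p : ℝ → 𝕜 := fun x => ((Real.cos (2 * Real.pi * x) : ℝ) : 𝕜)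
  set q : ℝ → 𝕜 := fun x => ((Real.sin (2 * Real.pi * x) : ℝ) : 𝕜)
  have hp : ContDiff ℝ ∞ p := contDiff_ofReal (by fun_prop)
  have hq : ContDiff ℝ ∞ q := contDiff_ofReal (by fun_prop)
  have hp' : Function.Periodic p 1 := fun x => by
    simp only [p, mul_add, mul_one, Real.cos_add_two_pi]
  have hq' : Function.Periodic q 1 := fun x => by
    simp only [q, mul_add, mul_one, Real.sin_add_two_pi]
  have hlin : ∀ x, HasDerivAt (fun x : ℝ => 2 * Real.pi * x) (2 * Real.pi) x := fun x => by
    simpa using (hasDerivAt_id x).const_mul (2 * Real.pi)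
  have hdq : ∀ x, deriv q x = ((2 * Real.pi * Real.cos (2 * Real.pi * x) : ℝ) : 𝕜) := fun x => by
    have := hasDerivAt_ofReal (𝕜 := 𝕜) ((Real.hasDerivAt_sin _).comp x (hlin x))
    rw [mul_comm (2 * Real.pi)]
    exact this.deriv
  have hdp : ∀ x, deriv p x = ((- (2 * Real.pi * Real.sin (2 * Real.pi * x)) : ℝ) : 𝕜) :=
    fun x => by
    have := hasDerivAt_ofReal (𝕜 := 𝕜) ((Real.hasDerivAt_cos _).comp x (hlin x))
    rw [mul_comm (2 * Real.pi), ← neg_mul]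
    exact this.deriv
  have h := hskew (fun _ => v) (fun x => p x • Pi.single i 1) (fun x => q x • Pi.single j 1)
    ⟨contDiff_const, fun _ => rfl⟩ (fun _ => hv) (isLoop_smul_single hp hp' i)
    (isLoop_smul_single hq hq' j)
  rw [bracket_smul_single hq, bracket_smul_single hp] at h
  simp only [deriv_const, Pi.zero_apply, mul_zero, Finset.sum_const_zero, zero_mul, add_zero] at h
  have e1 : (fun x => p x * (B.g v i j * deriv q x))
      = fun x => B.g v i j * ((2 * Real.pi * Real.cos (2 * Real.pi * x) ^ 2 : ℝ) : 𝕜) := by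
    ext x
    rw [hdq]
    simp only [p]
    push_cast
    ring
  have e2 : (fun x => q x * (B.g v j i * deriv p x))
      = fun x => B.g v j i * ((- (2 * Real.pi * Real.sin (2 * Real.pi * x) ^ 2) : ℝ) : 𝕜) := by
    ext x
    rw [hdp]
    simp only [q]
    push_cast
    ring
  have c1 : ∫ x in (0 : ℝ)..1, 2 * Real.pi * Real.cos (2 * Real.pi * x) ^ 2 = Real.pi := by
    rw [intervalIntegral.integral_const_mul,
      intervalIntegral.integral_comp_mul_left (fun x => Real.cos x ^ 2) (by positivity)]
    rw [smul_eq_mul, ← mul_assoc, mul_inv_cancel₀ (by positivity), integral_cos_sq]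
    simp
  have c2 : ∫ x in (0 : ℝ)..1, - (2 * Real.pi * Real.sin (2 * Real.pi * x) ^ 2) = - Real.pi := by
    rw [intervalIntegral.integral_neg, intervalIntegral.integral_const_mul,
      intervalIntegral.integral_comp_mul_left (fun x => Real.sin x ^ 2) (by positivity)]
    rw [smul_eq_mul, ← mul_assoc, mul_inv_cancel₀ (by positivity), integral_sin_sq]
    simp
  rw [e1, e2, intervalIntegral.integral_const_mul, intervalIntegral.integral_const_mul,
    intervalIntegral_ofReal (by fun_prop), intervalIntegral_ofReal (by fun_prop), c1, c2] at h
  have hpi : ((Real.pi : ℝ) : 𝕜) ≠ 0 := by exact_mod_cast Real.pi_ne_zero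
  push_cast at h
  rw [mul_neg, neg_neg] at h
  exact mul_right_cancel₀ hpi h

omit [DecidableEq ι] in
theorem contDiff_comp_loop {f : (ι → 𝕜) → 𝕜} (hf : ContDiffOn 𝕜 ∞ f M)
    {u : ℝ → ι → 𝕜} (hu : ContDiff ℝ ∞ u) (huM : ∀ x, u x ∈ M) :
    ContDiff ℝ ∞ fun x => f (u x) :=
  (hf.restrict_scalars ℝ).comp_contDiff hu huM

/-- A skew-symmetric bracket of hydrodynamic type satisfies `∂_k g^{ij} = Γ^{ij}_k + Γ^{ji}_k`. -/
theorem pd_g_of_skew (hM : IsOpen M) (hB : B.SmoothOn M)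
    (hskew : ∀ u a b : ℝ → ι → 𝕜, IsLoop u → (∀ x, u x ∈ M) → IsLoop a →
    IsLoop b → B.bracket a b u = - B.bracket b a u) {v : ι → 𝕜} (hv : v ∈ M) (i j k : ι) :
    pd k (fun y => B.g y j i) v = B.Γ v i j k + B.Γ v j i k := by
  obtain ⟨r, hr, hball⟩ := Metric.isOpen_iff.1 hM v hv
  -- This produces a loop passing through `v` at `x = 0` with velocity a nonzero multiple of `∂_k`;
  -- the amplitude `r / 2` keeps it in the ball of radius `r` inside `M`.
  set s : ℝ → 𝕜 := fun x => ((r / 2 * Real.sin (2 * Real.pi * x) : ℝ) : 𝕜) with hs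
  have hsc : ContDiff ℝ ∞ s := contDiff_ofReal (by fun_prop)
  set u : ℝ → ι → 𝕜 := fun x => v + s x • Pi.single k 1 with hudef
  have hu : ContDiff ℝ ∞ u := contDiff_const.add (hsc.smul contDiff_const)
  have hup : Function.Periodic u 1 := fun x => by
    simp only [hudef, hs, mul_add, mul_one, Real.sin_add_two_pi]
  have huM : ∀ x, u x ∈ M := fun x => hball <| by
    rw [Metric.mem_ball, dist_eq_norm]
    have h1 : ‖u x - v‖ ≤ r / 2 := by
      simp only [hudef, add_sub_cancel_left, norm_smul, Pi.norm_single, norm_one, mul_one, hs,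
        RCLike.norm_ofReal, abs_mul, abs_of_pos (half_pos hr)]
      exact mul_le_of_le_one_right (half_pos hr).le (Real.abs_sin_le_one _)
    linarith
  set γ : ι → ι → ℝ → 𝕜 := fun i j x => ∑ k, B.Γ (u x) i j k * deriv u x k with hγ
  set G : ℝ → 𝕜 := fun x => B.g (u x) j i with hG
  have hdu : ContDiff ℝ ∞ (deriv u) := (contDiff_infty_iff_deriv.1 hu).2
  have hdup : Function.Periodic (deriv u) 1 := fun x => by
    rw [← deriv_comp_add_const]
    congr 1
    exact funext hup
  have hduk : ∀ k, ContDiff ℝ ∞ fun x => deriv u x k := fun k => contDiff_pi.1 hdu k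
  have hγc : ∀ i j, ContDiff ℝ ∞ (γ i j) := fun i j =>
    ContDiff.sum fun k _ => (contDiff_comp_loop (hB.2 i j k) hu huM).mul (hduk k)
  have hγp : ∀ i j, Function.Periodic (γ i j) 1 := fun i j x => by
    simp only [hγ, hup x, hdup x]
  have hGc : ContDiff ℝ ∞ G := contDiff_comp_loop (hB.1 j i) hu huM
  have hGp : Function.Periodic G 1 := fun x => by simp only [hG, hup x]
  have hdG : ContDiff ℝ ∞ (deriv G) := (contDiff_infty_iff_deriv.1 hGc).2
  have hdGp : Function.Periodic (deriv G) 1 := fun x => by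
    rw [← deriv_comp_add_const]
    congr 1
    exact funext hGp
  have hzero : γ i j 0 + γ j i 0 - deriv G 0 = 0 := by
    refine eq_zero_of_forall_integral_mul (W := fun x => γ i j x + γ j i x - deriv G x)
      (((hγc i j).add (hγc j i)).sub hdG)
      (fun x => by simp only [hγp i j x, hγp j i x, hdGp x]) fun p hp hpp => ?_
    -- One test function is arbitrary and the other constant, so the only derivative falls on `p`;
    -- the integration by parts `h2` moves it to `G`.
    have h1 := hskew u (fun x => p x • Pi.single i 1) (fun x => (1 : 𝕜) • Pi.single j 1)
      ⟨hu, hup⟩ huM (isLoop_smul_single hp hpp i)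
      (isLoop_smul_single (p := fun _ => 1) contDiff_const (fun _ => rfl) j)
    rw [bracket_smul_single (q := fun _ => (1 : 𝕜)) contDiff_const,
      bracket_smul_single (p := fun _ => (1 : 𝕜)) hp] at h1
    simp only [deriv_const, mul_zero, zero_add, mul_one, one_mul] at h1
    have hdp : Continuous (deriv p) := (contDiff_infty_iff_deriv.1 hp).2.continuous
    have h2 : ∫ x in (0 : ℝ)..1, (deriv G x * p x + G x * deriv p x) = 0 := by
      rw [intervalIntegral.integral_eq_sub_of_hasDerivAt (f := fun x => G x * p x)
        (fun x _ => ((hGc.differentiable (by simp) x).hasDerivAt.mul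
          (hp.differentiable (by simp) x).hasDerivAt))
        (((hdG.continuous.mul hp.continuous).add
          (hGc.continuous.mul hdp)).intervalIntegrable _ _)]
      have a1 := hGp 0
      have a2 := hpp 0
      rw [zero_add] at a1 a2
      rw [a1, a2, sub_self]
    have i1 : IntervalIntegrable (fun x => p x * γ i j x) MeasureTheory.volume 0 1 :=
      (hp.continuous.mul (hγc i j).continuous).intervalIntegrable _ _
    have i2 : IntervalIntegrable (fun x => G x * deriv p x + γ j i x * p x)
        MeasureTheory.volume 0 1 :=
      ((hGc.continuous.mul hdp).add ((hγc j i).continuous.mul hp.continuous)).intervalIntegrable _ _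
    have i3 : IntervalIntegrable (fun x => deriv G x * p x + G x * deriv p x)
        MeasureTheory.volume 0 1 :=
      ((hdG.continuous.mul hp.continuous).add
          (hGc.continuous.mul hdp)).intervalIntegrable _ _
    have e : (fun x => p x * (γ i j x + γ j i x - deriv G x))
        = fun x => (p x * γ i j x + (G x * deriv p x + γ j i x * p x))
          - (deriv G x * p x + G x * deriv p x) := by
      ext x; ring
    rw [e, intervalIntegral.integral_sub (i1.add i2) i3, intervalIntegral.integral_add i1 i2, h2,
      sub_zero]
    exact eq_neg_iff_add_eq_zero.1 h1
  have hu0 : u 0 = v := by simp [hudef, hs]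
  have hds : HasDerivAt s ((r / 2 * (2 * Real.pi) : ℝ) : 𝕜) 0 := by
    have hlin : HasDerivAt (fun x : ℝ => 2 * Real.pi * x) (2 * Real.pi) 0 := by
      simpa using (hasDerivAt_id (0 : ℝ)).const_mul (2 * Real.pi)
    have := hasDerivAt_ofReal (𝕜 := 𝕜) (((Real.hasDerivAt_sin _).comp 0 hlin).const_mul (r / 2))
    rw [mul_zero, Real.cos_zero, one_mul] at this
    exact this
  have hdu0 : HasDerivAt u (((r / 2 * (2 * Real.pi) : ℝ) : 𝕜) • Pi.single k 1) 0 :=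
    (hds.smul_const _).const_add v
  set K : 𝕜 := ((r / 2 * (2 * Real.pi) : ℝ) : 𝕜) with hK
  have hK0 : K ≠ 0 := by
    rw [hK]
    have : r / 2 * (2 * Real.pi) ≠ 0 := by positivity
    exact_mod_cast this
  have hγ0 : ∀ i j, γ i j 0 = K * B.Γ v i j k := fun i j => by
    simp only [hγ, hu0, hdu0.deriv]
    rw [Finset.sum_eq_single k]
    · simp [mul_comm]
    · intro k' _ hk'
      simp [hk']
    · simp
  have hG0 : deriv G 0 = K * pd k (fun y => B.g y j i) v := by
    have hg := (differentiableAt_of_smoothOn hM (hB.1 j i) hv).hasFDerivAt.restrictScalars ℝ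
    rw [← hu0] at hg
    have := (hg.comp_hasDerivAt 0 hdu0).deriv
    rw [hu0] at this
    refine this.trans ?_
    rw [ContinuousLinearMap.coe_restrictScalars', map_smul, smul_eq_mul]
    rfl
  rw [hγ0, hγ0, hG0, ← mul_add, ← mul_sub] at hzero
  rcases mul_eq_zero.1 hzero with h | h
  · exact absurd h hK0
  · exact (sub_eq_zero.1 h).symm

variable {η : Matrix ι ι 𝕜} {B₂ : HydroBracket 𝕜 ι}

omit [Fintype ι] [DecidableEq ι] in
theorem comb_zero_one (B₁ B₂ : HydroBracket 𝕜 ι) : HydroBracket.comb 0 1 B₁ B₂ = B₂ := by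
  simp [HydroBracket.comb]

theorem IsBihamiltonianOn.metric_symm (h : IsBihamiltonianOn M (flatBracket η) B₂)
    (hMn : M.Nonempty) : η.IsSymm := by
  obtain ⟨v, hv⟩ := hMn
  ext i j
  simpa [HydroBracket.comb, flatBracket] using g_symm_of_skew (h.2.2 1 0).1 hv j i

theorem IsBihamiltonianOn.g_symm (h : IsBihamiltonianOn M (flatBracket η) B₂) {v : ι → 𝕜}
    (hv : v ∈ M) : (B₂.g v).IsSymm := by
  have h' := (h.2.2 0 1).1
  rw [comb_zero_one] at h'
  ext i j
  exact g_symm_of_skew h' hv j i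

theorem IsBihamiltonianOn.pd_g (hM : IsOpen M) (h : IsBihamiltonianOn M (flatBracket η) B₂)
    {v : ι → 𝕜} (hv : v ∈ M) (i j k : ι) :
    pd k (fun y => B₂.g y i j) v = B₂.Γ v i j k + B₂.Γ v j i k := by
  have h' := (h.2.2 0 1).1
  rw [comb_zero_one] at h'
  rw [pd_g_of_skew hM h.2.1 h' hv j i k, add_comm]

end Skew

/-! ### Tau-structures -/

section Tau

set_option maxSynthPendingDepth 6

open Matrix

variable {𝕜 : Type} [RCLike 𝕜] {ι : Type} [Fintype ι] [DecidableEq ι]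
  {M : Set (ι → 𝕜)} {η : Matrix ι ι 𝕜} {B₂ : HydroBracket 𝕜 ι} {f g : (ι → 𝕜) → 𝕜} {v : ι → 𝕜}

omit [DecidableEq ι] in
theorem fderiv_sum_mul {κ : Type*} (s : Finset κ) (k : κ → 𝕜) (F : κ → (ι → 𝕜) → 𝕜)
    (hM : IsOpen M) (hF : ∀ i, ContDiffOn 𝕜 ∞ (F i) M) (hv : v ∈ M) :
    fderiv 𝕜 (fun u => ∑ i ∈ s, k i * F i u) v = ∑ i ∈ s, k i • fderiv 𝕜 (F i) v := by
  rw [fderiv_fun_sum fun i _ => (differentiableAt_of_smoothOn hM (hF i) hv).const_mul _]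
  exact Finset.sum_congr rfl fun i _ =>
    fderiv_const_mul (differentiableAt_of_smoothOn hM (hF i) hv) _

omit [DecidableEq ι] in
theorem D2_sum_mul {κ : Type*} (s : Finset κ) (k : κ → 𝕜) (F : κ → (ι → 𝕜) → 𝕜)
    (hM : IsOpen M) (hF : ∀ i, ContDiffOn 𝕜 ∞ (F i) M) (hv : v ∈ M) :
    D2 (fun u => ∑ i ∈ s, k i * F i u) v = ∑ i ∈ s, k i • D2 (F i) v := by
  unfold D2
  rw [fderiv_congr_of_isOpen hM (fun u hu => fderiv_sum_mul s k F hM hF hu) hv]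
  exact (HasFDerivAt.fun_sum fun i _ => (differentiableAt_of_smoothOn hM
    (smoothOn_fderiv hM (hF i)) hv).hasFDerivAt.const_smul (k i)).fderiv

omit [DecidableEq ι] in
theorem smoothOn_sum_mul {κ : Type*} (s : Finset κ) (k : κ → 𝕜) (F : κ → (ι → 𝕜) → 𝕜)
    (hF : ∀ i, ContDiffOn 𝕜 ∞ (F i) M) : ContDiffOn 𝕜 ∞ (fun u => ∑ i ∈ s, k i * F i u) M :=
  ContDiffOn.sum fun i _ => contDiffOn_const.mul (hF i)

theorem sum_pd_mul (hM : IsOpen M) (hf : ContDiffOn 𝕜 ∞ f M) (hv : v ∈ M) (ξ : ι → 𝕜) (j : ι) :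
    ∑ k, pd k (pd j f) v * ξ k = D2 f v ξ (Pi.single j 1) := by
  rw [clm_eq_sum (D2 f v) ξ]
  simp [pd_pd_eq_D2 hM hf hv, mul_comm]

theorem flat_flow (hM : IsOpen M) (hf : ContDiffOn 𝕜 ∞ f M) (hv : v ∈ M) (ξ : ι → 𝕜) :
    (flatBracket η).flow f v ξ = η *ᵥ fun j => D2 f v ξ (Pi.single j 1) := by
  ext i
  simp [HydroBracket.flow, flatBracket, sum_pd_mul hM hf hv, Matrix.mulVec, dotProduct]

theorem flat_timeDeriv (hM : IsOpen M) (hf : ContDiffOn 𝕜 ∞ f M) (hv : v ∈ M) (ξ : ι → 𝕜) :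
    (flatBracket η).timeDeriv g f v ξ
      = ∑ k, ∑ m, fderiv 𝕜 g v (Pi.single k 1) * η k m * D2 f v ξ (Pi.single m 1) := by
  simp [HydroBracket.timeDeriv, flat_flow hM hf hv, Matrix.mulVec, dotProduct, pd,
    Finset.mul_sum, mul_assoc]

/-! ### The potential of a normalized tau-structure and its associativity. -/

namespace TauStructure

variable (T : TauStructure M η B₂)

theorem h_smooth (α : ι) (p : ℕ) : ContDiffOn 𝕜 ∞ (T.h α p) M := by
  obtain ⟨k, hk⟩ := T.h_eq α p
  refine ContDiffOn.congr ?_ hk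
  exact (ContDiffOn.sum fun q _ => smoothOn_sum_mul _ _ _ fun β => T.φ_smooth β q).add
    contDiffOn_const

/-- The action of an invertible constant matrix on tau-structures. -/
def transform (hM : IsOpen M) (A : Matrix ι ι 𝕜) (hA : A.det ≠ 0) : TauStructure M η B₂ where
  φ := T.φ
  a := fun p q => A * T.a p q
  h := fun α p v => ∑ β, A α β * T.h β p v
  φ_smooth := T.φ_smooth
  φ_init := T.φ_init
  casimir_init := T.casimir_init
  casimir_succ := T.casimir_succ
  a_nondeg := fun p => by
    rw [Matrix.det_mul]
    exact mul_ne_zero hA (T.a_nondeg p)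
  h_eq := fun α p => by
    choose k hk using fun β => T.h_eq β p
    refine ⟨∑ β, A α β * k β, fun v hv => ?_⟩
    simp only [hk _ v hv, mul_add, Finset.sum_add_distrib, Matrix.mul_apply, Finset.sum_mul,
      Finset.mul_sum]
    congr 1
    rw [Finset.sum_comm]
    refine Finset.sum_congr rfl fun q _ => ?_
    rw [Finset.sum_comm]
    simp only [mul_assoc]
  symmetric := fun i j p q v hv ξ => by
    have key : ∀ i j p q, (flatBracket η).timeDeriv (fun v => ∑ β, A i β * T.h β p v)
        (fun v => ∑ β, A j β * T.h β (q + 1) v) v ξ = ∑ β, ∑ γ, A i β * A j γ *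
          (flatBracket η).timeDeriv (T.h β p) (T.h γ (q + 1)) v ξ := by
      intro i j p q
      rw [flat_timeDeriv hM (smoothOn_sum_mul _ _ _ fun β => T.h_smooth β _) hv,
        fderiv_sum_mul _ _ _ hM (fun β => T.h_smooth β _) hv,
        D2_sum_mul _ _ _ hM (fun β => T.h_smooth β _) hv]
      simp only [flat_timeDeriv hM (T.h_smooth _ _) hv, _root_.sum_apply, _root_.smul_apply,
        smul_eq_mul, Finset.sum_mul, Finset.mul_sum]
      have comm4 : ∀ X : ι → ι → ι → ι → 𝕜,
          ∑ k, ∑ m, ∑ γ, ∑ β, X k m γ β = ∑ β, ∑ γ, ∑ k, ∑ m, X k m γ β := by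
        intro X
        rw [Finset.sum_congr rfl fun k _ => Finset.sum_comm, Finset.sum_comm]
        rw [Finset.sum_congr rfl fun γ _ => Finset.sum_congr rfl fun k _ => Finset.sum_comm,
          Finset.sum_congr rfl fun γ _ => Finset.sum_comm, Finset.sum_comm]
      rw [comm4]
      refine Finset.sum_congr rfl fun β _ => Finset.sum_congr rfl fun γ _ =>
        Finset.sum_congr rfl fun k _ => Finset.sum_congr rfl fun m _ => ?_
      ring
    rw [key, key, Finset.sum_comm]
    refine Finset.sum_congr rfl fun β _ => Finset.sum_congr rfl fun γ _ => ?_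
    rw [T.symmetric γ β p q v hv ξ]
    ring

/-- At the lowest level the densities are `T.a 0 0` applied to the `v_α`, up to constants, so the
inverse of this matrix normalizes them. -/
theorem exists_normalized (hM : IsOpen M) : ∃ (A : Matrix ι ι 𝕜) (T' : TauStructure M η B₂),
    A.det ≠ 0 ∧ T'.φ = T.φ ∧ (∀ α p v, T'.h α p v = ∑ β, A α β * T.h β p v) ∧ T'.IsNormalized := by
  have hu : IsUnit (T.a 0 0).det := isUnit_iff_ne_zero.2 (T.a_nondeg 0)
  have hA : ((T.a 0 0)⁻¹).det ≠ 0 := by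
    rw [Matrix.det_nonsing_inv]
    exact (isUnit_ringInverse.2 hu).ne_zero
  refine ⟨(T.a 0 0)⁻¹, T.transform hM _ hA, hA, rfl, fun _ _ _ => rfl, fun α => ?_⟩
  obtain ⟨k, hk⟩ := (T.transform hM _ hA).h_eq α 0
  refine ⟨k, fun v hv => ?_⟩
  rw [hk v hv]
  simp only [transform, zero_add, Finset.range_one, Finset.sum_singleton,
    Matrix.nonsing_inv_mul _ hu]
  simp [Matrix.one_apply, T.φ_init α v hv]

theorem pd_φ_init (hM : IsOpen M) (hv : v ∈ M) (α j : ι) : pd j (T.φ α 0) v = η⁻¹ α j := by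
  rw [pd_congr hM (T.φ_init α) hv]
  let l : (ι → 𝕜) →L[𝕜] 𝕜 := ∑ ε, η⁻¹ α ε • ContinuousLinearMap.proj (R := 𝕜) (φ := fun _ => 𝕜) ε
  have : (fun v : ι → 𝕜 => ∑ ε, η⁻¹ α ε * v ε) = l := by ext v; simp [l]
  rw [this, pd, l.fderiv]
  simp [l, Pi.single_apply]

theorem D2_φ_init (hM : IsOpen M) (hv : v ∈ M) (α : ι) : D2 (T.φ α 0) v = 0 := by
  let l : (ι → 𝕜) →L[𝕜] 𝕜 := ∑ ε, η⁻¹ α ε • ContinuousLinearMap.proj (R := 𝕜) (φ := fun _ => 𝕜) ε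
  have h : ∀ u ∈ M, T.φ α 0 u = (0 : (ι → 𝕜) →L[𝕜] (ι → 𝕜) →L[𝕜] 𝕜) u u + l u + 0 := by
    intro u hu
    rw [T.φ_init α u hu]
    simp [l]
  rw [D2_congr hM h hv, D2_quadratic]
  ext; simp

/-- In the recursion from level -1 to level 0 the term with `g` disappears because `T.φ α 0` is
linear; what remains is a contraction of `Γ` with the lowered metric. -/
theorem casimir_one (hM : IsOpen M) (hv : v ∈ M) (α i k : ι) :
    (η *ᵥ fun j => D2 (T.φ α 1) v (Pi.single k 1) (Pi.single j 1)) i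
      = ∑ l, B₂.Γ v i l k * η⁻¹ α l := by
  have h := congrFun (T.casimir_succ α 0 v hv (Pi.single k 1)) i
  rw [zero_add, flat_flow hM (T.φ_smooth α 1) hv] at h
  rw [h]
  simp only [HydroBracket.flow, sum_pd_mul hM (T.φ_smooth α 0) hv, T.D2_φ_init hM hv,
    T.pd_φ_init hM hv]
  simp [Pi.single_apply]

/-- The coefficients `Γ` in terms of the first Casimir densities. -/
theorem Γ_eq_φ (hM : IsOpen M) (hη : η.det ≠ 0) (hv : v ∈ M) (i l k : ι) :
    B₂.Γ v i l k
      = ∑ α, η l α * (η *ᵥ fun j => D2 (T.φ α 1) v (Pi.single k 1) (Pi.single j 1)) i := by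
  simp only [T.casimir_one hM hv, Finset.mul_sum]
  rw [Finset.sum_comm]
  have : ∀ m, ∑ α, η l α * (B₂.Γ v i m k * η⁻¹ α m) = B₂.Γ v i m k * (1 : Matrix ι ι 𝕜) l m := by
    intro m
    rw [← Matrix.mul_nonsing_inv η (isUnit_iff_ne_zero.2 hη), Matrix.mul_apply, Finset.mul_sum]
    exact Finset.sum_congr rfl fun α _ => by ring
  simp [this, Matrix.one_apply]

theorem D2_h_one (hM : IsOpen M) (hv : v ∈ M) (α : ι) :
    D2 (T.h α 1) v = ∑ β, T.a 1 1 α β • D2 (T.φ β 1) v := by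
  obtain ⟨k, hk⟩ := T.h_eq α 1
  have h : ∀ u ∈ M, T.h α 1 u = (∑ β, T.a 1 0 α β * T.φ β 0 u + ∑ β, T.a 1 1 α β * T.φ β 1 u)
      + ∑ β ∈ {α}, k * (fun _ _ => (1 : 𝕜)) β u := by
    intro u hu
    rw [hk u hu]
    simp [Finset.sum_range_succ]
  have s0 := smoothOn_sum_mul Finset.univ (T.a 1 0 α) _ (fun β => T.φ_smooth β 0)
  have s1 := smoothOn_sum_mul Finset.univ (T.a 1 1 α) _ (fun β => T.φ_smooth β 1)
  have s2 := smoothOn_sum_mul (M := M) {α} (fun _ => k) (fun _ _ => (1 : 𝕜))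
    (fun β => contDiffOn_const)
  rw [D2_congr hM h hv, D2_add hM (s0.add s1) s2 hv, D2_add hM s0 s1 hv,
    D2_sum_mul _ _ _ hM (fun β => T.φ_smooth β 0) hv,
    D2_sum_mul _ _ _ hM (fun β => T.φ_smooth β 1) hv,
    D2_sum_mul _ _ _ hM (fun β => contDiffOn_const) hv]
  have : D2 (fun _ : ι → 𝕜 => (1 : 𝕜)) v = 0 := by
    unfold D2
    simp
  simp [this, T.D2_φ_init hM hv]

theorem D2_φ_one (hM : IsOpen M) (hv : v ∈ M) (α : ι) :
    D2 (T.φ α 1) v = ∑ β, T.b α β • D2 (T.h β 1) v := by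
  simp only [T.D2_h_one hM hv, Finset.smul_sum, smul_smul]
  rw [Finset.sum_comm]
  have : ∀ γ, ∑ β, (T.b α β * T.a 1 1 β γ) • D2 (T.φ γ 1) v
      = (1 : Matrix ι ι 𝕜) α γ • D2 (T.φ γ 1) v := by
    intro γ
    rw [← Finset.sum_smul, ← Matrix.mul_apply, b,
      Matrix.nonsing_inv_mul _ (isUnit_iff_ne_zero.2 (T.a_nondeg 1))]
  simp [this, Matrix.one_apply]

/-- The coefficients `Γ` in terms of the first densities of the tau-structure. -/
theorem Γ_eq_h (hM : IsOpen M) (hη : η.det ≠ 0) (hv : v ∈ M) (i l k : ι) :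
    B₂.Γ v i l k = ∑ ε, ∑ j, (η * T.b) l ε * η i j *
      D2 (T.h ε 1) v (Pi.single k 1) (Pi.single j 1) := by
  rw [T.Γ_eq_φ hM hη hv]
  simp only [T.D2_φ_one hM hv, Matrix.mulVec, dotProduct, Matrix.mul_apply, _root_.sum_apply,
    _root_.smul_apply, smul_eq_mul, Finset.mul_sum, Finset.sum_mul]
  have comm3 : ∀ X : ι → ι → ι → 𝕜, ∑ a, ∑ j, ∑ e, X a j e = ∑ e, ∑ j, ∑ a, X a j e := by
    intro X
    rw [Finset.sum_comm, Finset.sum_congr rfl fun j _ => Finset.sum_comm, Finset.sum_comm]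
  rw [comm3]
  refine Finset.sum_congr rfl fun ε _ => Finset.sum_congr rfl fun j _ =>
    Finset.sum_congr rfl fun α _ => ?_
  ring

theorem pd_h_zero (hM : IsOpen M) (hT : T.IsNormalized) (hv : v ∈ M) (i m : ι) :
    fderiv 𝕜 (T.h i 0) v (Pi.single m 1) = η⁻¹ i m := by
  obtain ⟨k, hk⟩ := hT i
  rw [fderiv_congr_of_isOpen hM (f := T.h i 0) (g := fun u => T.φ i 0 u + k)
    (fun u hu => by rw [hk u hu, T.φ_init i u hu]) hv, fderiv_add_const]
  exact T.pd_φ_init hM hv i m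

/-- The gradient of `h_{i,-1} = v_i` is a row of `η⁻¹`, which cancels the `η` of the flow.
Tau-symmetries involving level -1 thereby become statements on Hessians. -/
theorem timeDeriv_h_zero (hM : IsOpen M) (hη : η.det ≠ 0) (hT : T.IsNormalized) (hv : v ∈ M)
    (hf : ContDiffOn 𝕜 ∞ f M) (ξ : ι → 𝕜) (i : ι) :
    (flatBracket η).timeDeriv (T.h i 0) f v ξ = D2 f v ξ (Pi.single i 1) := by
  rw [flat_timeDeriv hM hf hv, Finset.sum_comm]
  simp only [T.pd_h_zero hM hT hv, ← Finset.sum_mul, ← Matrix.mul_apply,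
    Matrix.nonsing_inv_mul _ (isUnit_iff_ne_zero.2 hη)]
  simp [Matrix.one_apply]

theorem D2_h_one_symm (hM : IsOpen M) (hη : η.det ≠ 0) (hT : T.IsNormalized) (hv : v ∈ M)
    (ξ : ι → 𝕜) (i j : ι) :
    D2 (T.h j 1) v ξ (Pi.single i 1) = D2 (T.h i 1) v ξ (Pi.single j 1) := by
  rw [← T.timeDeriv_h_zero hM hη hT hv (T.h_smooth j 1),
    ← T.timeDeriv_h_zero hM hη hT hv (T.h_smooth i 1)]
  exact T.symmetric i j 0 0 v hv ξ

/-- The first densities of a normalized tau-structure are, up to linear terms, the partial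
derivatives of a function. -/
theorem exists_D3_eq (hM : IsOpen M) (hMc : Convex ℝ M) (hη : η.det ≠ 0) (hT : T.IsNormalized)
    (hMn : M.Nonempty) : ∃ F, ContDiffOn 𝕜 ∞ F M ∧ ∀ v ∈ M, ∀ x y j,
      D3 F v x y (Pi.single j 1) = D2 (T.h j 1) v x y := by
  obtain ⟨v₀, hv₀⟩ := hMn
  let pr : ι → ((ι → 𝕜) →L[𝕜] 𝕜) := fun j => ContinuousLinearMap.proj (R := 𝕜) (φ := fun _ => 𝕜) j
  -- Tau-symmetry only makes `∂_i h_j - ∂_j h_i` constant. Subtracting from each density its linear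
  -- part at `v₀` makes this constant vanish at `v₀`, hence everywhere.
  let H : ι → (ι → 𝕜) → 𝕜 := fun j u => T.h j 1 u - fderiv 𝕜 (T.h j 1) v₀ u
  have hH : ∀ j, ContDiffOn 𝕜 ∞ (H j) M := fun j =>
    (T.h_smooth j 1).sub (ContinuousLinearMap.contDiff _).contDiffOn
  have hdH : ∀ j, ∀ v ∈ M, fderiv 𝕜 (H j) v = fderiv 𝕜 (T.h j 1) v - fderiv 𝕜 (T.h j 1) v₀ := by
    intro j v hv
    simp only [H]
    rw [fderiv_fun_sub (differentiableAt_of_smoothOn hM (T.h_smooth j 1) hv)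
      (ContinuousLinearMap.differentiableAt _), ContinuousLinearMap.fderiv]
  have hsymm : ∀ v ∈ M, ∀ i j,
      fderiv 𝕜 (H j) v (Pi.single i 1) = fderiv 𝕜 (H i) v (Pi.single j 1) := by
    have hD2 : ∀ j, ∀ v ∈ M, ∀ x y, D2 (H j) v x y = D2 (T.h j 1) v x y := by
      intro j v hv x y
      unfold D2
      rw [fderiv_congr_of_isOpen hM (hdH j) hv, fderiv_sub_const]
    intro v hv i j
    rw [← sub_eq_zero]
    have hd : ∀ i j, DifferentiableOn 𝕜 (fun v => fderiv 𝕜 (H j) v (Pi.single i 1)) M :=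
      fun i j => (smoothOn_fderiv_apply hM (hH j) _).differentiableOn (by simp)
    have := hM.is_const_of_fderiv_eq_zero hMc.isPreconnected ((hd i j).sub (hd j i))
      (fun u hu => by
        rw [fderiv_sub ((hd i j).differentiableAt (hM.mem_nhds hu))
          ((hd j i).differentiableAt (hM.mem_nhds hu))]
        ext x
        have e1 := fderiv_fderiv_eq_D2 hM (hH j) hu x (Pi.single i 1)
        have e2 := fderiv_fderiv_eq_D2 hM (hH i) hu x (Pi.single j 1)
        rw [_root_.sub_apply, e1, e2, hD2 j u hu, hD2 i u hu,
          T.D2_h_one_symm hM hη hT hu x i j, sub_self]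
        rfl) hv hv₀
    simp only [Pi.sub_apply] at this
    rw [this, hdH j v₀ hv₀, hdH i v₀ hv₀]
    simp
  let θ : (ι → 𝕜) → (ι → 𝕜) →L[𝕜] 𝕜 := fun u => ∑ j, H j u • pr j
  have hθ : ContDiffOn 𝕜 ∞ θ M := ContDiffOn.sum fun j _ => (hH j).smul contDiffOn_const
  have hdθ : ∀ v ∈ M, ∀ x y, fderiv 𝕜 θ v x y = ∑ j, fderiv 𝕜 (H j) v x * y j := by
    intro v hv x y
    have h := HasFDerivAt.fun_sum (u := Finset.univ) fun j _ =>
      (differentiableAt_of_smoothOn hM (hH j) hv).hasFDerivAt.smul_const (pr j)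
    rw [h.fderiv]
    simp [pr]
  have hclosed : ∀ v ∈ M, ∀ x y, fderiv 𝕜 θ v x y = fderiv 𝕜 θ v y x := by
    intro v hv x y
    rw [hdθ v hv, hdθ v hv]
    simp only [clm_eq_sum (fderiv 𝕜 (H _) v) x, clm_eq_sum (fderiv 𝕜 (H _) v) y, Finset.sum_mul,
      smul_eq_mul]
    rw [Finset.sum_comm]
    refine Finset.sum_congr rfl fun i _ => Finset.sum_congr rfl fun j _ => ?_
    rw [hsymm v hv i j]
    ring
  obtain ⟨F, hF, hdF⟩ := exists_primitive_of_closed hM hMc hθ hclosed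
  refine ⟨F, hF, fun v hv x y j => ?_⟩
  rw [← fderiv3_eq_D3 hM hF hv]
  have h1 : ∀ u ∈ M, fderiv 𝕜 F u (Pi.single j 1) = H j u := by
    intro u hu
    rw [(hdF u hu).fderiv]
    simp [θ, pr, Pi.single_apply]
  have h2 : ∀ u ∈ M, fderiv 𝕜 (fun u' => fderiv 𝕜 F u' (Pi.single j 1)) u y
      = fderiv 𝕜 (T.h j 1) u y - fderiv 𝕜 (T.h j 1) v₀ y := by
    intro u hu
    rw [fderiv_congr_of_isOpen hM h1 hu, hdH j u hu]
    rfl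
  rw [fderiv_congr_of_isOpen hM h2 hv, fderiv_sub_const, fderiv_fderiv_eq_D2 hM (T.h_smooth j 1) hv]

theorem b_isUnit (hη : η.det ≠ 0) : IsUnit (η * T.b).det := by
  rw [Matrix.det_mul, b, Matrix.det_nonsing_inv]
  exact (isUnit_iff_ne_zero.2 hη).mul (isUnit_ringInverse.2 (isUnit_iff_ne_zero.2 (T.a_nondeg 1)))

/-- The formula for `Γ` is `Γ_eq_h`. By `pd_g` the derivative of `g` is the symmetrized `Γ`, which
is also the derivative of the symmetrized `b ∂∂F`; the difference is therefore constant on the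
connected set `M`, and is `g₀`. -/
theorem isPotential_of_D3_eq (hM : IsOpen M) (hMc : IsPreconnected M)
    (hη : η.det ≠ 0) (hB : IsBihamiltonianOn M (flatBracket η) B₂)
    {F : (ι → 𝕜) → 𝕜} (hF : ContDiffOn 𝕜 ∞ F M)
    (h : ∀ v ∈ M, ∀ x y j, D3 F v x y (Pi.single j 1) = D2 (T.h j 1) v x y) :
    IsPotential M η T.b B₂ F := by
  have hΓ : ∀ v ∈ M, ∀ α β γ,
      B₂.Γ v α β γ = ∑ ε, ∑ l, (η * T.b) β ε * η α l * c₃ F l γ ε v := by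
    intro v hv α β γ
    rw [T.Γ_eq_h hM hη hv]
    refine Finset.sum_congr rfl fun ε _ => Finset.sum_congr rfl fun j _ => ?_
    rw [c₃_eq_D3 hM hF hv, h v hv, D2_symm hM (T.h_smooth ε 1) hv]
  refine ⟨hF, hΓ, ?_⟩
  let S : ι → ι → (ι → 𝕜) → 𝕜 := fun α β v =>
    ∑ p : ι × ι, (η * T.b) α p.1 * η β p.2 * pd p.1 (pd p.2 F) v
  have hsm : ∀ p : ι × ι, ContDiffOn 𝕜 ∞ (fun v => pd p.1 (pd p.2 F) v) M := fun p =>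
    smoothOn_pd hM (smoothOn_pd hM hF _) _
  have hS : ∀ α β, ContDiffOn 𝕜 ∞ (S α β) M := fun α β => smoothOn_sum_mul _ _ _ hsm
  have hdS : ∀ α β γ, ∀ v ∈ M, fderiv 𝕜 (S α β) v (Pi.single γ 1) = B₂.Γ v β α γ := by
    intro α β γ v hv
    simp only [S]
    rw [fderiv_sum_mul _ _ _ hM hsm hv, hΓ v hv, Fintype.sum_prod_type, _root_.sum_apply]
    refine Finset.sum_congr rfl fun ε _ => ?_
    rw [_root_.sum_apply]
    refine Finset.sum_congr rfl fun l _ => ?_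
    rw [_root_.smul_apply, smul_eq_mul]
    congr 1
    change c₃ F γ ε l v = _
    rw [c₃_eq_D3 hM hF hv, c₃_eq_D3 hM hF hv, D3_symm_right hM hF hv, D3_symm_left hM hF hv]
  have hg : ∀ α β, ∃ k, ∀ v ∈ M, B₂.g v α β - (S α β v + S β α v) = k := by
    intro α β
    have hgs := hB.2.1.1 α β
    have hd := hgs.sub ((hS α β).add (hS β α))
    refine hM.exists_is_const_of_fderiv_eq_zero hMc (hd.differentiableOn (by simp)) fun v hv => ?_
    ext x
    rw [clm_eq_sum]
    refine Finset.sum_eq_zero fun γ _ => ?_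
    have a1 := differentiableAt_of_smoothOn hM hgs hv
    have a2 := differentiableAt_of_smoothOn hM (hS α β) hv
    have a3 := differentiableAt_of_smoothOn hM (hS β α) hv
    have h1 := hB.pd_g hM hv α β γ
    unfold pd at h1
    have h3 := hdS α β γ v hv
    have h4 := hdS β α γ v hv
    have h5 : fderiv 𝕜 (fun v => B₂.g v α β - (S α β v + S β α v)) v = _ :=
      (a1.hasFDerivAt.sub (a2.hasFDerivAt.add a3.hasFDerivAt)).fderiv
    rw [h5, _root_.sub_apply, _root_.add_apply, h1, h3, h4]
    simp [add_comm]
  choose g₀ hg₀ using hg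
  refine ⟨g₀, fun v hv α β => ?_⟩
  rw [← hg₀ α β v hv]
  simp only [S, Fintype.sum_prod_type]
  ring

/-- Read as an identity of matrices, the formula for `Γ` has the invertible factors `η b` and `ηᵀ`
on the two sides, so `Γ` determines the third derivatives. This gives uniqueness up to quadratics
and lets the later arguments apply to every potential. -/
theorem D3_eq_of_isPotential (hM : IsOpen M) (hη : η.det ≠ 0) {F : (ι → 𝕜) → 𝕜}
    (hF : IsPotential M η T.b B₂ F) (hv : v ∈ M) (x y : ι → 𝕜) (j : ι) :
    D3 F v x y (Pi.single j 1) = D2 (T.h j 1) v x y := by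
  obtain ⟨hFs, hΓ, -⟩ := hF
  have key : ∀ γ ε l, c₃ F l γ ε v = D2 (T.h ε 1) v (Pi.single γ 1) (Pi.single l 1) := by
    intro γ
    let P : Matrix ι ι 𝕜 := fun ε l => c₃ F l γ ε v
    let Q : Matrix ι ι 𝕜 := fun ε l => D2 (T.h ε 1) v (Pi.single γ 1) (Pi.single l 1)
    have h : (η * T.b) * P * ηᵀ = (η * T.b) * Q * ηᵀ := by
      ext β α
      have e1 := hΓ v hv α β γ
      rw [T.Γ_eq_h hM hη hv] at e1
      simp only [Matrix.mul_apply (M := _ * _) (N := ηᵀ), Matrix.mul_apply (N := P),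
        Matrix.mul_apply (N := Q), Matrix.transpose_apply, Finset.sum_mul]
      rw [Finset.sum_comm, Finset.sum_comm (f := fun l ε => (η * T.b) β ε * Q ε l * η α l)]
      simp only [P, Q]
      simp only [mul_right_comm _ (η α _)] at e1
      exact e1.symm
    have hu : IsUnit ηᵀ := (Matrix.isUnit_iff_isUnit_det _).2 (by
      rw [Matrix.det_transpose]; exact isUnit_iff_ne_zero.2 hη)
    have hu' : IsUnit (η * T.b) := (Matrix.isUnit_iff_isUnit_det _).2 (T.b_isUnit hη)
    have hPQ : P = Q := hu'.mul_left_cancel (hu.mul_right_cancel h)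
    exact fun ε l => congrFun (congrFun hPQ ε) l
  revert x y
  refine vec_induction (fun α => vec_induction (fun β => ?_) ?_ ?_ ?_) ?_ ?_ ?_
  · rw [← c₃_eq_D3 hM hFs hv, key, D2_symm hM (T.h_smooth j 1) hv]
  all_goals intros; simp_all

theorem isPotential_iff (hM : IsOpen M) (hMc : IsPreconnected M) (hη : η.det ≠ 0)
    (hB : IsBihamiltonianOn M (flatBracket η) B₂) {F : (ι → 𝕜) → 𝕜}
    (hF : IsPotential M η T.b B₂ F) (F' : (ι → 𝕜) → 𝕜) : IsPotential M η T.b B₂ F' ↔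
      ContDiffOn 𝕜 ∞ F' M ∧ IsQuadraticOn M (fun v => F' v - F v) := by
  constructor
  · intro hF'
    refine ⟨hF'.1, isQuadraticOn_of_D3 hM hMc (hF'.1.sub hF.1) fun v hv => ?_⟩
    rw [D3_sub hM hF'.1 hF.1 hv, sub_eq_zero]
    refine D3_eq_of_c₃_eq hM hF'.1 hF.1 hv fun α β γ => ?_
    rw [c₃_eq_D3 hM hF'.1 hv, c₃_eq_D3 hM hF.1 hv, T.D3_eq_of_isPotential hM hη hF hv,
      T.D3_eq_of_isPotential hM hη hF' hv]
  · rintro ⟨hF', hq⟩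
    refine T.isPotential_of_D3_eq hM hMc hη hB hF' fun v hv x y j => ?_
    have h := hq.D3_eq_zero hM hv
    rw [D3_sub hM hF' hF.1 hv, sub_eq_zero] at h
    rw [h, T.D3_eq_of_isPotential hM hη hF hv]

-- Both sides are the Hessian of the second directional derivative of `F` along `a` and `b`; this is
-- the symmetry of fourth derivatives without introducing them.
omit [DecidableEq ι] in
theorem D3_fderiv_apply_symm {F : (ι → 𝕜) → 𝕜} (hM : IsOpen M) (hF : ContDiffOn 𝕜 ∞ F M)
    (hv : v ∈ M) (a b x y : ι → 𝕜) :
    D3 (fun u => fderiv 𝕜 F u a) v b x y = D3 (fun u => fderiv 𝕜 F u b) v a x y := by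
  have key : ∀ a b, D3 (fun u => fderiv 𝕜 F u a) v b x y = D2 (fun u => D2 F u b a) v x y := by
    intro a b
    have ha := smoothOn_fderiv_apply hM hF a
    rw [D3_symm_left hM ha hv, D3_symm_right hM ha hv, ← fderiv3_eq_D3 hM ha hv,
      fderiv_fderiv_eq_D2 hM (smoothOn_fderiv_apply hM ha b) hv,
      D2_congr hM (fun u hu => fderiv_fderiv_eq_D2 hM hF hu b a) hv]
  rw [key, key, D2_congr hM (fun u hu => D2_symm hM hF hu b a) hv]

/-- Potentials of tau-symmetric bihamiltonian structures satisfy the associativity equations. -/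
theorem isWDVVOn_of_isPotential (hM : IsOpen M) (hη : η.det ≠ 0) (hT : T.IsNormalized)
    {F : (ι → 𝕜) → 𝕜} (hF : IsPotential M η T.b B₂ F) : IsWDVVOn M η F := by
  have hs := hF.1
  have hD2 : ∀ i, ∀ v ∈ M, D2 (T.h i 1) v = D2 (fun u => fderiv 𝕜 F u (Pi.single i 1)) v := by
    intro i v hv
    ext x y
    rw [← T.D3_eq_of_isPotential hM hη hF hv, ← fderiv3_eq_D3 hM hs hv,
      fderiv_fderiv_eq_D2 hM (smoothOn_fderiv_apply hM hs _) hv]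
  have hD3 : ∀ i, ∀ v ∈ M, D3 (T.h i 1) v = D3 (fun u => fderiv 𝕜 F u (Pi.single i 1)) v :=
    fun i v hv => fderiv_congr_of_isOpen (f := D2 (T.h i 1)) hM (hD2 i) hv
  intro v hv α β γ δ
  -- Tau-symmetry between levels -1 and 0 and the flows one level above: it expresses the Hessian of
  -- `T.h β 2` by the first and second derivatives of the `T.h · 1`.
  have hflow : ∀ i, ∀ u ∈ M, D2 (T.h β 2) u (Pi.single γ 1) (Pi.single i 1)
      = ∑ k, ∑ m, fderiv 𝕜 (T.h β 1) u (Pi.single k 1) * η k m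
          * D2 (T.h i 1) u (Pi.single γ 1) (Pi.single m 1) := by
    intro i u hu
    rw [← T.timeDeriv_h_zero hM hη hT hu (T.h_smooth β 2), ← flat_timeDeriv hM (T.h_smooth i 1) hu]
    exact T.symmetric i β 0 1 u hu _
  have hder : ∀ i ν, D3 (T.h β 2) v (Pi.single ν 1) (Pi.single γ 1) (Pi.single i 1)
      = (∑ k, ∑ m, c₃ F ν β k v * η k m * c₃ F m γ i v)
        + ∑ k, ∑ m, fderiv 𝕜 (T.h β 1) v (Pi.single k 1) * η k m
          * D3 (T.h i 1) v (Pi.single ν 1) (Pi.single γ 1) (Pi.single m 1) := by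
    intro i ν
    rw [← fderiv_D2_eq_D3 hM (T.h_smooth β 2) hv, fderiv_congr_of_isOpen hM (hflow i) hv]
    have d1 : ∀ k, HasFDerivAt (fun u => fderiv 𝕜 (T.h β 1) u (Pi.single k 1)) _ v := fun k =>
      (differentiableAt_of_smoothOn hM
        (smoothOn_fderiv_apply hM (T.h_smooth β 1) (Pi.single k 1)) hv).hasFDerivAt
    have d2 : ∀ m, HasFDerivAt (fun u => D2 (T.h i 1) u (Pi.single γ 1) (Pi.single m 1)) _ v :=
      fun m => (differentiableAt_of_smoothOn hM (((smoothOn_D2 hM (T.h_smooth i 1)).clm_apply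
        contDiffOn_const).clm_apply contDiffOn_const) hv).hasFDerivAt
    have hsum := HasFDerivAt.fun_sum (u := Finset.univ) fun k _ =>
      HasFDerivAt.fun_sum (u := Finset.univ) fun m _ => ((d1 k).mul_const (η k m)).fun_mul (d2 m)
    rw [hsum.fderiv, _root_.sum_apply, ← Finset.sum_add_distrib]
    refine Finset.sum_congr rfl fun k _ => ?_
    rw [_root_.sum_apply, ← Finset.sum_add_distrib]
    refine Finset.sum_congr rfl fun m _ => ?_
    rw [_root_.add_apply, _root_.smul_apply, _root_.smul_apply, _root_.smul_apply,
      fderiv_fderiv_eq_D2 hM (T.h_smooth β 1) hv, fderiv_D2_eq_D3 hM (T.h_smooth i 1) hv,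
      c₃_eq_D3 hM hs hv, c₃_eq_D3 hM hs hv,
      D3_symm_right hM hs hv (Pi.single ν 1) (Pi.single β 1) (Pi.single k 1),
      T.D3_eq_of_isPotential hM hη hF hv, T.D3_eq_of_isPotential hM hη hF hv,
      D2_symm hM (T.h_smooth i 1) hv (Pi.single γ 1)]
    simp only [smul_eq_mul]
    ring
  have h1 := hder δ α
  have h2 := hder α δ
  have h3 : D3 (T.h β 2) v (Pi.single α 1) (Pi.single γ 1) (Pi.single δ 1)
      = D3 (T.h β 2) v (Pi.single δ 1) (Pi.single γ 1) (Pi.single α 1) := by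
    have hs2 := T.h_smooth β 2
    rw [D3_symm_right hM hs2 hv, D3_symm_left hM hs2 hv, D3_symm_right hM hs2 hv]
  -- These are fourth derivatives of `F`, symmetric under `δ ↔ α`. They cancel between `h1` and
  -- `h2`, and only the terms quadratic in the structure constants remain.
  have h4 : ∀ m, D3 (T.h δ 1) v (Pi.single α 1) (Pi.single γ 1) (Pi.single m 1)
      = D3 (T.h α 1) v (Pi.single δ 1) (Pi.single γ 1) (Pi.single m 1) := fun m => by
    rw [hD3 δ v hv, hD3 α v hv]
    exact D3_fderiv_apply_symm hM hs hv _ _ _ _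
  rw [h3, h2] at h1
  simp only [h4] at h1
  exact (add_right_cancel h1).symm

end TauStructure

end Tau

/-! ### Vector fields on solutions of the associativity equations -/

section Fields

set_option maxSynthPendingDepth 6

open Matrix

variable {𝕜 : Type} [RCLike 𝕜] {ι : Type} [Fintype ι] [DecidableEq ι]
  {M : Set (ι → 𝕜)} {η : Matrix ι ι 𝕜} {B : HydroBracket 𝕜 ι} {F f : (ι → 𝕜) → 𝕜}
  {v e w : ι → 𝕜} {E : (ι → 𝕜) → (ι → 𝕜)} {A : Matrix ι ι 𝕜} {r : ι → 𝕜} {c κ : 𝕜}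

/-- The action of a matrix on vectors, as a continuous linear map. -/
def mulVecL (A : Matrix ι ι 𝕜) : (ι → 𝕜) →L[𝕜] (ι → 𝕜) :=
  LinearMap.toContinuousLinearMap (Matrix.mulVecLin A)

omit [DecidableEq ι] in
@[simp]
theorem mulVecL_apply (A : Matrix ι ι 𝕜) (x : ι → 𝕜) : mulVecL A x = A *ᵥ x := rfl

omit [DecidableEq ι] in
theorem hasFDerivAt_affine (hM : IsOpen M) (hE : ∀ v ∈ M, E v = A *ᵥ v + r) (hv : v ∈ M) :
    HasFDerivAt E (mulVecL A) v :=
  ((mulVecL A).hasFDerivAt.add_const r).congr_of_eventuallyEq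
    (Filter.eventuallyEq_of_mem (hM.mem_nhds hv) hE)

omit [DecidableEq ι] in
theorem lieBracket_const_affine (hM : IsOpen M) (hE : ∀ v ∈ M, E v = A *ᵥ v + r) (hv : v ∈ M)
    (e : ι → 𝕜) : VectorField.lieBracket 𝕜 (fun _ => e) E v = A *ᵥ e := by
  rw [VectorField.lieBracket, (hasFDerivAt_affine hM hE hv).fderiv]
  simp

theorem nablaField_affine (hM : IsOpen M) (hE : ∀ v ∈ M, E v = A *ᵥ v + r) (hv : v ∈ M) :
    nablaField E v = A := by
  ext β ε
  have h := hasFDerivAt_pi'.1 (hasFDerivAt_affine hM hE hv) β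
  rw [nablaField, pd, h.fderiv]
  simp

omit [DecidableEq ι] in
theorem D2_fderiv_apply (hM : IsOpen M) (hF : ContDiffOn 𝕜 ∞ F M) (hv : v ∈ M) (w x y : ι → 𝕜) :
    D2 (fun u => fderiv 𝕜 F u w) v x y = D3 F v w x y := by
  rw [← fderiv_fderiv_eq_D2 hM (smoothOn_fderiv_apply hM hF w) hv, fderiv3_eq_D3 hM hF hv,
    D3_symm_right hM hF hv, D3_symm_left hM hF hv]

/-- The Hessian of `∂_w F` is `D3 F v w`, so `∂_w F` is quadratic exactly when multiplication by `w`
is the same operator at all points. -/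
theorem isQuadraticDirection_iff (hM : IsOpen M) (hMc : IsPreconnected M)
    (hF : ContDiffOn 𝕜 ∞ F M) :
    IsQuadraticDirection M F w ↔ ∃ C, ∀ v ∈ M, D3 F v w = C := by
  have hw := smoothOn_fderiv_apply hM hF w
  have key : ∀ v ∈ M, D2 (fun u => fderiv 𝕜 F u w) v = D3 F v w := fun v hv => by
    ext x y
    exact D2_fderiv_apply hM hF hv w x y
  constructor
  · intro h
    obtain ⟨C, hC⟩ := h.exists_D2_eq hM
    exact ⟨C, fun v hv => by rw [← key v hv, hC v hv]⟩
  · rintro ⟨C, hC⟩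
    refine isQuadraticOn_of_D3 hM hMc hw fun v hv => ?_
    unfold D3
    rw [fderiv_congr_of_isOpen (f := D2 fun u => fderiv 𝕜 F u w) (g := fun _ => C) hM
      (fun u hu => by rw [key u hu, hC u hu]) hv]
    simp

/-- Multiplication by `w` is self-adjoint for the metric: the `γ`-component of `w·∇F` is the
derivative of `F` along `w·∂_γ`. -/
theorem twist_sum (hM : IsOpen M) (hη : η.IsSymm) (hF : ContDiffOn 𝕜 ∞ F M) (hv : v ∈ M)
    (w : ι → 𝕜) (γ : ι) :
    ∑ ε, ∑ ν, ∑ μ, w ε * c₃ F ε γ ν v * η ν μ * pd μ F v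
      = fderiv 𝕜 F v (prodAt η F v w (Pi.single γ 1)) := by
  rw [clm_eq_sum (fderiv 𝕜 F v), Finset.sum_comm,
    Finset.sum_congr rfl fun ν _ => Finset.sum_comm, Finset.sum_comm]
  refine Finset.sum_congr rfl fun μ _ => ?_
  simp only [prodAt_apply, Matrix.mulVec, dotProduct, smul_eq_mul, Finset.sum_mul]
  refine Finset.sum_congr rfl fun ν _ => ?_
  rw [D3_symm_left hM hF hv, clm_eq_sum (D3 F v) w]
  simp only [_root_.sum_apply, _root_.smul_apply, smul_eq_mul, Finset.mul_sum, Finset.sum_mul]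
  refine Finset.sum_congr rfl fun ε _ => ?_
  rw [c₃_eq_D3 hM hF hv, D3_symm_right hM hF hv, hη.apply μ ν]
  unfold pd
  ring

/-- A function whose third derivative is twice that of `F`, twisted by the constant operator of
multiplication by `w`, is `2 F^w` up to a quadratic polynomial. -/
theorem exists_isTwist (hM : IsOpen M) (hMc : IsPreconnected M) (hη : η.IsSymm)
    (hF : ContDiffOn 𝕜 ∞ F M) (hf : ContDiffOn 𝕜 ∞ f M) (W : (ι → 𝕜) →L[𝕜] (ι → 𝕜))
    (hW : ∀ v ∈ M, ∀ x, prodAt η F v w x = W x)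
    (h : ∀ v ∈ M, ∀ x y z, D3 f v x y z = 2 * D3 F v x y (W z)) :
    ∃ G, IsTwist M η F w G ∧ IsQuadraticOn M (fun v => f v - 2 * G v) := by
  have haff : ∀ γ, ∃ (L : (ι → 𝕜) →L[𝕜] 𝕜) (k : 𝕜), ∀ v ∈ M,
      fderiv 𝕜 f v (Pi.single γ 1) = 2 * fderiv 𝕜 F v (W (Pi.single γ 1)) + L v + k := by
    intro γ
    set x : ι → 𝕜 := Pi.single γ 1
    have s1 := smoothOn_fderiv_apply hM hf x
    have s2 := smoothOn_fderiv_apply hM hF (W x)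
    have s3 : ContDiffOn 𝕜 ∞ (fun u => fderiv 𝕜 f u x - 2 * fderiv 𝕜 F u (W x)) M :=
      s1.sub (contDiffOn_const.mul s2)
    obtain ⟨L, hL⟩ := hM.exists_is_const_of_fderiv_eq_zero hMc
      ((smoothOn_fderiv hM s3).differentiableOn (by simp)) (fun v hv => by
        change D2 (fun u => fderiv 𝕜 f u x - 2 * fderiv 𝕜 F u (W x)) v = 0
        ext y z
        rw [D2_sub hM s1 (contDiffOn_const.mul s2) hv, D2_const_mul hM s2 2 hv]
        simp only [_root_.sub_apply, _root_.smul_apply, smul_eq_mul, D2_fderiv_apply hM hf hv,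
          D2_fderiv_apply hM hF hv]
        rw [D3_symm_left hM hf hv, D3_symm_right hM hf hv, h v hv, D3_symm_left hM hF hv (W x),
          D3_symm_right hM hF hv y (W x), sub_self]
        rfl)
    obtain ⟨k, hk⟩ := exists_affine_of_fderiv_const hM hMc (s3.differentiableOn (by simp)) hL
    exact ⟨L, k, fun v hv => by linear_combination hk v hv⟩
  choose L k hLk using haff
  let pr : ι → ((ι → 𝕜) →L[𝕜] 𝕜) := fun j => ContinuousLinearMap.proj (R := 𝕜) (φ := fun _ => 𝕜) j
  -- The matrix of the `L γ` need not be symmetric. Subtracting `C v v` from `f` removes its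
  -- symmetric part; the antisymmetric part cannot be integrated and survives as `ρ`, with the
  -- further factor `1/2` coming from `f = 2G`.
  let C : (ι → 𝕜) →L[𝕜] (ι → 𝕜) →L[𝕜] 𝕜 := ∑ γ, (pr γ).smulRight ((1 / 2 : 𝕜) • L γ)
  let l : (ι → 𝕜) →L[𝕜] 𝕜 := ∑ γ, k γ • pr γ
  have hCl : ∀ x y, C x y = ∑ γ, x γ * (1 / 2 * L γ y) := by intro x y; simp [C, pr]
  have hs := (smooth_quadratic C l 0).contDiffOn (s := M)
  let ρ : Matrix ι ι 𝕜 := fun γ ν => (1 / 2 : 𝕜) * (L γ (Pi.single ν 1) - L ν (Pi.single γ 1))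
  refine ⟨fun v => (1 / 2 : 𝕜) * (f v - (C v v + l v + 0)), ⟨contDiffOn_const.mul (hf.sub hs), ρ,
    ?_, fun v hv γ => ?_⟩, isQuadraticOn_iff.2 ⟨C, l, 0, fun v _ => by ring⟩⟩
  · ext γ ν
    rw [Matrix.transpose_apply, Matrix.neg_apply]
    simp only [ρ]
    ring
  · rw [twist_sum hM hη hF hv, hW v hv]
    have hd := ((differentiableAt_of_smoothOn hM hf hv).hasFDerivAt.fun_sub
      (hasFDerivAt_quadratic C l 0 v)).const_mul (1 / 2 : 𝕜)
    unfold pd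
    rw [hd.fderiv, _root_.smul_apply, _root_.sub_apply, hLk γ v hv]
    have e1 : C v (Pi.single γ 1) = ∑ ν, 1 / 2 * L ν (Pi.single γ 1) * v ν := by
      rw [hCl]
      exact Finset.sum_congr rfl fun ν _ => by ring
    have e2 : C (Pi.single γ 1) v = 1 / 2 * L γ v := by
      rw [hCl, Finset.sum_eq_single γ]
      · simp
      · intro b _ hb
        simp [hb]
      · simp
    have e3 : L γ v = ∑ ν, L γ (Pi.single ν 1) * v ν := by
      rw [clm_eq_sum (L γ) v]
      exact Finset.sum_congr rfl fun ν _ => by rw [smul_eq_mul, mul_comm]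
    have e4 : l (Pi.single γ 1) = k γ := by simp [l, pr, Pi.single_apply]
    have e5 : ∑ ν, ρ γ ν * v ν = 1 / 2 * L γ v - C v (Pi.single γ 1) := by
      rw [e1, e3, Finset.mul_sum, ← Finset.sum_sub_distrib]
      exact Finset.sum_congr rfl fun ν _ => by simp only [ρ]; ring
    rw [e5]
    simp only [_root_.add_apply, ContinuousLinearMap.flip_apply, e2, e4, smul_eq_mul]
    ring

/-! ### Raised indices, rescaling and the two normal forms. -/

theorem cUp_eq_D3 (hM : IsOpen M) (hF : ContDiffOn 𝕜 ∞ F M) (hv : v ∈ M) (α β γ : ι) :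
    cUp η F α β γ v = D3 F v (η α) (η β) (Pi.single γ 1) := by
  simp only [cUp, c₃_eq_D3 hM hF hv]
  rw [D3_symm_right hM hF hv, D3_symm_left hM hF hv, D3_eq_sum (D3 F v (Pi.single γ 1))]
  refine Finset.sum_congr rfl fun μ _ => Finset.sum_congr rfl fun ν _ => ?_
  rw [D3_symm_left hM hF hv (Pi.single γ 1), D3_symm_right hM hF hv _ (Pi.single γ 1)]
  ring

theorem sum_cUp (hM : IsOpen M) (hF : ContDiffOn 𝕜 ∞ F M) (hv : v ∈ M) (α β : ι) (x : ι → 𝕜) :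
    ∑ ε, x ε * cUp η F α β ε v = D3 F v (η α) (η β) x := by
  rw [clm_eq_sum (D3 F v (η α) (η β)) x]
  simp [cUp_eq_D3 hM hF hv]

theorem c₃_const_mul (hM : IsOpen M) (hF : ContDiffOn 𝕜 ∞ F M) (hv : v ∈ M) (k : 𝕜) (α β γ : ι) :
    c₃ (fun u => k * F u) α β γ v = k * c₃ F α β γ v := by
  rw [c₃_eq_D3 hM (contDiffOn_const.mul hF) hv, c₃_eq_D3 hM hF hv, D3_const_mul hM hF k hv]
  rfl

theorem IsUnitalSolution.rescale (h : IsUnitalSolution M η F e) (hκ : κ ≠ 0) :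
    IsUnitalSolution M η (fun v => κ * F v) (κ⁻¹ • e) where
  isOpen := h.isOpen
  isConnected := h.isConnected
  metric_symm := h.metric_symm
  metric_nondeg := h.metric_nondeg
  smooth := contDiffOn_const.mul h.smooth
  wdvv := fun v hv α β γ δ => by
    have key : ∀ α β γ δ, ∑ l, ∑ m, c₃ (fun v => κ * F v) α β l v * η l m
        * c₃ (fun v => κ * F v) m γ δ v
        = κ * κ * ∑ l, ∑ m, c₃ F α β l v * η l m * c₃ F m γ δ v := by
      intro α β γ δ
      simp only [c₃_const_mul h.isOpen h.smooth hv, Finset.mul_sum]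
      exact Finset.sum_congr rfl fun l _ => Finset.sum_congr rfl fun m _ => by ring
    rw [key, key, h.wdvv v hv]
  unity := fun v hv α β => by
    rw [← h.unity v hv α β]
    refine Finset.sum_congr rfl fun ε _ => ?_
    rw [c₃_const_mul h.isOpen h.smooth hv, Pi.smul_apply, smul_eq_mul]
    field_simp

/-- A quasihomogeneous unital solution is, after rescaling, a Frobenius manifold. -/
theorem IsUnitalSolution.isFrobenius (h : IsUnitalSolution M η F e)
    (hE : ∀ v ∈ M, E v = A *ᵥ v + r) (hA : A *ᵥ e = κ • e) (hκ : κ ≠ 0)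
    (hq : IsQuadraticOn M (fun v => fderiv 𝕜 F v (E v) - 2 * (c + κ) * F v)) :
    IsFrobenius M η (fun v => κ * F v) (κ⁻¹ • e) (fun v => κ⁻¹ • E v) (1 - 2 * c / κ) where
  toIsUnitalSolution := h.rescale hκ
  linear := ⟨κ⁻¹ • A, κ⁻¹ • r, fun v hv => by simp only [hE v hv, Matrix.smul_mulVec, smul_add]⟩
  -- Here `3 - d = 2(c + κ)/κ`, and the factors `κ` and `κ⁻¹` of the potential and the field cancel
  -- in `∂_E F`; the same quadratic polynomial serves.
  quasihomogeneous := by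
    obtain ⟨Q, q, k, hk⟩ := hq
    refine ⟨Q, q, k, fun v hv => ?_⟩
    rw [← hk v hv]
    beta_reduce
    rw [fderiv_const_mul (differentiableAt_of_smoothOn h.isOpen h.smooth hv),
      _root_.smul_apply, map_smul, smul_eq_mul, smul_eq_mul]
    field_simp
    ring
  lie := fun v hv => by
    rw [lieBracket_const_affine (A := κ⁻¹ • A) (r := κ⁻¹ • r) h.isOpen
      (fun v hv => by simp only [hE v hv, Matrix.smul_mulVec, smul_add]) hv, Matrix.smul_mulVec,
      Matrix.mulVec_smul, hA, smul_smul, smul_smul]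
    field_simp

theorem IsUnitalSolution.isDegenerateFrobenius (h : IsUnitalSolution M η F e)
    (hE : ∀ v ∈ M, E v = A *ᵥ v + r) (hA : A *ᵥ e = 0)
    (hq : IsQuadraticOn M (fun v => fderiv 𝕜 F v (E v) - 2 * c * F v)) :
    IsDegenerateFrobenius M η F e E (2 * c) where
  toIsUnitalSolution := h
  linear := ⟨A, r, hE⟩
  quasihomogeneous := hq
  lie := fun v hv => by rw [lieBracket_const_affine h.isOpen hE hv, hA]

/-- With `∇(κ⁻¹E) = κ⁻¹A` and `d = 1 - 2c/κ` one gets `1/2 - μ = κ⁻¹(A - c)`, and the factor `κ⁻¹`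
is absorbed by the third derivatives of `κF`. -/
theorem IsFrobenius.normalForm (h : IsUnitalSolution M η F e)
    (hE : ∀ v ∈ M, E v = A *ᵥ v + r) (hκ : κ ≠ 0)
    (hfrob : IsFrobenius M η (fun v => κ * F v) (κ⁻¹ • e) (fun v => κ⁻¹ • E v) (1 - 2 * c / κ))
    (hg : IsIntersectionForm M η F E B)
    (hΓ : ∀ v ∈ M, ∀ α β γ, B.Γ v α β γ = ∑ ε, cUp η F α ε γ v * (A - c • 1) β ε) :
    IsFrobeniusNormalForm M η (fun v => κ * F v) (κ⁻¹ • e) (fun v => κ⁻¹ • E v)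
      (1 - 2 * c / κ) B := by
  have hcUp : ∀ v ∈ M, ∀ α β γ, cUp η (fun v => κ * F v) α β γ v = κ * cUp η F α β γ v := by
    intro v hv α β γ
    simp only [cUp, c₃_const_mul h.isOpen h.smooth hv, Finset.mul_sum]
    exact Finset.sum_congr rfl fun l _ => Finset.sum_congr rfl fun m _ => by ring
  refine ⟨hfrob, fun v hv α β => ?_, fun v hv α β γ => ?_⟩
  · rw [hg v hv]
    refine Finset.sum_congr rfl fun ε _ => ?_
    rw [hcUp v hv]
    simp only [Pi.smul_apply, smul_eq_mul]
    field_simp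
  · rw [hΓ v hv]
    refine Finset.sum_congr rfl fun ε _ => ?_
    rw [hcUp v hv, nablaField_affine (A := κ⁻¹ • A) (r := κ⁻¹ • r) h.isOpen
      (fun v hv => by simp only [hE v hv, Matrix.smul_mulVec, smul_add]) hv]
    simp only [Matrix.sub_apply, Matrix.smul_apply, smul_eq_mul]
    field_simp
    ring

theorem IsDegenerateFrobenius.normalForm (h : IsDegenerateFrobenius M η F e E (2 * c))
    (hE : ∀ v ∈ M, E v = A *ᵥ v + r) (hg : IsIntersectionForm M η F E B)
    (hΓ : ∀ v ∈ M, ∀ α β γ, B.Γ v α β γ = ∑ ε, cUp η F α ε γ v * (A - c • 1) β ε) :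
    IsDegenerateNormalForm M η F e E (2 * c) B := by
  refine ⟨h, hg, fun v hv α β γ => ?_⟩
  rw [hΓ v hv, ← Finset.sum_neg_distrib]
  refine Finset.sum_congr rfl fun ε _ => ?_
  rw [nablaField_affine h.isOpen hE hv]
  simp only [Matrix.sub_apply, Matrix.smul_apply, smul_eq_mul]
  ring

/-- On a rigid solution, the only quadratic directions are the multiples of the unity. -/
theorem IsUnitalSolution.eq_smul_of_isRigidOn (h : IsUnitalSolution M η F e)
    (hr : IsRigidOn M η F) (hw : IsQuadraticDirection M F w) : ∃ k : 𝕜, w = k • e := by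
  obtain ⟨C, hC⟩ := (isQuadraticDirection_iff h.isOpen h.isConnected.isPreconnected h.smooth).1 hw
  obtain ⟨v₀, hv₀⟩ := h.isConnected.nonempty
  -- The form `D3 F v w` is constant because `w` is a quadratic direction, and invariant by
  -- associativity. Rigidity makes it `k • η⁻¹`, which is the form of `k • e`.
  let S : Matrix ι ι 𝕜 := fun α β => C (Pi.single α 1) (Pi.single β 1)
  have hS : ∀ x y, x ⬝ᵥ (S *ᵥ y) = C x y := by
    intro x y
    rw [D3_eq_sum C x y]
    simp only [dotProduct, Matrix.mulVec, Finset.mul_sum, S]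
    exact Finset.sum_congr rfl fun l _ => Finset.sum_congr rfl fun m _ => by ring
  obtain ⟨k, hk⟩ := hr S
    (by
      ext α β
      rw [Matrix.transpose_apply]
      simp only [S]
      rw [← hC v₀ hv₀, D3_symm_right h.isOpen h.smooth hv₀])
    (fun v hv x y z => by
      rw [hS, hS, mulAt_eq_prodAt h.isOpen h.smooth hv, mulAt_eq_prodAt h.isOpen h.smooth hv,
        ← hC v hv, D3_symm_right h.isOpen h.smooth hv, h.prod_comm hv x y,
        (isWDVVOn_iff h.isOpen h.smooth).1 h.wdvv v hv w z y x,
        (isWDVVOn_iff h.isOpen h.smooth).1 h.wdvv v hv w x y z, D3_symm_left h.isOpen h.smooth hv])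
  refine ⟨k, eq_of_low_eq h.metric_nondeg fun z => ?_⟩
  rw [map_smul, smul_eq_mul, ← h.D3_unity hv₀, D3_symm_right h.isOpen h.smooth hv₀,
    D3_symm_left h.isOpen h.smooth hv₀, D3_symm_right h.isOpen h.smooth hv₀, hC v₀ hv₀, ← hS, hk,
    Matrix.smul_mulVec, dotProduct_smul, low_apply, smul_eq_mul]

end Fields

/-! ### Compatibility with spatial translations -/

section Translation

set_option maxSynthPendingDepth 6

open Matrix

variable {𝕜 : Type} [RCLike 𝕜] {ι : Type} [Fintype ι] [DecidableEq ι]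
  {M : Set (ι → 𝕜)} {η : Matrix ι ι 𝕜} {B₂ : HydroBracket 𝕜 ι} {F f : (ι → 𝕜) → 𝕜}
  {v : ι → 𝕜} {E : (ι → 𝕜) → (ι → 𝕜)} {o : ι}

namespace TauStructure

variable (T : TauStructure M η B₂)

theorem low_eq_of_mulVec_eq (hη : η.det ≠ 0) (hηs : η.IsSymm) {L : (ι → 𝕜) →L[𝕜] 𝕜} {ξ : ι → 𝕜}
    (h : (η *ᵥ fun j => L (Pi.single j 1)) = ξ) (y : ι → 𝕜) : L y = low η ξ y := by
  rw [low_symm hηs, low_apply, ← h, Matrix.mulVec_mulVec,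
    Matrix.nonsing_inv_mul _ (isUnit_iff_ne_zero.2 hη), Matrix.one_mulVec, clm_eq_sum L y]
  rfl

theorem D2_h_translation (hM : IsOpen M) (hη : η.det ≠ 0) (hηs : η.IsSymm)
    (hTC : T.IsTranslationCompatible o) (hv : v ∈ M) (x y : ι → 𝕜) :
    D2 (T.h o 1) v x y = low η x y := by
  have h := (hTC v hv x).1
  rw [flat_flow hM (T.h_smooth o 1) hv] at h
  exact low_eq_of_mulVec_eq hη hηs h y

/-- By symmetry `∂_o` may be moved to the last slot of `D3 F v`. There the form is the Hessian of
`T.h o 1`, which is the lowered metric because the flow of this density is the translation. -/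
theorem isUnitalSolution (hM : IsOpen M) (hMc : IsConnected M) (hη : η.det ≠ 0) (hηs : η.IsSymm)
    (hT : T.IsNormalized) (hTC : T.IsTranslationCompatible o) (hF : IsPotential M η T.b B₂ F) :
    IsUnitalSolution M η F (Pi.single o 1) where
  isOpen := hM
  isConnected := hMc
  metric_symm := hηs
  metric_nondeg := hη
  smooth := hF.1
  wdvv := T.isWDVVOn_of_isPotential hM hη hT hF
  unity := fun v hv => (unity_iff hM hF.1 hv).2 fun x y => by
    rw [D3_symm_left hM hF.1 hv, D3_symm_right hM hF.1 hv, T.D3_eq_of_isPotential hM hη hF hv,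
      T.D2_h_translation hM hη hηs hTC hv]

theorem a_translation_ne_zero (hTC : T.IsTranslationCompatible o) (hMn : M.Nonempty) :
    T.a 1 1 o o ≠ 0 := by
  intro h0
  obtain ⟨v, hv⟩ := hMn
  have h := congrFun (hTC v hv (Pi.single o 1)).2 o
  rw [h0] at h
  simp at h

theorem D2_φ_translation (hM : IsOpen M) (hη : η.det ≠ 0) (hηs : η.IsSymm)
    (hTC : T.IsTranslationCompatible o) (hv : v ∈ M) (x y : ι → 𝕜) :
    D2 (T.φ o 1) v x y = (T.a 1 1 o o)⁻¹ * low η x y := by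
  have h := (hTC v hv x).2
  rw [flat_flow hM (T.φ_smooth o 1) hv, ← Matrix.mulVec_smul] at h
  rw [← low_eq_of_mulVec_eq (L := T.a 1 1 o o • D2 (T.φ o 1) v x) hη hηs h y, _root_.smul_apply,
    smul_eq_mul, inv_mul_cancel_left₀ (T.a_translation_ne_zero hTC ⟨v, hv⟩)]

theorem D2_φ_eq_D3 (hM : IsOpen M) (hη : η.det ≠ 0) (hF : IsPotential M η T.b B₂ F) (hv : v ∈ M)
    (α : ι) (x y : ι → 𝕜) : D2 (T.φ α 1) v x y = D3 F v x y (T.b α) := by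
  rw [T.D2_φ_one hM hv, clm_eq_sum (D3 F v x y) (T.b α)]
  simp [T.D3_eq_of_isPotential hM hη hF hv]

/-- The Hessian of `T.φ o 1` is computed twice: as `D3 F v` with the row `T.b o` inserted, and, by
translation compatibility, as a multiple of the metric. Pairing with the unity and nondegeneracy
identify the row. -/
theorem b_translation (hU : IsUnitalSolution M η F (Pi.single o 1))
    (hTC : T.IsTranslationCompatible o) (hF : IsPotential M η T.b B₂ F) :
    T.b o = (T.a 1 1 o o)⁻¹ • Pi.single o 1 := by
  obtain ⟨v, hv⟩ := hU.isConnected.nonempty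
  refine eq_of_low_eq hU.metric_nondeg fun z => ?_
  rw [← hU.D3_unity hv, ← T.D2_φ_eq_D3 hU.isOpen hU.metric_nondeg hF hv,
    T.D2_φ_translation hU.isOpen hU.metric_nondeg hU.metric_symm hTC hv, map_smul,
    low_symm hU.metric_symm, smul_eq_mul]

/-- Contracting the first upper index with `η_{oε}` inserts the unity into the structure constants,
leaving the metric; only `b` with its indices moved by `η` survives. -/
theorem sum_Γ_first (hU : IsUnitalSolution M η F (Pi.single o 1))
    (hF : IsPotential M η T.b B₂ F) (hv : v ∈ M) (α γ : ι) :
    ∑ ε, B₂.Γ v ε α γ * η⁻¹ o ε = (η * T.b * η⁻¹) α γ := by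
  have hηs := hU.metric_symm
  have hηs' : (η⁻¹).IsSymm := by
    rw [Matrix.IsSymm, Matrix.transpose_nonsing_inv, hηs.eq]
  simp only [hF.2.1 v hv, Finset.sum_mul]
  rw [Finset.sum_comm, Matrix.mul_apply]
  refine Finset.sum_congr rfl fun ε _ => ?_
  rw [Finset.sum_comm]
  have : ∀ l, ∑ κ, (η * T.b) α ε * η κ l * c₃ F l γ ε v * η⁻¹ o κ
      = (η * T.b) α ε * ((1 : Matrix ι ι 𝕜) o l * c₃ F l γ ε v) := by
    intro l
    rw [← Matrix.nonsing_inv_mul η (isUnit_iff_ne_zero.2 hU.metric_nondeg),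
      Matrix.mul_apply (M := η⁻¹) (N := η), Finset.sum_mul, Finset.mul_sum]
    exact Finset.sum_congr rfl fun κ _ => by ring
  simp only [this, ← Finset.mul_sum]
  congr 1
  rw [Finset.sum_eq_single o (fun b _ hb => by simp [hb.symm]) (by simp),
    Matrix.one_apply_eq, one_mul, c₃_eq_D3 hU.isOpen hU.smooth hv, hU.D3_unity hv, low_single,
    hηs'.apply]

/-- The gradient of the distinguished coordinate with respect to the second metric is an affine
vector field. -/
theorem euler_affine (hU : IsUnitalSolution M η F (Pi.single o 1))
    (hB : IsBihamiltonianOn M (flatBracket η) B₂) (hTC : T.IsTranslationCompatible o)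
    (hF : IsPotential M η T.b B₂ F) (hE : ∀ v α, E v α = ∑ ε, B₂.g v α ε * η⁻¹ o ε) :
    ∃ r, ∀ v ∈ M, E v = ((T.a 1 1 o o)⁻¹ • (1 : Matrix ι ι 𝕜) + η * T.b * η⁻¹) *ᵥ v + r := by
  have hM := hU.isOpen
  set A := (T.a 1 1 o o)⁻¹ • (1 : Matrix ι ι 𝕜) + η * T.b * η⁻¹
  have hd : ∀ v ∈ M, HasFDerivAt E (mulVecL A) v := by
    intro v hv
    refine hasFDerivAt_pi'.2 fun α => ?_
    have h1 := HasFDerivAt.fun_sum (u := Finset.univ) fun ε _ =>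
      (differentiableAt_of_smoothOn hM (hB.2.1.1 α ε) hv).hasFDerivAt.mul_const (η⁻¹ o ε)
    have h2 : (fun x => E x α) = fun v => ∑ ε, B₂.g v α ε * η⁻¹ o ε := funext fun v => hE v α
    rw [h2]
    refine h1.congr_fderiv ?_
    ext x
    rw [clm_eq_sum, clm_eq_sum (_ ∘L _)]
    refine Finset.sum_congr rfl fun γ _ => ?_
    congr 1
    have h3 : ∀ ε, fderiv 𝕜 (fun y => B₂.g y α ε) v (Pi.single γ 1)
        = B₂.Γ v α ε γ + B₂.Γ v ε α γ := fun ε => hB.pd_g hM hv α ε γ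
    simp only [_root_.sum_apply, _root_.smul_apply, h3, smul_eq_mul, mul_add,
      Finset.sum_add_distrib]
    -- The derivative of `E` is the sum of the contractions of `Γ` over its second and its first
    -- upper index: `h4` with `h6` evaluates the one as `c δ`, and `h5` the other as `b̄`.
    have h4 := T.casimir_one hM hv o α γ
    have h5 := T.sum_Γ_first hU hF hv α γ
    have h6 : (η *ᵥ fun j => D2 (T.φ o 1) v (Pi.single γ 1) (Pi.single j 1)) α
        = (T.a 1 1 o o)⁻¹ * (1 : Matrix ι ι 𝕜) α γ := by
      simp only [T.D2_φ_translation hM hU.metric_nondeg hU.metric_symm hTC hv]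
      rw [show (fun j => (T.a 1 1 o o)⁻¹ * low η (Pi.single γ 1) (Pi.single j 1))
        = (T.a 1 1 o o)⁻¹ • (η⁻¹ *ᵥ Pi.single γ 1) from ?_]
      · rw [Matrix.mulVec_smul, Matrix.mulVec_mulVec,
          Matrix.mul_nonsing_inv _ (isUnit_iff_ne_zero.2 hU.metric_nondeg)]
        simp [Matrix.one_apply]
      · ext j
        rw [low_symm hU.metric_symm, low_apply]
        simp
    simp only [mul_comm (η⁻¹ o _)]
    rw [h5, ← h4, h6]
    simp [A, Matrix.one_apply]
  obtain ⟨r, hr⟩ := exists_affine_of_fderiv_const hM hU.isConnected.isPreconnected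
    (fun v hv => (hd v hv).differentiableAt.differentiableWithinAt) fun v hv => (hd v hv).fderiv
  exact ⟨r, hr⟩

/-- The second metric with lowered indices. -/
theorem torsion_free (hM : IsOpen M) (hη : η.det ≠ 0) (hF : IsPotential M η T.b B₂ F)
    (hv : v ∈ M) (t x y : ι → 𝕜) :
    x ⬝ᵥ (η⁻¹ * B₂.g v) *ᵥ (fun j => D3 F v y (Pi.single j 1) t)
      = y ⬝ᵥ (η⁻¹ * B₂.g v) *ᵥ (fun j => D3 F v x (Pi.single j 1) t) := by
  have hrow : ∀ α, x ⬝ᵥ (η⁻¹ * B₂.g v) *ᵥ (fun j => D3 F v y (Pi.single j 1) (T.b α))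
      = y ⬝ᵥ (η⁻¹ * B₂.g v) *ᵥ (fun j => D3 F v x (Pi.single j 1) (T.b α)) := by
    intro α
    -- The differential of `T.φ α 1` contracted with `b^{jε}`; with it the `Γ`-term of the second
    -- flow takes the symmetric form `D3 F v (·) ξ t`.
    let t : ι → 𝕜 := fun ε => ∑ j, pd j (T.φ α 1) v * (η * T.b) j ε
    have key : ∀ x ξ, D2 (T.φ α 2) v ξ x
        = x ⬝ᵥ (η⁻¹ * B₂.g v) *ᵥ (fun j => D3 F v ξ (Pi.single j 1) (T.b α)) + D3 F v x ξ t := by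
      intro x ξ
      have h := T.casimir_succ α 1 v hv ξ
      rw [flat_flow hM (T.φ_smooth α 2) hv] at h
      have hflow : B₂.flow (T.φ α 1) v ξ
          = B₂.g v *ᵥ (fun j => D3 F v ξ (Pi.single j 1) (T.b α))
            + η *ᵥ (fun l => D3 F v (Pi.single l 1) ξ t) := by
        ext i
        simp only [HydroBracket.flow, sum_pd_mul hM (T.φ_smooth α 1) hv,
          T.D2_φ_eq_D3 hM hη hF hv, Finset.sum_add_distrib, Pi.add_apply]
        congr 1
        simp only [hF.2.1 v hv, Matrix.mulVec, dotProduct]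
        have : ∀ l, D3 F v (Pi.single l 1) ξ t
            = ∑ k, ∑ ε, D3 F v (Pi.single l 1) (Pi.single k 1) (Pi.single ε 1) * ξ k * t ε :=
          fun l => D3_eq_sum _ _ _
        simp only [this, c₃_eq_D3 hM hF.1 hv, t, Finset.mul_sum, Finset.sum_mul]
        have comm4 : ∀ X : ι → ι → ι → ι → 𝕜,
            ∑ j, ∑ k, ∑ ε, ∑ l, X j k ε l = ∑ l, ∑ k, ∑ ε, ∑ j, X j k ε l := by
          intro X
          rw [Finset.sum_comm, Finset.sum_congr rfl fun k _ => Finset.sum_comm,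
            Finset.sum_congr rfl fun k _ => Finset.sum_congr rfl fun ε _ => Finset.sum_comm,
            Finset.sum_congr rfl fun k _ => Finset.sum_comm, Finset.sum_comm]
        rw [comm4]
        refine Finset.sum_congr rfl fun l _ => Finset.sum_congr rfl fun k _ =>
          Finset.sum_congr rfl fun ε _ => Finset.sum_congr rfl fun j _ => ?_
        ring
      rw [hflow] at h
      have h' := congrArg (fun z => η⁻¹ *ᵥ z) h
      simp only [Matrix.mulVec_add, Matrix.mulVec_mulVec,
        Matrix.nonsing_inv_mul _ (isUnit_iff_ne_zero.2 hη), Matrix.one_mulVec] at h'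
      rw [clm_eq_sum (D2 (T.φ α 2) v ξ) x, clm_eq_sum (D3 F v) x]
      have h'' := congrArg (fun z => x ⬝ᵥ z) h'
      simp only [dotProduct_add] at h''
      simp only [_root_.sum_apply, _root_.smul_apply, smul_eq_mul]
      exact h''
    -- The Hessian of `T.φ α 2` and the term with `t` are both symmetric in the two vectors, so the
    -- remaining term is symmetric too.
    have h1 := key x y
    have h2 := key y x
    rw [D2_symm hM (T.φ_smooth α 2) hv, h2, D3_symm_left hM hF.1 hv] at h1
    exact (add_right_cancel h1).symm
  have hdet : IsUnit (T.a 1 1).det := isUnit_iff_ne_zero.2 (T.a_nondeg 1)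
  -- The rows of `b` span, since `b` is invertible; the symmetry extends from rows to all `t` by
  -- linearity.
  have ht : t = ∑ α, (t ᵥ* T.a 1 1) α • T.b α := by
    have : t = (t ᵥ* T.a 1 1) ᵥ* T.b := by
      rw [Matrix.vecMul_vecMul, b, Matrix.mul_nonsing_inv _ hdet, Matrix.vecMul_one]
    conv_lhs => rw [this]
    exact Matrix.vecMul_eq_sum _ _
  have hexp : ∀ x y, x ⬝ᵥ (η⁻¹ * B₂.g v) *ᵥ (fun j => D3 F v y (Pi.single j 1) t)
      = ∑ α, (t ᵥ* T.a 1 1) α *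
        (x ⬝ᵥ (η⁻¹ * B₂.g v) *ᵥ (fun j => D3 F v y (Pi.single j 1) (T.b α))) := by
    intro x y
    have : (fun j => D3 F v y (Pi.single j 1) t) = ∑ α, (t ᵥ* T.a 1 1) α •
        (fun j => D3 F v y (Pi.single j 1) (T.b α)) := by
      ext j
      conv_lhs => rw [ht]
      simp
    rw [this, Matrix.mulVec_sum, dotProduct_sum]
    simp [Matrix.mulVec_smul]
  rw [hexp, hexp]
  exact Finset.sum_congr rfl fun α _ => by rw [hrow]

/-- This is `torsion_free` with the unity as one of the two exchanged vectors: in one position the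
structure constants collapse to the metric, in the other the unity is contracted with `g` and
becomes `E`. -/
theorem D3_euler (hU : IsUnitalSolution M η F (Pi.single o 1))
    (hB : IsBihamiltonianOn M (flatBracket η) B₂)
    (hF : IsPotential M η T.b B₂ F) (hE : ∀ v α, E v α = ∑ ε, B₂.g v α ε * η⁻¹ o ε) (hv : v ∈ M)
    (x y : ι → 𝕜) : D3 F v x y (E v) = x ⬝ᵥ (η⁻¹ * B₂.g v * η⁻¹) *ᵥ y := by
  have hM := hU.isOpen
  have h := T.torsion_free hM hU.metric_nondeg hF hv y (Pi.single o 1) x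
  have hηs' : (η⁻¹).IsSymm := by
    rw [Matrix.IsSymm, Matrix.transpose_nonsing_inv, hU.metric_symm.eq]
  have h1 : (fun j => D3 F v (Pi.single o 1) (Pi.single j 1) y) = η⁻¹ *ᵥ y := by
    ext j
    rw [hU.D3_unity hv, low_apply]
    simp
  have h2 : (Pi.single o 1 : ι → 𝕜) ᵥ* (η⁻¹ * B₂.g v) = E v := by
    ext α
    rw [hE]
    simp only [Matrix.single_one_vecMul, Matrix.row_apply, Matrix.mul_apply]
    refine Finset.sum_congr rfl fun ε _ => ?_
    rw [mul_comm, (hB.g_symm hv).apply]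
  rw [h1, Matrix.mulVec_mulVec, Matrix.dotProduct_mulVec, h2] at h
  rw [← h, D3_symm_right hM hF.1 hv, clm_eq_sum (D3 F v x) (E v)]
  simp [dotProduct]

theorem isIntersectionForm (hU : IsUnitalSolution M η F (Pi.single o 1))
    (hB : IsBihamiltonianOn M (flatBracket η) B₂)
    (hF : IsPotential M η T.b B₂ F) (hE : ∀ v α, E v α = ∑ ε, B₂.g v α ε * η⁻¹ o ε) :
    IsIntersectionForm M η F E B₂ := by
  intro v hv α β
  have hrow : ∀ α, η α = η *ᵥ Pi.single α 1 := fun α => by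
    ext β
    simpa using hU.metric_symm.apply β α
  have hdet : IsUnit η.det := isUnit_iff_ne_zero.2 hU.metric_nondeg
  rw [sum_cUp hU.isOpen hU.smooth hv, T.D3_euler hU hB hF hE hv, hrow β, Matrix.mulVec_mulVec,
    Matrix.mul_assoc, Matrix.nonsing_inv_mul _ hdet, Matrix.mul_one, hrow α,
    dotProduct_comm, Matrix.dotProduct_mulVec, ← Matrix.mulVec_transpose, hU.metric_symm.eq,
    Matrix.mulVec_mulVec, ← Matrix.mul_assoc, Matrix.mul_nonsing_inv _ hdet, Matrix.one_mul]
  simp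

/-- The third derivatives of `∂_E F`, and multiplication by the vector `w`. -/
theorem D3_fderiv_euler (hU : IsUnitalSolution M η F (Pi.single o 1))
    (hB : IsBihamiltonianOn M (flatBracket η) B₂)
    (hF : IsPotential M η T.b B₂ F) (hE : ∀ v α, E v α = ∑ ε, B₂.g v α ε * η⁻¹ o ε)
    {A : Matrix ι ι 𝕜} {r : ι → 𝕜} (hA : ∀ v ∈ M, E v = A *ᵥ v + r) :
    (∀ v ∈ M, ∀ x y z, D3 F v x ((A + (T.b)ᵀ) *ᵥ y) z = D3 F v y ((A + (T.b)ᵀ) *ᵥ x) z) ∧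
    ∀ v ∈ M, ∀ x y z, D3 (fun u => fderiv 𝕜 F u (E u)) v x y z
      = 2 * D3 F v x y ((A + (T.b)ᵀ) *ᵥ z) := by
  have hM := hU.isOpen
  have hs := hF.1
  set W := mulVecL (A + (T.b)ᵀ) with hW
  change (∀ v ∈ M, ∀ x y z, D3 F v x (W y) z = D3 F v y (W x) z) ∧
    ∀ v ∈ M, ∀ x y z, D3 (fun u => fderiv 𝕜 F u (E u)) v x y z = 2 * D3 F v x y (W z)
  obtain ⟨v₀, hv₀⟩ := hU.isConnected.nonempty
  let f : (ι → 𝕜) → 𝕜 := fun u => fderiv 𝕜 F u (mulVecL A u + r)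
  have hff : ∀ u ∈ M, fderiv 𝕜 F u (E u) = f u := fun u hu => by rw [hA u hu]; rfl
  have hf : ContDiffOn 𝕜 ∞ f M := smoothOn_fderiv_apply_affine hM hs _ _
  obtain ⟨g₀, hg₀⟩ := hF.2.2
  have hdet : IsUnit η.det := isUnit_iff_ne_zero.2 hU.metric_nondeg
  -- the Hessian of `∂_E F`
  have hcoord : ∀ v ∈ M, ∀ p q, D3 F v (E v) (η *ᵥ p) (η *ᵥ q)
      = D2 F v ((T.b)ᵀ *ᵥ (η *ᵥ p)) (η *ᵥ q) + D2 F v (η *ᵥ p) ((T.b)ᵀ *ᵥ (η *ᵥ q))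
        + p ⬝ᵥ (g₀ *ᵥ q) := by
    intro v hv
    have hrow : ∀ α, η *ᵥ Pi.single α 1 = η α := fun α => by
      ext β
      simpa using hU.metric_symm.apply α β
    have hrow' : ∀ α, (T.b)ᵀ *ᵥ (η *ᵥ Pi.single α 1) = (η * T.b) α := fun α => by
      rw [hrow, Matrix.mulVec_transpose]
      rfl
    refine vec_induction (fun α => vec_induction (fun β => ?_) ?_ ?_ ?_) ?_ ?_ ?_
    · have e1 := T.isIntersectionForm hU hB hF hE v hv α β
      rw [sum_cUp hM hs hv, hg₀ v hv, D3_symm_right hM hs hv, D3_symm_left hM hs hv] at e1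
      rw [hrow', hrow', hrow, hrow, ← e1, D3_eq_sum (D2 F v), D2_symm hM hs hv (η α),
        D3_eq_sum (D2 F v) ((η * T.b) β)]
      simp only [pd_pd_eq_D2 hM hs hv]
      congr 2
      · refine Finset.sum_congr rfl fun ε _ => Finset.sum_congr rfl fun l _ => by ring
      · refine Finset.sum_congr rfl fun ε _ => Finset.sum_congr rfl fun l _ => by ring
      · simp
    · simp
    · intro q q' h h'
      simp only [Matrix.mulVec_add, map_add, dotProduct_add]
      linear_combination h + h'
    · intro k q h
      simp only [Matrix.mulVec_smul, map_smul, dotProduct_smul, smul_eq_mul]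
      linear_combination k * h
    · simp
    · intro p p' h h' q
      simp only [Matrix.mulVec_add, map_add, _root_.add_apply, add_dotProduct]
      linear_combination h q + h' q
    · intro k p h q
      simp only [Matrix.mulVec_smul, map_smul, _root_.smul_apply, smul_dotProduct, smul_eq_mul]
      linear_combination k * h q
  have hhess : ∃ C : (ι → 𝕜) → (ι → 𝕜) → 𝕜, ∀ v ∈ M, ∀ x y,
      D2 f v x y = D2 F v (W x) y + D2 F v x (W y) + C x y := by
    -- The part of `W` from `A` comes from differentiating `E`; the part from `bᵀ` comes from `D3 F
    -- v (E v)`, which is `g` with lowered indices. The constant form is `g₀` with lowered indices.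
    refine ⟨fun x y => (η⁻¹ *ᵥ x) ⬝ᵥ (g₀ *ᵥ (η⁻¹ *ᵥ y)), fun v hv x y => ?_⟩
    have h1 := D2_apply_affine hM hs (mulVecL A) r hv x y
    have h2 := hcoord v hv (η⁻¹ *ᵥ x) (η⁻¹ *ᵥ y)
    simp only [Matrix.mulVec_mulVec, Matrix.mul_nonsing_inv _ hdet, Matrix.one_mulVec] at h2
    rw [hA v hv] at h2
    rw [mulVecL_apply] at h1
    change D2 f v x y = _ at h1
    rw [h1, h2]
    simp only [hW, mulVecL_apply, Matrix.add_mulVec, map_add, _root_.add_apply,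
      Matrix.mulVec_mulVec]
    ring
  obtain ⟨C, hC⟩ := hhess
  have hthird : ∀ v ∈ M, ∀ x y z, D3 f v x y z = D3 F v x (W y) z + D3 F v x y (W z) := by
    intro v hv x y z
    rw [← fderiv_D2_eq_D3 hM hf hv, fderiv_congr_of_isOpen hM (fun u hu => hC u hu y z) hv,
      fderiv_add_const]
    have hd : ∀ a b, DifferentiableAt 𝕜 (fun u => D2 F u a b) v := fun a b =>
      ((differentiableAt_of_smoothOn hM (smoothOn_D2 hM hs) hv).clm_apply
        (differentiableAt_const a)).clm_apply (differentiableAt_const b)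
    rw [fderiv_fun_add (hd _ _) (hd _ _), _root_.add_apply, fderiv_D2_eq_D3 hM hs hv,
      fderiv_D2_eq_D3 hM hs hv]
  -- Exchanging `x` and `y` changes neither the third derivative of `f` nor the second term of
  -- `hthird`, hence not the first term either.
  have hsymm : ∀ v ∈ M, ∀ x y z, D3 F v x (W y) z = D3 F v y (W x) z := by
    intro v hv x y z
    have h1 := hthird v hv x y z
    rw [D3_symm_left hM hf hv, hthird v hv y x z, D3_symm_left hM hs hv x y] at h1
    exact (add_right_cancel h1).symm
  refine ⟨hsymm, fun v hv x y z => ?_⟩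
  rw [D3_congr hM hff hv, hthird v hv]
  have : D3 F v x (W y) z = D3 F v x y (W z) := by
    rw [D3_symm_left hM hs hv, D3_symm_right hM hs hv, D3_symm_left hM hs hv, hsymm v hv,
      D3_symm_right hM hs hv, D3_symm_left hM hs hv]
  rw [this]
  ring

end TauStructure

end Translation

/-! ### Functions on a projection of a domain -/

section Projection

set_option maxSynthPendingDepth 6

variable {𝕜 : Type} [RCLike 𝕜] {X Y : Type*} [NormedAddCommGroup X] [NormedSpace 𝕜 X]
  [NormedAddCommGroup Y] [NormedSpace 𝕜 Y] {M : Set X} {pr : X →L[𝕜] Y} {inj : Y →L[𝕜] X}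
  {g : X → 𝕜} {φ : Y → 𝕜} {v : X}

/-- The affine map `y ↦ v + inj (y - pr v)` is a section of the projection with values in `M` near
`pr v`. Through it smoothness and derivatives descend from `g` to `φ`. -/
theorem eventually_eq_comp_section (hpi : ∀ y, pr (inj y) = y) (hM : IsOpen M)
    (h : ∀ u ∈ M, φ (pr u) = g u) (hv : v ∈ M) :
    φ =ᶠ[nhds (pr v)] fun y => g (v + inj (y - pr v)) := by
  have hc : ContinuousAt (fun y => v + inj (y - pr v)) (pr v) := by fun_prop
  have hm : ∀ᶠ y in nhds (pr v), v + inj (y - pr v) ∈ M := by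
    apply hc
    simpa using hM.mem_nhds hv
  filter_upwards [hm] with y hy
  rw [← h _ hy]
  simp [hpi]

theorem isOpen_image_projection (hpi : ∀ y, pr (inj y) = y) (hM : IsOpen M) : IsOpen (pr '' M) := by
  rw [isOpen_iff_mem_nhds]
  rintro _ ⟨v, hv, rfl⟩
  have hc : ContinuousAt (fun y => v + inj (y - pr v)) (pr v) := by fun_prop
  have hm : ∀ᶠ y in nhds (pr v), v + inj (y - pr v) ∈ M := by
    apply hc
    simpa using hM.mem_nhds hv
  filter_upwards [hm] with y hy
  exact ⟨_, hy, by simp [hpi]⟩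

theorem smoothOn_projection (hpi : ∀ y, pr (inj y) = y) (hM : IsOpen M) (hg : ContDiffOn 𝕜 ∞ g M)
    (h : ∀ u ∈ M, φ (pr u) = g u) : ContDiffOn 𝕜 ∞ φ (pr '' M) := by
  rintro _ ⟨v, hv, rfl⟩
  refine ContDiffAt.contDiffWithinAt ?_
  refine ContDiffAt.congr_of_eventuallyEq ?_ (eventually_eq_comp_section hpi hM h hv)
  have hg' : ContDiffAt 𝕜 ∞ g (v + inj (pr v - pr v)) := by
    simpa using hg.contDiffAt (hM.mem_nhds hv)
  exact hg'.comp (pr v) (f := fun y => v + inj (y - pr v)) (by fun_prop)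

theorem fderiv_projection (hpi : ∀ y, pr (inj y) = y) (hM : IsOpen M) (hg : ContDiffOn 𝕜 ∞ g M)
    (h : ∀ u ∈ M, φ (pr u) = g u) (hv : v ∈ M) (y : Y) :
    fderiv 𝕜 φ (pr v) y = fderiv 𝕜 g v (inj y) := by
  have hg' : HasFDerivAt g (fderiv 𝕜 g v) (v + inj (pr v - pr v)) := by
    simpa using (differentiableAt_of_smoothOn hM hg hv).hasFDerivAt
  have hi : HasFDerivAt (fun y => v + inj (y - pr v)) inj (pr v) := by
    have := (inj.hasFDerivAt.comp (pr v) ((hasFDerivAt_id (pr v)).sub_const (pr v))).const_add v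
    exact this
  rw [((hg'.comp (pr v) hi).congr_of_eventuallyEq
    (eventually_eq_comp_section hpi hM h hv)).fderiv]
  rfl

theorem D2_projection (hpi : ∀ y, pr (inj y) = y) (hM : IsOpen M) (hg : ContDiffOn 𝕜 ∞ g M)
    (h : ∀ u ∈ M, φ (pr u) = g u) (hv : v ∈ M) (x y : Y) :
    D2 φ (pr v) x y = D2 g v (inj x) (inj y) := by
  rw [← fderiv_fderiv_eq_D2 (isOpen_image_projection hpi hM) (smoothOn_projection hpi hM hg h)
    ⟨v, hv, rfl⟩, ← fderiv_fderiv_eq_D2 hM hg hv]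
  exact fderiv_projection hpi hM (smoothOn_fderiv_apply hM hg _)
    (fun u hu => fderiv_projection hpi hM hg h hu y) hv x

theorem D3_projection (hpi : ∀ y, pr (inj y) = y) (hM : IsOpen M) (hg : ContDiffOn 𝕜 ∞ g M)
    (h : ∀ u ∈ M, φ (pr u) = g u) (hv : v ∈ M) (x y z : Y) :
    D3 φ (pr v) x y z = D3 g v (inj x) (inj y) (inj z) := by
  rw [← fderiv_D2_eq_D3 (isOpen_image_projection hpi hM) (smoothOn_projection hpi hM hg h)
    ⟨v, hv, rfl⟩, ← fderiv_D2_eq_D3 hM hg hv]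
  exact fderiv_projection hpi hM
    (((smoothOn_D2 hM hg).clm_apply contDiffOn_const).clm_apply contDiffOn_const)
    (fun u hu => D2_projection hpi hM hg h hu y z) hv x

/-- A function on a convex domain whose derivative vanishes on the kernel of a projection is
constant on the fibres. -/
theorem eq_of_fderiv_eq_zero_on_fibres [NormedSpace ℝ X] [IsScalarTower ℝ 𝕜 X] (hM : IsOpen M)
    (hMc : Convex ℝ M) (hg : ContDiffOn 𝕜 ∞ g M)
    (h : ∀ u ∈ M, ∀ x, pr x = 0 → fderiv 𝕜 g u x = 0) {v v' : X} (hv : v ∈ M) (hv' : v' ∈ M)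
    (hvv : pr v = pr v') : g v' = g v := by
  -- Convexity is what makes the fibres of the projection in `M` connected: two points of a fibre
  -- are joined by a segment.
  have hmem : ∀ t ∈ Set.Icc (0 : ℝ) 1, v + t • (v' - v) ∈ M := fun t ht =>
    hMc.add_smul_sub_mem hv hv' ht
  have hd : ∀ t ∈ Set.Icc (0 : ℝ) 1, HasDerivAt (fun t : ℝ => g (v + t • (v' - v))) 0 t := by
    intro t ht
    have h1 := (differentiableAt_of_smoothOn hM hg (hmem t ht)).hasFDerivAt.restrictScalars ℝ
    have h2 : HasDerivAt (fun t : ℝ => v + t • (v' - v)) (v' - v) t := by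
      simpa using ((hasDerivAt_id t).smul_const (v' - v)).const_add v
    have h3 := h1.comp_hasDerivAt t h2
    have h4 : fderiv 𝕜 g (v + t • (v' - v)) (v' - v) = 0 :=
      h _ (hmem t ht) _ (by rw [map_sub, hvv, sub_self])
    rw [ContinuousLinearMap.coe_restrictScalars', h4] at h3
    exact h3
  have := constant_of_has_deriv_right_zero
    (fun t ht => (hd t ht).continuousAt.continuousWithinAt)
    (fun t ht => (hd t ⟨ht.1, ht.2.le⟩).hasDerivWithinAt) 1 (by simp)
  simpa using this

end Projection

/-! ### Block decompositions -/

section Blocks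

set_option maxSynthPendingDepth 6

open Matrix

variable {𝕜 : Type} [RCLike 𝕜] {ι : Type} [Fintype ι] [DecidableEq ι] {m : ℕ} {N : Fin m → ℕ}

/-- The basis vector with index `x` of the new coordinates. -/
def bvec (ψ : (ι → 𝕜) ≃ₗ[𝕜] ((Σ s : Fin m, Fin (N s)) → 𝕜)) (x : Σ s : Fin m, Fin (N s)) : ι → 𝕜 :=
  ψ.symm (Pi.single x 1)

/-- The projection onto a factor. -/
def prL (ψ : (ι → 𝕜) ≃ₗ[𝕜] ((Σ s : Fin m, Fin (N s)) → 𝕜)) (s : Fin m) :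
    (ι → 𝕜) →L[𝕜] (Fin (N s) → 𝕜) :=
  LinearMap.toContinuousLinearMap
    ((LinearMap.pi fun a => LinearMap.proj (⟨s, a⟩ : Σ s : Fin m, Fin (N s))) ∘ₗ ψ.toLinearMap)

/-- The inclusion of a factor. -/
def injL (ψ : (ι → 𝕜) ≃ₗ[𝕜] ((Σ s : Fin m, Fin (N s)) → 𝕜)) (s : Fin m) :
    (Fin (N s) → 𝕜) →L[𝕜] (ι → 𝕜) :=
  ∑ a, (ContinuousLinearMap.proj (R := 𝕜) (φ := fun _ => 𝕜) a).smulRight (bvec ψ ⟨s, a⟩)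

variable (ψ : (ι → 𝕜) ≃ₗ[𝕜] ((Σ s : Fin m, Fin (N s)) → 𝕜))

omit [DecidableEq ι] in
theorem prL_apply (s : Fin m) (v : ι → 𝕜) : prL ψ s v = comp ψ s v := rfl

omit [Fintype ι] [DecidableEq ι] in
theorem injL_apply (s : Fin m) (y : Fin (N s) → 𝕜) : injL ψ s y = ∑ a, y a • bvec ψ ⟨s, a⟩ := by
  simp [injL]

omit [Fintype ι] [DecidableEq ι] in
theorem apply_bvec (x y : Σ s : Fin m, Fin (N s)) : ψ (bvec ψ x) y = if y = x then 1 else 0 := by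
  simp [bvec, Pi.single_apply]

omit [DecidableEq ι] in
theorem prL_injL (s : Fin m) (y : Fin (N s) → 𝕜) : prL ψ s (injL ψ s y) = y := by
  ext a
  rw [prL_apply, comp, injL_apply]
  simp [apply_bvec]

omit [Fintype ι] [DecidableEq ι] in
theorem injL_single (s : Fin m) (a : Fin (N s)) : injL ψ s (Pi.single a 1) = bvec ψ ⟨s, a⟩ := by
  rw [injL_apply, Finset.sum_eq_single a] <;> simp +contextual

omit [Fintype ι] [DecidableEq ι] in
theorem sum_apply_bvec (v : ι → 𝕜) : ∑ x, ψ v x • bvec ψ x = v := by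
  apply ψ.injective
  ext y
  simp [apply_bvec]

omit [DecidableEq ι] in
theorem sum_injL_prL (v : ι → 𝕜) : ∑ s, injL ψ s (prL ψ s v) = v := by
  conv_rhs => rw [← sum_apply_bvec ψ v]
  rw [Fintype.sum_sigma]
  exact Finset.sum_congr rfl fun s _ => injL_apply ψ s _

omit [DecidableEq ι] in
theorem isOpen_factor {M : Set (ι → 𝕜)} (hM : IsOpen M) (s : Fin m) : IsOpen (factor ψ M s) :=
  isOpen_image_projection (pr := prL ψ s) (inj := injL ψ s) (prL_injL ψ s) hM

omit [DecidableEq ι] in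
theorem convex_factor {M : Set (ι → 𝕜)} (hM : Convex ℝ M) (s : Fin m) : Convex ℝ (factor ψ M s) :=
  hM.linear_image ((prL ψ s).toLinearMap.restrictScalars ℝ)

/-- A change of coordinates adapted to a solution `F` of the associativity equations and an affine
vector field `E = A v + r`: products of vectors from different blocks vanish, the metric is diagonal,
the blocks are invariant under `A`, `∂_E F` is `2 F^w` up to quadratic polynomials with `w` acting as
a scalar on every block, and all quadratic directions are multiples of the unity on every block. -/
structure IsBlockSystem (M : Set (ι → 𝕜)) (η : Matrix ι ι 𝕜) (F : (ι → 𝕜) → 𝕜) (e : ι → 𝕜)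
    (A : Matrix ι ι 𝕜) (r : ι → 𝕜) (w : ι → 𝕜) (c : 𝕜)
    (ψ : (ι → 𝕜) ≃ₗ[𝕜] ((Σ s : Fin m, Fin (N s)) → 𝕜)) (d : (Σ s : Fin m, Fin (N s)) → 𝕜)
    (κ : Fin m → 𝕜) : Prop where
  convex : Convex ℝ M
  unital : IsUnitalSolution M η F e
  dim_pos : ∀ s, 0 < N s
  D3_eq_zero : ∀ v ∈ M, ∀ x y, x.1 ≠ y.1 → ∀ z, D3 F v (bvec ψ x) (bvec ψ y) z = 0
  low_bvec : ∀ x y, low η (bvec ψ x) (bvec ψ y) = if x = y then d x else 0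
  d_ne_zero : ∀ x, d x ≠ 0
  A_block : ∀ x y, x.1 ≠ y.1 → ψ (A *ᵥ bvec ψ x) y = 0
  A_unity : ∀ s, comp ψ s (A *ᵥ e) = κ s • comp ψ s e
  w_eq : ∀ s, comp ψ s w = c • comp ψ s e + κ s • comp ψ s e
  third : ∀ v ∈ M, ∀ x y z, D3 (fun u => fderiv 𝕜 F u (A *ᵥ u + r)) v x y (bvec ψ z)
    = 2 * ((c + κ z.1) * D3 F v x y (bvec ψ z))
  direction : ∀ u, (∀ v ∈ M, ∀ v' ∈ M, D3 F v u = D3 F v' u) → ∀ s, ∃ k : 𝕜,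
    comp ψ s u = k • comp ψ s e

namespace IsBlockSystem

variable {ψ} {M : Set (ι → 𝕜)} {η : Matrix ι ι 𝕜} {F : (ι → 𝕜) → 𝕜} {e : ι → 𝕜}
    {A : Matrix ι ι 𝕜} {r : ι → 𝕜} {w : ι → 𝕜} {c : 𝕜} {d : (Σ s : Fin m, Fin (N s)) → 𝕜}
    {κ : Fin m → 𝕜} {v : ι → 𝕜}

theorem D3_injL_eq_zero (H : IsBlockSystem M η F e A r w c ψ d κ) (hv : v ∈ M) {s t : Fin m}
    (hst : s ≠ t) (x : Fin (N s) → 𝕜) (y : Fin (N t) → 𝕜) (z : ι → 𝕜) :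
    D3 F v (injL ψ s x) (injL ψ t y) z = 0 := by
  rw [injL_apply, injL_apply]
  simp [H.D3_eq_zero v hv ⟨s, _⟩ ⟨t, _⟩ hst]

/-- The block of the third derivative picked by one of the arguments. -/
theorem D3_injL_left (H : IsBlockSystem M η F e A r w c ψ d κ) (hv : v ∈ M) (s : Fin m)
    (x : Fin (N s) → 𝕜) (y z : ι → 𝕜) :
    D3 F v (injL ψ s x) y z = D3 F v (injL ψ s x) (injL ψ s (prL ψ s y)) z := by
  conv_lhs => rw [← sum_injL_prL ψ y]
  rw [map_sum, _root_.sum_apply, Finset.sum_eq_single s]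
  · intro t _ hts
    exact H.D3_injL_eq_zero hv hts.symm _ _ _
  · simp

/-- Along the block `s`, `dF` depends on the other blocks only through linear terms, because the
mixed second derivatives are constant. Subtracting the Hessian `C` at a base point cancels these
terms, so that the block component of `dF` becomes closed. -/
theorem exists_primitive (H : IsBlockSystem M η F e A r w c ψ d κ) (s : Fin m) :
    ∃ (C : (ι → 𝕜) →L[𝕜] (ι → 𝕜) →L[𝕜] 𝕜) (K : (ι → 𝕜) → 𝕜), ContDiffOn 𝕜 ∞ K M ∧
      ∀ v ∈ M, ∀ x, fderiv 𝕜 K v x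
        = fderiv 𝕜 F v (injL ψ s (prL ψ s x)) - C v (injL ψ s (prL ψ s x)) := by
  have hM := H.unital.isOpen
  have hF := H.unital.smooth
  obtain ⟨v₀, hv₀⟩ := H.unital.isConnected.nonempty
  set C := D2 F v₀
  set P : (ι → 𝕜) →L[𝕜] (ι → 𝕜) := (injL ψ s).comp (prL ψ s)
  -- the mixed second derivatives are constant
  have hmixed : ∀ v ∈ M, ∀ t, s ≠ t → ∀ x y,
      D2 F v (injL ψ t y) (injL ψ s x) = C (injL ψ t y) (injL ψ s x) := by
    intro v hv t hst x y
    refine hM.is_const_of_fderiv_eq_zero (𝕜 := 𝕜)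
      (f := fun v => D2 F v (injL ψ t y) (injL ψ s x)) H.convex.isPreconnected
      ((((smoothOn_D2 hM hF).clm_apply contDiffOn_const).clm_apply
        contDiffOn_const).differentiableOn (by simp)) (fun u hu => ?_) hv hv₀
    ext z
    rw [fderiv_D2_eq_D3 hM hF hu, D3_symm_left hM hF hu, D3_symm_right hM hF hu,
      H.D3_injL_eq_zero hu hst.symm]
    rfl
  have hblock : ∀ v ∈ M, ∀ x y, D2 F v y (P x) - C y (P x)
      = D2 F v (P y) (P x) - C (P y) (P x) := by
    intro v hv x y
    have : ∀ T : (ι → 𝕜) →L[𝕜] (ι → 𝕜) →L[𝕜] 𝕜, T y (P x)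
        = T (P y) (P x) + ∑ t ∈ Finset.univ.erase s, T (injL ψ t (prL ψ t y)) (P x) := by
      intro T
      conv_lhs => rw [← sum_injL_prL ψ y]
      rw [map_sum, _root_.sum_apply, ← Finset.add_sum_erase _ _ (Finset.mem_univ s)]
      rfl
    have hsum : ∑ t ∈ Finset.univ.erase s, D2 F v (injL ψ t (prL ψ t y)) (P x)
        = ∑ t ∈ Finset.univ.erase s, C (injL ψ t (prL ψ t y)) (P x) :=
      Finset.sum_congr rfl fun t ht =>
        hmixed v hv t (Finset.ne_of_mem_erase ht).symm (prL ψ s x) (prL ψ t y)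
    rw [this (D2 F v), this C, hsum]
    ring
  let θ : (ι → 𝕜) → (ι → 𝕜) →L[𝕜] 𝕜 := fun v => (fderiv 𝕜 F v - C v).comp P
  have hθ : ContDiffOn 𝕜 ∞ θ M :=
    ((smoothOn_fderiv hM hF).sub C.contDiff.contDiffOn).clm_comp contDiffOn_const
  have hdθ : ∀ v ∈ M, ∀ x y, fderiv 𝕜 θ v x y = D2 F v x (P y) - C x (P y) := by
    intro v hv x y
    rw [← fderiv_fderiv_apply (differentiableAt_of_smoothOn hM hθ hv)]
    have h1 := (differentiableAt_of_smoothOn hM (smoothOn_fderiv_apply hM hF (P y)) hv)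
    have h2 : DifferentiableAt 𝕜 (fun u => C u (P y)) v := by fun_prop
    have h3 : (fun u => θ u y) = fun u => fderiv 𝕜 F u (P y) - C u (P y) := rfl
    rw [h3, fderiv_fun_sub h1 h2, _root_.sub_apply, fderiv_fderiv_eq_D2 hM hF hv,
      fderiv_fderiv_apply C.differentiableAt, C.fderiv]
  obtain ⟨K, hK, hdK⟩ := exists_primitive_of_closed hM H.convex hθ (fun v hv x y => by
    rw [hdθ v hv, hdθ v hv, hblock v hv y x, hblock v hv x y, D2_symm hM hF hv (P x),
      D2_symm hM hF hv₀ (P x)])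
  exact ⟨C, K, hK, fun v hv x => by rw [(hdK v hv).fderiv]; rfl⟩

end IsBlockSystem

end Blocks

/-! ### The solution induced on each factor. -/

section Factors

set_option maxSynthPendingDepth 6

open Matrix

variable {𝕜 : Type} [RCLike 𝕜] {ι : Type} [Fintype ι] [DecidableEq ι] {m : ℕ} {N : Fin m → ℕ}
  {ψ : (ι → 𝕜) ≃ₗ[𝕜] ((Σ s : Fin m, Fin (N s)) → 𝕜)}
  {M : Set (ι → 𝕜)} {η : Matrix ι ι 𝕜} {F : (ι → 𝕜) → 𝕜} {e : ι → 𝕜}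
  {A : Matrix ι ι 𝕜} {r : ι → 𝕜} {w : ι → 𝕜} {c : 𝕜} {d : (Σ s : Fin m, Fin (N s)) → 𝕜}
  {κ : Fin m → 𝕜} {v : ι → 𝕜}

theorem low_row (hη : η.det ≠ 0) (α : ι) (z : ι → 𝕜) : low η (η α) z = z α := by
  have h : η α ᵥ* η⁻¹ = Pi.single α 1 := by
    change (η * η⁻¹) α = _
    rw [Matrix.mul_nonsing_inv _ (isUnit_iff_ne_zero.2 hη)]
    ext β
    simp [Matrix.one_apply, Pi.single_apply, eq_comm]
  rw [low_apply, Matrix.dotProduct_mulVec, h]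
  simp

/-- `K` is a primitive of the component of `dF` along the block `s`, up to a linear form, and `Φ` is
the function on the factor induced by `K`. -/
structure IsFactorPotential (M : Set (ι → 𝕜)) (F : (ι → 𝕜) → 𝕜)
    (ψ : (ι → 𝕜) ≃ₗ[𝕜] ((Σ s : Fin m, Fin (N s)) → 𝕜)) (s : Fin m)
    (C : (ι → 𝕜) →L[𝕜] (ι → 𝕜) →L[𝕜] 𝕜) (K : (ι → 𝕜) → 𝕜) (Φ : (Fin (N s) → 𝕜) → 𝕜) : Prop where
  smooth : ContDiffOn 𝕜 ∞ K M
  fderiv_eq : ∀ v ∈ M, ∀ x, fderiv 𝕜 K v x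
    = fderiv 𝕜 F v (injL ψ s (prL ψ s x)) - C v (injL ψ s (prL ψ s x))
  factor_eq : ∀ v ∈ M, Φ (prL ψ s v) = K v

/-- The block of the matrix `A` on a factor. -/
def blockMatrix (ψ : (ι → 𝕜) ≃ₗ[𝕜] ((Σ s : Fin m, Fin (N s)) → 𝕜)) (A : Matrix ι ι 𝕜) (s : Fin m) :
    Matrix (Fin (N s)) (Fin (N s)) 𝕜 :=
  fun a b => ψ (A *ᵥ bvec ψ ⟨s, b⟩) ⟨s, a⟩

/-- The metric of a factor. -/
def blockMetric (d : (Σ s : Fin m, Fin (N s)) → 𝕜) (s : Fin m) :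
    Matrix (Fin (N s)) (Fin (N s)) 𝕜 :=
  Matrix.diagonal fun a => (d ⟨s, a⟩)⁻¹

namespace IsBlockSystem

theorem exists_isFactorPotential (H : IsBlockSystem M η F e A r w c ψ d κ) (s : Fin m) :
    ∃ C K Φ, IsFactorPotential M F ψ s C K Φ := by
  classical
  obtain ⟨C, K, hK, hdK⟩ := H.exists_primitive s
  -- `K` is evaluated at an arbitrary preimage in `M`, and the value off the factor is 0; the choice
  -- is immaterial because `K` is constant on fibres.
  refine ⟨C, K, fun y => if h : ∃ v ∈ M, prL ψ s v = y then K h.choose else 0, hK, hdK,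
    fun v hv => ?_⟩
  have h : ∃ v' ∈ M, prL ψ s v' = prL ψ s v := ⟨v, hv, rfl⟩
  rw [dif_pos h]
  refine (eq_of_fderiv_eq_zero_on_fibres H.unital.isOpen H.convex hK (pr := prL ψ s)
    (fun u hu x hx => ?_) h.choose_spec.1 hv h.choose_spec.2).symm
  rw [hdK u hu, hx]
  simp

theorem low_bvec_right (H : IsBlockSystem M η F e A r w c ψ d κ) (z : ι → 𝕜)
    (x : Σ s : Fin m, Fin (N s)) : low η z (bvec ψ x) = ψ z x * d x := by
  conv_lhs => rw [← sum_apply_bvec ψ z]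
  simp [H.low_bvec]

/-- Raising the index of a linear form. -/
theorem sum_smul_row (H : IsBlockSystem M η F e A r w c ψ d κ) (L : (ι → 𝕜) →ₗ[𝕜] 𝕜) :
    ∑ α, L (Pi.single α 1) • η α = ∑ x, ((d x)⁻¹ * L (bvec ψ x)) • bvec ψ x := by
  have hη := H.unital.metric_nondeg
  have hηs := H.unital.metric_symm
  have h1 : ∀ z, low η (∑ α, L (Pi.single α 1) • η α) z = L z := by
    intro z
    have hz : L z = ∑ α, z α * L (Pi.single α 1) :=
      clm_eq_sum (LinearMap.toContinuousLinearMap L) z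
    rw [map_sum, LinearMap.sum_apply, hz]
    exact Finset.sum_congr rfl fun α _ => by
      rw [map_smul, LinearMap.smul_apply, low_row hη, smul_eq_mul, mul_comm]
  refine eq_of_low_eq hη fun z => ?_
  rw [low_symm hηs, h1, map_sum]
  conv_lhs => rw [← sum_apply_bvec ψ z]
  rw [map_sum]
  refine Finset.sum_congr rfl fun x _ => ?_
  rw [map_smul, map_smul, H.low_bvec_right, smul_eq_mul, smul_eq_mul]
  field_simp [H.d_ne_zero x]

theorem sum_smul_row_coord (H : IsBlockSystem M η F e A r w c ψ d κ)
    (x : Σ s : Fin m, Fin (N s)) :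
    ∑ α, ψ (Pi.single α 1) x • η α = (d x)⁻¹ • bvec ψ x := by
  have h := H.sum_smul_row (LinearMap.proj x ∘ₗ ψ.toLinearMap)
  simp only [LinearMap.comp_apply, LinearMap.proj_apply, LinearEquiv.coe_coe] at h
  rw [h, Finset.sum_eq_single x]
  · simp [apply_bvec]
  · intro y _ hy
    simp [apply_bvec, hy.symm]
  · simp

theorem gNew_flat (H : IsBlockSystem M η F e A r w c ψ d κ) (x y : Σ s : Fin m, Fin (N s)) :
    gNew ψ (flatBracket η) v x y = if x = y then (d x)⁻¹ else 0 := by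
  have h : ∀ β, ∑ α, ψ (Pi.single α 1) x * η α β = (d x)⁻¹ * bvec ψ x β := fun β => by
    have := congrFun (H.sum_smul_row_coord x) β
    simpa using this
  have h2 : ψ (bvec ψ x) y = ∑ β, bvec ψ x β * ψ (Pi.single β 1) y :=
    clm_eq_sum (LinearMap.toContinuousLinearMap (LinearMap.proj (R := 𝕜)
      (φ := fun _ : (Σ s : Fin m, Fin (N s)) => 𝕜) y ∘ₗ ψ.toLinearMap)) (bvec ψ x)
  simp only [gNew, flatBracket]
  rw [Finset.sum_comm]
  have h3 : ∀ β, ∑ α, ψ (Pi.single α 1) x * ψ (Pi.single β 1) y * η α β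
      = (d x)⁻¹ * (bvec ψ x β * ψ (Pi.single β 1) y) := fun β => by
    rw [← mul_assoc, ← h, Finset.sum_mul]
    exact Finset.sum_congr rfl fun α _ => by ring
  simp only [h3, ← Finset.mul_sum, ← h2, apply_bvec]
  simp [eq_comm]

theorem metric_isDirectSum (H : IsBlockSystem M η F e A r w c ψ d κ) :
    IsDirectSum ψ M (flatBracket η) (fun s => flatBracket (blockMetric d s)) := by
  refine fun v _ => ⟨fun s a b => ?_, fun x y hxy => ?_, fun s a b c => ?_, fun x y z _ => ?_⟩
  · rw [H.gNew_flat]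
    simp [flatBracket, blockMetric, Matrix.diagonal_apply]
  · rw [H.gNew_flat, if_neg (fun h : x = y => hxy (by rw [h]))]
  · simp [ΓNew, flatBracket]
  · simp [ΓNew, flatBracket]

theorem blockMetric_inv (H : IsBlockSystem M η F e A r w c ψ d κ) (s : Fin m) :
    (blockMetric d s)⁻¹ = Matrix.diagonal fun a => d ⟨s, a⟩ := by
  refine Matrix.inv_eq_right_inv ?_
  rw [blockMetric, Matrix.diagonal_mul_diagonal]
  ext a b
  simp [Matrix.diagonal_apply, Matrix.one_apply, H.d_ne_zero]

theorem blockMetric_det (H : IsBlockSystem M η F e A r w c ψ d κ) (s : Fin m) :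
    (blockMetric d s).det ≠ 0 := by
  rw [blockMetric, Matrix.det_diagonal]
  exact Finset.prod_ne_zero_iff.2 fun a _ => inv_ne_zero (H.d_ne_zero _)

theorem low_blockMetric (H : IsBlockSystem M η F e A r w c ψ d κ) (s : Fin m)
    (x y : Fin (N s) → 𝕜) : low (blockMetric d s) x y = low η (injL ψ s x) (injL ψ s y) := by
  rw [low_apply, H.blockMetric_inv, injL_apply ψ s y, map_sum]
  simp only [map_smul, H.low_bvec_right, smul_eq_mul, dotProduct, Matrix.mulVec_diagonal]
  refine Finset.sum_congr rfl fun a _ => ?_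
  have : ψ (injL ψ s x) ⟨s, a⟩ = x a := congrFun (prL_injL ψ s x) a
  rw [this]
  ring

theorem prL_mulVec (H : IsBlockSystem M η F e A r w c ψ d κ) (s : Fin m) (x : ι → 𝕜) :
    prL ψ s (A *ᵥ x) = blockMatrix ψ A s *ᵥ prL ψ s x := by
  ext a
  have h1 : A *ᵥ x = ∑ y, ψ x y • (A *ᵥ bvec ψ y) := by
    conv_lhs => rw [← sum_apply_bvec ψ x]
    rw [Matrix.mulVec_sum]
    simp only [Matrix.mulVec_smul]
  rw [prL_apply, comp, h1, map_sum, Finset.sum_apply, Fintype.sum_sigma, Finset.sum_eq_single s]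
  · simp only [Matrix.mulVec, dotProduct, blockMatrix]
    refine Finset.sum_congr rfl fun b _ => ?_
    rw [map_smul, Pi.smul_apply, smul_eq_mul, mul_comm]
    rfl
  · intro t _ hts
    refine Finset.sum_eq_zero fun b _ => ?_
    rw [map_smul, Pi.smul_apply, H.A_block _ _ hts, smul_zero]
  · simp

theorem mulVec_injL (H : IsBlockSystem M η F e A r w c ψ d κ) (s : Fin m) (y : Fin (N s) → 𝕜) :
    injL ψ s (prL ψ s (A *ᵥ injL ψ s y)) = A *ᵥ injL ψ s y := by
  conv_rhs => rw [← sum_injL_prL ψ (A *ᵥ injL ψ s y)]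
  rw [Finset.sum_eq_single s]
  · intro t _ hts
    have : prL ψ t (A *ᵥ injL ψ s y) = 0 := by
      ext a
      rw [injL_apply, Matrix.mulVec_sum, prL_apply, comp, map_sum, Finset.sum_apply]
      refine Finset.sum_eq_zero fun b _ => ?_
      rw [Matrix.mulVec_smul, map_smul, Pi.smul_apply, H.A_block ⟨s, b⟩ ⟨t, a⟩ hts.symm, smul_zero]
    rw [this, map_zero]
  · simp

theorem third_injL (H : IsBlockSystem M η F e A r w c ψ d κ) (hv : v ∈ M) (s : Fin m)
    (x y : ι → 𝕜) (z : Fin (N s) → 𝕜) :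
    D3 (fun u => fderiv 𝕜 F u (A *ᵥ u + r)) v x y (injL ψ s z)
      = 2 * (c + κ s) * D3 F v x y (injL ψ s z) := by
  rw [injL_apply]
  simp only [map_sum, map_smul, H.third v hv, smul_eq_mul, Finset.mul_sum]
  exact Finset.sum_congr rfl fun a _ => by ring

section FactorPotential

variable {s : Fin m} {C : (ι → 𝕜) →L[𝕜] (ι → 𝕜) →L[𝕜] 𝕜} {K : (ι → 𝕜) → 𝕜}
  {Φ : (Fin (N s) → 𝕜) → 𝕜}

theorem D2_K (H : IsBlockSystem M η F e A r w c ψ d κ) (hΦ : IsFactorPotential M F ψ s C K Φ)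
    (hv : v ∈ M) (x y : ι → 𝕜) :
    D2 K v x y = D2 F v x (injL ψ s (prL ψ s y)) - C x (injL ψ s (prL ψ s y)) := by
  have hM := H.unital.isOpen
  have hF := H.unital.smooth
  set z := injL ψ s (prL ψ s y)
  rw [← fderiv_fderiv_eq_D2 hM hΦ.smooth hv,
    fderiv_congr_of_isOpen hM (fun u hu => hΦ.fderiv_eq u hu y) hv]
  have h1 := (differentiableAt_of_smoothOn hM (smoothOn_fderiv_apply hM hF z) hv)
  have h2 : DifferentiableAt 𝕜 (fun u => C u z) v := by fun_prop
  rw [fderiv_fun_sub h1 h2, _root_.sub_apply, fderiv_fderiv_eq_D2 hM hF hv,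
      fderiv_fderiv_apply C.differentiableAt, C.fderiv]

theorem D3_K (H : IsBlockSystem M η F e A r w c ψ d κ) (hΦ : IsFactorPotential M F ψ s C K Φ)
    (hv : v ∈ M) (x y z : ι → 𝕜) : D3 K v x y z = D3 F v x y (injL ψ s (prL ψ s z)) := by
  have hM := H.unital.isOpen
  rw [← fderiv_D2_eq_D3 hM hΦ.smooth hv,
    fderiv_congr_of_isOpen hM (fun u hu => H.D2_K hΦ hu y z) hv, fderiv_sub_const,
    fderiv_D2_eq_D3 hM H.unital.smooth hv]

theorem smoothOn_factor (H : IsBlockSystem M η F e A r w c ψ d κ)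
    (hΦ : IsFactorPotential M F ψ s C K Φ) : ContDiffOn 𝕜 ∞ Φ (factor ψ M s) :=
  smoothOn_projection (prL_injL ψ s) H.unital.isOpen hΦ.smooth hΦ.factor_eq

theorem D3_factor (H : IsBlockSystem M η F e A r w c ψ d κ) (hΦ : IsFactorPotential M F ψ s C K Φ)
    (hv : v ∈ M) (x y z : Fin (N s) → 𝕜) :
    D3 Φ (prL ψ s v) x y z = D3 F v (injL ψ s x) (injL ψ s y) (injL ψ s z) := by
  rw [D3_projection (prL_injL ψ s) H.unital.isOpen hΦ.smooth hΦ.factor_eq hv, H.D3_K hΦ hv,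
    prL_injL]

/-- A block is an ideal orthogonal to the others, so pairing with `z` sees only the `s`-component of
`z`. The inclusion of the factor is thus multiplicative, and associativity is inherited. -/
theorem injL_prodAt (H : IsBlockSystem M η F e A r w c ψ d κ)
    (hΦ : IsFactorPotential M F ψ s C K Φ) (hv : v ∈ M) (x y : Fin (N s) → 𝕜) :
    injL ψ s (prodAt (blockMetric d s) Φ (prL ψ s v) x y)
      = prodAt η F v (injL ψ s x) (injL ψ s y) := by
  refine eq_of_low_eq H.unital.metric_nondeg fun z => ?_
  have hM := H.unital.isOpen
  have hF := H.unital.smooth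
  have hz : low η z (injL ψ s (prodAt (blockMetric d s) Φ (prL ψ s v) x y))
      = low η (injL ψ s (prL ψ s z)) (injL ψ s (prodAt (blockMetric d s) Φ (prL ψ s v) x y)) := by
    rw [injL_apply ψ s (prodAt _ _ _ _ _), map_sum, map_sum]
    refine Finset.sum_congr rfl fun a _ => ?_
    rw [map_smul, map_smul, H.low_bvec_right, H.low_bvec_right]
    congr 2
    exact (congrFun (prL_injL ψ s (prL ψ s z)) a).symm
  rw [hz, ← H.low_blockMetric, low_prodAt (H.blockMetric_det s), low_prodAt H.unital.metric_nondeg,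
    H.D3_factor hΦ hv, D3_symm_left hM hF hv, ← H.D3_injL_left hv, D3_symm_left hM hF hv]

theorem isUnitalSolution_factor (H : IsBlockSystem M η F e A r w c ψ d κ)
    (hΦ : IsFactorPotential M F ψ s C K Φ) :
    IsUnitalSolution (factor ψ M s) (blockMetric d s) Φ (comp ψ s e) where
  isOpen := isOpen_factor ψ H.unital.isOpen s
  isConnected := (convex_factor ψ H.convex s).isConnected (H.unital.isConnected.nonempty.image _)
  metric_symm := Matrix.isSymm_diagonal _
  metric_nondeg := H.blockMetric_det s
  smooth := H.smoothOn_factor hΦ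
  wdvv := by
    refine (isWDVVOn_iff (isOpen_factor ψ H.unital.isOpen s) (H.smoothOn_factor hΦ)).2 ?_
    rintro _ ⟨v, hv, rfl⟩ x y z u
    rw [← prL_apply, H.D3_factor hΦ hv, H.D3_factor hΦ hv, H.injL_prodAt hΦ hv,
      H.injL_prodAt hΦ hv]
    exact (isWDVVOn_iff H.unital.isOpen H.unital.smooth).1 H.unital.wdvv v hv _ _ _ _
  unity := by
    rintro _ ⟨v, hv, rfl⟩
    refine (unity_iff (isOpen_factor ψ H.unital.isOpen s) (H.smoothOn_factor hΦ)
      ⟨v, hv, rfl⟩).2 fun x y => ?_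
    rw [← prL_apply, ← prL_apply, H.D3_factor hΦ hv, H.low_blockMetric, ← H.unital.D3_unity hv,
      D3_symm_left H.unital.isOpen H.unital.smooth hv, ← H.D3_injL_left hv,
      D3_symm_left H.unital.isOpen H.unital.smooth hv]

/-- An invariant form `S` is the contraction of the structure constants with one vector `u`,
obtained by raising the covector `S es`. As `S` is constant, the image of `u` in the whole space is
a constant direction, hence `u` is a multiple of `es` and `S` of the metric. -/
theorem isRigidOn_factor (H : IsBlockSystem M η F e A r w c ψ d κ)
    (hΦ : IsFactorPotential M F ψ s C K Φ) :
    IsRigidOn (factor ψ M s) (blockMetric d s) Φ := by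
  intro S hS hinv
  have U := H.isUnitalSolution_factor hΦ
  have hM := H.unital.isOpen
  have hF := H.unital.smooth
  have hdet : IsUnit (blockMetric d s).det := isUnit_iff_ne_zero.2 U.metric_nondeg
  set es := comp ψ s e
  set u : Fin (N s) → 𝕜 := blockMetric d s *ᵥ (S *ᵥ es) with hu
  have hlow : ∀ t, low (blockMetric d s) t u = t ⬝ᵥ (S *ᵥ es) := fun t => by
    rw [low_apply, hu, Matrix.mulVec_mulVec, Matrix.nonsing_inv_mul _ hdet, Matrix.one_mulVec]
  have hform : ∀ v ∈ M, ∀ y z, D3 Φ (prL ψ s v) u y z = y ⬝ᵥ (S *ᵥ z) := by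
    intro v hv y z
    have hp : prL ψ s v ∈ factor ψ M s := ⟨v, hv, rfl⟩
    rw [D3_symm_left U.isOpen U.smooth hp, D3_symm_right U.isOpen U.smooth hp,
      ← low_prodAt U.metric_nondeg, low_symm U.metric_symm]
    have h1 : low (blockMetric d s) (prodAt (blockMetric d s) Φ (prL ψ s v) z u) y
        = low (blockMetric d s) (prodAt (blockMetric d s) Φ (prL ψ s v) y z) u := by
      rw [low_symm U.metric_symm, low_prodAt U.metric_nondeg, low_symm U.metric_symm,
        low_prodAt U.metric_nondeg, D3_symm_right U.isOpen U.smooth hp,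
        D3_symm_left U.isOpen U.smooth hp]
    have h2 := hinv (prL ψ s v) hp y z es
    rw [mulAt_eq_prodAt U.isOpen U.smooth hp, mulAt_eq_prodAt U.isOpen U.smooth hp,
      U.prod_unity hp] at h2
    rw [h1, hlow, h2]
  have hconst : ∀ v ∈ M, ∀ v' ∈ M, D3 F v (injL ψ s u) = D3 F v' (injL ψ s u) := by
    have key : ∀ v ∈ M, ∀ x y, D3 F v (injL ψ s u) x y = prL ψ s x ⬝ᵥ (S *ᵥ prL ψ s y) := by
      intro v hv x y
      rw [H.D3_injL_left hv, D3_symm_right hM hF hv, H.D3_injL_left hv,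
        D3_symm_right hM hF hv, ← H.D3_factor hΦ hv, hform v hv]
    intro v hv v' hv'
    ext x y
    rw [key v hv, key v' hv']
  obtain ⟨k, hk⟩ := H.direction _ hconst s
  rw [← prL_apply, prL_injL] at hk
  obtain ⟨v, hv⟩ := H.unital.isConnected.nonempty
  have hp : prL ψ s v ∈ factor ψ M s := ⟨v, hv, rfl⟩
  refine ⟨k, ?_⟩
  ext a b
  have h := hform v hv (Pi.single a 1) (Pi.single b 1)
  rw [hk, map_smul, _root_.smul_apply, _root_.smul_apply, U.D3_unity hp, low_single] at h
  simpa using h.symm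

/-- Since `A` preserves the blocks, the derivative of `Φ` along the induced field pulls back to `∂_E
K`, whose Hessian on the block differs from that of `∂_E F` by constants. Third derivatives thus
agree there, and on block `s` they are `2(c + κ s)` times those of `F`. -/
theorem quasihomogeneous_factor (H : IsBlockSystem M η F e A r w c ψ d κ)
    (hΦ : IsFactorPotential M F ψ s C K Φ) :
    IsQuadraticOn (factor ψ M s) (fun y =>
      fderiv 𝕜 Φ y (blockMatrix ψ A s *ᵥ y + prL ψ s r) - 2 * (c + κ s) * Φ y) := by
  have hM := H.unital.isOpen
  have hF := H.unital.smooth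
  have hMs := isOpen_factor ψ hM s
  have hs := H.smoothOn_factor hΦ
  have hPP : ∀ v ∈ M, ∀ x, fderiv 𝕜 K v (injL ψ s (prL ψ s x)) = fderiv 𝕜 K v x := by
    intro v hv x
    rw [hΦ.fderiv_eq v hv, hΦ.fderiv_eq v hv, prL_injL]
  let g : (ι → 𝕜) → 𝕜 := fun u => fderiv 𝕜 K u (mulVecL A u + r)
  let f : (ι → 𝕜) → 𝕜 := fun u => fderiv 𝕜 F u (mulVecL A u + r)
  have hg : ContDiffOn 𝕜 ∞ g M := smoothOn_fderiv_apply_affine hM hΦ.smooth _ _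
  have hf : ContDiffOn 𝕜 ∞ f M := smoothOn_fderiv_apply_affine hM hF _ _
  let φ : (Fin (N s) → 𝕜) → 𝕜 := fun y =>
    fderiv 𝕜 Φ y (mulVecL (blockMatrix ψ A s) y + prL ψ s r)
  have hφs : ContDiffOn 𝕜 ∞ φ (factor ψ M s) := smoothOn_fderiv_apply_affine hMs hs _ _
  have hφ : ∀ v ∈ M, φ (prL ψ s v) = g v := by
    intro v hv
    simp only [φ, g]
    rw [fderiv_projection (prL_injL ψ s) hM hΦ.smooth hΦ.factor_eq hv, mulVecL_apply,
      ← H.prL_mulVec, ← map_add, hPP v hv]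
    rfl
  have hD2 : ∀ v ∈ M, ∀ y z, D2 g v (injL ψ s y) (injL ψ s z) = D2 f v (injL ψ s y) (injL ψ s z)
      - (C (A *ᵥ injL ψ s y) (injL ψ s z) + C (injL ψ s y) (A *ᵥ injL ψ s z)) := by
    intro v hv y z
    simp only [g, f]
    rw [D2_apply_affine hM hΦ.smooth _ _ hv, D2_apply_affine hM hF _ _ hv, H.D3_K hΦ hv,
      H.D2_K hΦ hv, H.D2_K hΦ hv, prL_injL]
    simp only [mulVecL_apply, H.mulVec_injL]
    ring
  have hD3 : ∀ v ∈ M, ∀ x y z, D3 g v x (injL ψ s y) (injL ψ s z)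
      = D3 f v x (injL ψ s y) (injL ψ s z) := by
    intro v hv x y z
    rw [← fderiv_D2_eq_D3 hM hg hv, fderiv_congr_of_isOpen hM (fun u hu => hD2 u hu y z) hv,
      fderiv_sub_const, fderiv_D2_eq_D3 hM hf hv]
  refine isQuadraticOn_of_D3 hMs (convex_factor ψ H.convex s).isPreconnected
    (hφs.sub (contDiffOn_const.mul hs)) ?_
  rintro _ ⟨v, hv, rfl⟩
  have hp : comp ψ s v ∈ factor ψ M s := ⟨v, hv, rfl⟩
  ext x y z
  have e1 := D3_sub hMs hφs (contDiffOn_const.mul hs :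
    ContDiffOn 𝕜 ∞ (fun y => 2 * (c + κ s) * Φ y) (factor ψ M s)) hp
  rw [D3_const_mul hMs hs _ hp] at e1
  change D3 (fun y => φ y - 2 * (c + κ s) * Φ y) (comp ψ s v) x y z = 0
  rw [e1]
  simp only [_root_.sub_apply, _root_.smul_apply, smul_eq_mul]
  rw [← prL_apply, D3_projection (prL_injL ψ s) hM hg hφ hv, hD3 v hv, H.D3_factor hΦ hv]
  have := H.third_injL hv s (injL ψ s x) (injL ψ s y) z
  change D3 f v _ _ _ = _ at this
  rw [this, sub_self]

theorem blockMatrix_unity (H : IsBlockSystem M η F e A r w c ψ d κ) (s : Fin m) :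
    blockMatrix ψ A s *ᵥ comp ψ s e = κ s • comp ψ s e := by
  rw [← H.A_unity, ← prL_apply, ← prL_apply, H.prL_mulVec]

theorem cUp_factor (H : IsBlockSystem M η F e A r w c ψ d κ)
    (hΦ : IsFactorPotential M F ψ s C K Φ) (hv : v ∈ M) (a b k : Fin (N s)) :
    cUp (blockMetric d s) Φ a b k (comp ψ s v)
      = (d ⟨s, a⟩)⁻¹ * (d ⟨s, b⟩)⁻¹ * D3 F v (bvec ψ ⟨s, a⟩) (bvec ψ ⟨s, b⟩) (bvec ψ ⟨s, k⟩) := by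
  have hrow : ∀ a, blockMetric d s a = (d ⟨s, a⟩)⁻¹ • Pi.single a 1 := fun a => by
    ext b
    simp [blockMetric, Matrix.diagonal_apply, Pi.single_apply, eq_comm]
  rw [cUp_eq_D3 (isOpen_factor ψ H.unital.isOpen s) (H.smoothOn_factor hΦ) ⟨v, hv, rfl⟩,
    hrow, hrow, ← prL_apply, H.D3_factor hΦ hv]
  simp only [map_smul, _root_.smul_apply, smul_eq_mul, injL_single]
  ring

end FactorPotential

end IsBlockSystem

end Factors

/-! ### Assembling the factors into a direct sum. -/

section BlockSum

set_option maxSynthPendingDepth 6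

open Matrix

variable {𝕜 : Type} [RCLike 𝕜] {ι : Type} [Fintype ι] [DecidableEq ι] {m : ℕ} {N : Fin m → ℕ}
  {ψ : (ι → 𝕜) ≃ₗ[𝕜] ((Σ s : Fin m, Fin (N s)) → 𝕜)}
  {M : Set (ι → 𝕜)} {η : Matrix ι ι 𝕜} {F : (ι → 𝕜) → 𝕜} {e : ι → 𝕜}
  {A : Matrix ι ι 𝕜} {r : ι → 𝕜} {w : ι → 𝕜} {c : 𝕜} {d : (Σ s : Fin m, Fin (N s)) → 𝕜}
  {κ : Fin m → 𝕜} {v : ι → 𝕜} {E : (ι → 𝕜) → (ι → 𝕜)} {B : HydroBracket 𝕜 ι}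

/-- The affine vector field induced on a factor. -/
def blockField (ψ : (ι → 𝕜) ≃ₗ[𝕜] ((Σ s : Fin m, Fin (N s)) → 𝕜)) (A : Matrix ι ι 𝕜) (r : ι → 𝕜)
    (s : Fin m) (y : Fin (N s) → 𝕜) : Fin (N s) → 𝕜 :=
  blockMatrix ψ A s *ᵥ y + prL ψ s r

/-- The bracket on a factor with metric the intersection form. -/
def blockBracket (ψ : (ι → 𝕜) ≃ₗ[𝕜] ((Σ s : Fin m, Fin (N s)) → 𝕜)) (A : Matrix ι ι 𝕜) (r : ι → 𝕜)
    (c : 𝕜) (d : (Σ s : Fin m, Fin (N s)) → 𝕜) (s : Fin m) (Φ : (Fin (N s) → 𝕜) → 𝕜) :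
    HydroBracket 𝕜 (Fin (N s)) where
  g := fun y a b => ∑ ε, blockField ψ A r s y ε * cUp (blockMetric d s) Φ a b ε y
  Γ := fun y a b k => ∑ ε, cUp (blockMetric d s) Φ a ε k y * (blockMatrix ψ A s - c • 1) b ε

namespace IsBlockSystem

section Factor

variable {s : Fin m} {C : (ι → 𝕜) →L[𝕜] (ι → 𝕜) →L[𝕜] 𝕜} {K : (ι → 𝕜) → 𝕜}
  {Φ : (Fin (N s) → 𝕜) → 𝕜}

theorem isFrobenius_factor (H : IsBlockSystem M η F e A r w c ψ d κ)
    (hΦ : IsFactorPotential M F ψ s C K Φ) (hκ : κ s ≠ 0) :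
    IsFrobenius (factor ψ M s) (blockMetric d s) (fun y => κ s * Φ y) ((κ s)⁻¹ • comp ψ s e)
      (fun y => (κ s)⁻¹ • blockField ψ A r s y) (1 - 2 * c / κ s) :=
  (H.isUnitalSolution_factor hΦ).isFrobenius (A := blockMatrix ψ A s) (r := prL ψ s r)
    (fun _ _ => rfl) (H.blockMatrix_unity s) hκ (H.quasihomogeneous_factor hΦ)

theorem isDegenerateFrobenius_factor (H : IsBlockSystem M η F e A r w c ψ d κ)
    (hΦ : IsFactorPotential M F ψ s C K Φ) (hκ : κ s = 0) :
    IsDegenerateFrobenius (factor ψ M s) (blockMetric d s) Φ (comp ψ s e)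
      (blockField ψ A r s) (2 * c) :=
  (H.isUnitalSolution_factor hΦ).isDegenerateFrobenius (A := blockMatrix ψ A s) (r := prL ψ s r)
    (fun _ _ => rfl) (by rw [H.blockMatrix_unity s, hκ, zero_smul])
    (by
      have h := H.quasihomogeneous_factor hΦ
      rw [hκ, add_zero] at h
      exact h)

end Factor

section AllFactors

variable {C : Fin m → (ι → 𝕜) →L[𝕜] (ι → 𝕜) →L[𝕜] 𝕜} {K : Fin m → (ι → 𝕜) → 𝕜}
  {Φ : ∀ s, (Fin (N s) → 𝕜) → 𝕜}

/-- The third derivative of `K s` is that of `F` with one argument projected to block `s`, and the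
projections add up to the identity. -/
theorem potential_sum (H : IsBlockSystem M η F e A r w c ψ d κ)
    (hΦ : ∀ s, IsFactorPotential M F ψ s (C s) (K s) (Φ s)) :
    IsQuadraticOn M (fun v => F v - ∑ s, Φ s (comp ψ s v)) := by
  have hM := H.unital.isOpen
  have hF := H.unital.smooth
  -- The coefficients 1 are kept to match the shape of `smoothOn_sum_mul` and `D2_sum_mul`.
  have hsum : ContDiffOn 𝕜 ∞ (fun v => ∑ s, 1 * K s v) M :=
    smoothOn_sum_mul _ _ _ fun s => (hΦ s).smooth
  have hq : IsQuadraticOn M (fun v => F v - ∑ s, 1 * K s v) := by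
    refine isQuadraticOn_of_D3 hM H.convex.isPreconnected (hF.sub hsum) fun v hv => ?_
    rw [D3_sub hM hF hsum hv]
    ext x y z
    have h1 : D3 (fun v => ∑ s, 1 * K s v) v x y z = ∑ s, D3 (K s) v x y z := by
      have h2 : ∀ u ∈ M, D2 (fun v => ∑ s, 1 * K s v) u y z = ∑ s, 1 * D2 (K s) u y z := by
        intro u hu
        rw [D2_sum_mul _ _ _ hM (fun s => (hΦ s).smooth) hu]
        simp
      rw [← fderiv_D2_eq_D3 hM hsum hv, fderiv_congr_of_isOpen hM h2 hv,
        fderiv_sum_mul _ _ (fun s u => D2 (K s) u y z) hM (fun s =>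
          ((smoothOn_D2 hM (hΦ s).smooth).clm_apply contDiffOn_const).clm_apply
            contDiffOn_const) hv]
      simp [fderiv_D2_eq_D3 hM (hΦ _).smooth hv]
    simp only [_root_.sub_apply, h1, H.D3_K (hΦ _) hv, ← map_sum, sum_injL_prL]
    simp
  obtain ⟨Q, q, k, h⟩ := hq
  refine ⟨Q, q, k, fun v hv => ?_⟩
  rw [← h v hv]
  simp [← (hΦ _).factor_eq v hv, prL_apply]

theorem isDecomposition (H : IsBlockSystem M η F e A r w c ψ d κ)
    (hE : ∀ v ∈ M, E v = A *ᵥ v + r)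
    (hΦ : ∀ s, IsFactorPotential M F ψ s (C s) (K s) (Φ s)) :
    IsDecomposition M η F e E w c ψ (blockMetric d) Φ (blockField ψ A r) κ where
  dim_pos := H.dim_pos
  metric := H.metric_isDirectSum
  potential := H.potential_sum hΦ
  euler := fun v hv s => by
    rw [hE v hv, ← prL_apply, ← prL_apply, map_add, H.prL_mulVec]
    rfl
  w_eq := H.w_eq
  rigid := fun s => H.isRigidOn_factor (hΦ s)
  frobenius := fun s => H.isFrobenius_factor (hΦ s)
  degenerate := fun s => H.isDegenerateFrobenius_factor (hΦ s)

theorem gNew_eq (H : IsBlockSystem M η F e A r w c ψ d κ) (hg : IsIntersectionForm M η F E B)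
    (hv : v ∈ M) (x y : Σ s : Fin m, Fin (N s)) :
    gNew ψ B v x y = (d x)⁻¹ * (d y)⁻¹ * D3 F v (bvec ψ x) (bvec ψ y) (E v) := by
  have h : D3 F v (∑ α, ψ (Pi.single α 1) x • η α) (∑ β, ψ (Pi.single β 1) y • η β) (E v)
      = gNew ψ B v x y := by
    simp only [map_sum, map_smul, _root_.sum_apply, _root_.smul_apply, gNew, hg v hv,
      sum_cUp H.unital.isOpen H.unital.smooth hv, smul_eq_mul, Finset.mul_sum]
    rw [Finset.sum_comm]
    exact Finset.sum_congr rfl fun _ _ => Finset.sum_congr rfl fun _ _ => by ring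
  rw [← h, H.sum_smul_row_coord, H.sum_smul_row_coord]
  simp only [map_smul, _root_.smul_apply, smul_eq_mul]
  ring

theorem ΓNew_eq (H : IsBlockSystem M η F e A r w c ψ d κ) {D : Matrix ι ι 𝕜}
    (hΓ : ∀ v ∈ M, ∀ α β γ, B.Γ v α β γ = ∑ ε, cUp η F α ε γ v * D β ε)
    (hv : v ∈ M) (x y z : Σ s : Fin m, Fin (N s)) :
    ΓNew ψ B v x y z = ∑ t, (d x)⁻¹ * (d t)⁻¹ * ψ (D *ᵥ bvec ψ t) y
      * D3 F v (bvec ψ x) (bvec ψ t) (bvec ψ z) := by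
  let L : (ι → 𝕜) →ₗ[𝕜] 𝕜 := LinearMap.proj (R := 𝕜)
    (φ := fun _ : (Σ s : Fin m, Fin (N s)) => 𝕜) y ∘ₗ ψ.toLinearMap
  let LD : (ι → 𝕜) →ₗ[𝕜] 𝕜 := L ∘ₗ D.mulVecLin
  have hLD : ∀ ε, LD (Pi.single ε 1) = ∑ β, D β ε * ψ (Pi.single β 1) y := by
    intro ε
    have h := clm_eq_sum (LinearMap.toContinuousLinearMap L) (D *ᵥ Pi.single ε 1)
    simp only [Matrix.mulVec_single_one, Matrix.col_apply] at h
    refine Eq.trans ?_ h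
    simp [LD]
  have h : D3 F v (∑ α, ψ (Pi.single α 1) x • η α) (∑ ε, LD (Pi.single ε 1) • η ε) (bvec ψ z)
      = ΓNew ψ B v x y z := by
    have hz : ∀ α ε, D3 F v (η α) (η ε) (bvec ψ z) = ∑ γ, bvec ψ z γ * cUp η F α ε γ v :=
      fun α ε => (sum_cUp H.unital.isOpen H.unital.smooth hv α ε _).symm
    simp only [map_sum, map_smul, _root_.sum_apply, _root_.smul_apply, ΓNew, hΓ v hv, hLD, hz,
      smul_eq_mul, Finset.mul_sum, Finset.sum_mul]
    rw [Finset.sum_comm]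
    refine Finset.sum_congr rfl fun α _ => ?_
    rw [Finset.sum_comm' (t' := Finset.univ) (s' := fun _ => Finset.univ) (by simp)]
    rw [Finset.sum_congr rfl fun γ _ => Finset.sum_comm, Finset.sum_comm]
    refine Finset.sum_congr rfl fun β _ => Finset.sum_congr rfl fun γ _ =>
      Finset.sum_congr rfl fun ε _ => ?_
    rw [bvec]
    ring
  rw [← h, H.sum_smul_row_coord, H.sum_smul_row]
  simp only [map_smul, map_sum, _root_.smul_apply, _root_.sum_apply, smul_eq_mul]
  refine Finset.sum_congr rfl fun t _ => ?_
  have : LD (bvec ψ t) = ψ (D *ᵥ bvec ψ t) y := rfl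
  rw [this]
  ring

/-- Components mixing blocks vanish because products across blocks do and `A - c` preserves the
blocks. Within a block only the component of `E` in that block contributes, and it depends on the
coordinates of that block alone. -/
theorem isDirectSum_blockBracket (H : IsBlockSystem M η F e A r w c ψ d κ)
    (hE : ∀ v ∈ M, E v = A *ᵥ v + r)
    (hΦ : ∀ s, IsFactorPotential M F ψ s (C s) (K s) (Φ s)) (hg : IsIntersectionForm M η F E B)
    (hΓ : ∀ v ∈ M, ∀ α β γ, B.Γ v α β γ = ∑ ε, cUp η F α ε γ v * (A - c • 1) β ε) :
    IsDirectSum ψ M B (fun s => blockBracket ψ A r c d s (Φ s)) := by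
  have hM := H.unital.isOpen
  have hF := H.unital.smooth
  have hD : ∀ t y : Σ s : Fin m, Fin (N s), ψ ((A - c • 1) *ᵥ bvec ψ t) y
      = ψ (A *ᵥ bvec ψ t) y - c * if y = t then 1 else 0 := by
    intro t y
    rw [Matrix.sub_mulVec, Matrix.smul_mulVec, Matrix.one_mulVec, map_sub, map_smul, Pi.sub_apply,
      Pi.smul_apply, apply_bvec, smul_eq_mul]
  have hD0 : ∀ t y : Σ s : Fin m, Fin (N s), t.1 ≠ y.1 →
      ψ ((A - c • 1) *ᵥ bvec ψ t) y = 0 := by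
    intro t y hty
    rw [hD, H.A_block _ _ hty, if_neg (fun h : y = t => hty (by rw [h])), mul_zero, sub_zero]
  intro v hv
  refine ⟨fun s a b => ?_, fun x y hxy => ?_, fun s a b k => ?_, fun x y z hxyz => ?_⟩
  · rw [H.gNew_eq hg hv]
    have hEs : D3 F v (bvec ψ ⟨s, a⟩) (bvec ψ ⟨s, b⟩) (E v)
        = D3 F v (bvec ψ ⟨s, a⟩) (bvec ψ ⟨s, b⟩) (injL ψ s (prL ψ s (E v))) := by
      rw [← injL_single, ← injL_single, D3_symm_right hM hF hv, H.D3_injL_left hv,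
        D3_symm_right hM hF hv]
    rw [hEs, hE v hv, map_add, H.prL_mulVec, injL_apply, map_sum, Finset.mul_sum]
    refine Finset.sum_congr rfl fun ε _ => ?_
    rw [H.cUp_factor (hΦ s) hv, map_smul, smul_eq_mul]
    simp only [blockField, prL_apply]
    ring
  · rw [H.gNew_eq hg hv, H.D3_eq_zero v hv x y hxy, mul_zero]
  · rw [H.ΓNew_eq hΓ hv, Fintype.sum_sigma, Finset.sum_eq_single s]
    · refine Finset.sum_congr rfl fun ε _ => ?_
      rw [H.cUp_factor (hΦ s) hv, hD]
      simp only [blockMatrix, Matrix.sub_apply, Matrix.smul_apply, Matrix.one_apply, smul_eq_mul]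
      have : ((⟨s, b⟩ : Σ s : Fin m, Fin (N s)) = ⟨s, ε⟩) ↔ b = ε := by simp
      simp only [this]
      ring
    · intro t _ hts
      refine Finset.sum_eq_zero fun ε _ => ?_
      rw [hD0 _ _ hts, mul_zero, zero_mul]
    · simp
  · rw [H.ΓNew_eq hΓ hv]
    refine Finset.sum_eq_zero fun t _ => ?_
    by_cases hty : t.1 = y.1
    · by_cases hxt : x.1 = t.1
      · rw [D3_symm_right hM hF hv, H.D3_eq_zero v hv x z, mul_zero]
        exact fun h => hxyz ⟨hxt.trans hty, (hxt.trans hty).symm.trans h⟩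
      · rw [H.D3_eq_zero v hv x t hxt, mul_zero]
    · rw [hD0 _ _ hty, mul_zero, zero_mul]

theorem isFrobeniusNormalForm_blockBracket (H : IsBlockSystem M η F e A r w c ψ d κ)
    (hΦ : ∀ s, IsFactorPotential M F ψ s (C s) (K s) (Φ s)) (s : Fin m) (hκ : κ s ≠ 0) :
    IsFrobeniusNormalForm (factor ψ M s) (blockMetric d s) (fun y => κ s * Φ s y)
      ((κ s)⁻¹ • comp ψ s e) (fun y => (κ s)⁻¹ • blockField ψ A r s y) (1 - 2 * c / κ s)
      (blockBracket ψ A r c d s (Φ s)) :=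
  IsFrobenius.normalForm (A := blockMatrix ψ A s) (r := prL ψ s r)
    (H.isUnitalSolution_factor (hΦ s)) (fun _ _ => rfl) hκ (H.isFrobenius_factor (hΦ s) hκ)
    (fun _ _ _ _ => rfl) (fun _ _ _ _ _ => rfl)

theorem isDegenerateNormalForm_blockBracket (H : IsBlockSystem M η F e A r w c ψ d κ)
    (hΦ : ∀ s, IsFactorPotential M F ψ s (C s) (K s) (Φ s)) (s : Fin m) (hκ : κ s = 0) :
    IsDegenerateNormalForm (factor ψ M s) (blockMetric d s) (Φ s) (comp ψ s e)
      (blockField ψ A r s) (2 * c) (blockBracket ψ A r c d s (Φ s)) :=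
  IsDegenerateFrobenius.normalForm (A := blockMatrix ψ A s) (r := prL ψ s r)
    (H.isDegenerateFrobenius_factor (hΦ s) hκ) (fun _ _ => rfl)
    (fun _ _ _ _ => rfl) (fun _ _ _ _ _ => rfl)

end AllFactors

end IsBlockSystem

end BlockSum

/-! ### Subalgebras of a power of the field -/

section Partition

variable {𝕜 : Type*} [Field 𝕜] {ι : Type} [Fintype ι]

/-- A subalgebra of `ι → 𝕜` is the algebra of functions constant on the classes of a partition. -/
theorem exists_partition_of_subalgebra (S : Subalgebra 𝕜 (ι → 𝕜)) :
    ∃ (m : ℕ) (cls : ι → Fin m), Function.Surjective cls ∧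
      (∀ a ∈ S, ∀ i j, cls i = cls j → a i = a j) ∧
      ∀ s, (fun i => if cls i = s then (1 : 𝕜) else 0) ∈ S := by
  classical
  let R : Setoid ι := ⟨fun i j => ∀ a ∈ S, a i = a j, fun _ _ _ => rfl,
    fun h a ha => (h a ha).symm, fun h h' a ha => (h a ha).trans (h' a ha)⟩
  let φ := Fintype.equivFin (Quotient R)
  have hcls : ∀ i j, φ ⟦i⟧ = φ ⟦j⟧ ↔ ∀ a ∈ S, a i = a j := fun i j => by
    rw [φ.injective.eq_iff]
    exact Quotient.eq
  refine ⟨_, fun i => φ ⟦i⟧, φ.surjective.comp Quotient.mk_surjective,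
    fun a ha i j hij => (hcls i j).1 hij a ha, fun s => ?_⟩
  obtain ⟨i, rfl⟩ := (φ.surjective.comp Quotient.mk_surjective) s
  -- An element of `S` that separates `j` from `i` is normalized affinely to be 1 at `i` and 0 at
  -- `j`; this uses that `S` contains the constants.
  have hsep : ∀ j, ∃ a ∈ S, a i = 1 ∧ (φ ⟦j⟧ ≠ φ ⟦i⟧ → a j = 0) := by
    intro j
    by_cases hj : φ ⟦j⟧ = φ ⟦i⟧
    · exact ⟨1, S.one_mem, rfl, fun h => absurd hj h⟩
    · have hn : ¬ ∀ a ∈ S, a j = a i := fun h => hj ((hcls j i).2 h)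
      push Not at hn
      obtain ⟨a, ha, hne⟩ := hn
      have hne' : a i - a j ≠ 0 := sub_ne_zero.2 hne.symm
      refine ⟨(a i - a j)⁻¹ • (a - a j • 1),
        S.smul_mem (S.sub_mem ha (S.smul_mem S.one_mem _)) _, ?_, fun _ => ?_⟩
      · simp [hne']
      · simp
  choose a ha hai haj using hsep
  -- The product vanishes off the class of `i` and equals 1 on it, since elements of `S` are
  -- constant on classes.
  have hprod : ∏ j, a j ∈ S := S.prod_mem fun j _ => ha j
  convert hprod using 1
  ext k
  rw [Finset.prod_apply]
  simp only [Function.comp_apply]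
  split_ifs with hk
  · symm
    refine Finset.prod_eq_one fun j _ => ?_
    rw [(hcls k i).1 hk _ (ha j), hai]
  · exact (Finset.prod_eq_zero (f := fun j => a j k) (Finset.mem_univ k) (haj k hk)).symm

/-- An enumeration of the classes of a partition. -/
theorem exists_sigma_equiv {m : ℕ} (cls : ι → Fin m) (h : Function.Surjective cls) :
    ∃ (N : Fin m → ℕ) (σ : (Σ s : Fin m, Fin (N s)) ≃ ι),
      (∀ s, 0 < N s) ∧ ∀ x, cls (σ x) = x.1 := by
  classical
  refine ⟨fun s => Fintype.card {i // cls i = s},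
    (Equiv.sigmaCongrRight fun s => (Fintype.equivFin {i // cls i = s}).symm).trans
      (Equiv.sigmaFiberEquiv cls), fun s => ?_, fun x => ?_⟩
  · obtain ⟨i, hi⟩ := h s
    exact Fintype.card_pos_iff.2 ⟨⟨i, hi⟩⟩
  · exact ((Fintype.equivFin {i // cls i = x.1}).symm x.2).2

end Partition

/-! ### Semisimple solutions -/

section Semisimple

set_option maxSynthPendingDepth 6

open Matrix

variable {𝕜 : Type} [RCLike 𝕜] {ι : Type} [Fintype ι] [DecidableEq ι]
  {M : Set (ι → 𝕜)} {η : Matrix ι ι 𝕜} {F : (ι → 𝕜) → 𝕜} {e u w : ι → 𝕜}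
  {A : Matrix ι ι 𝕜} {r : ι → 𝕜} {c : 𝕜} {v v₀ : ι → 𝕜}

/-- The operator of multiplication by the constant vector `u` does not depend on the point. -/
def IsConstDirection (M : Set (ι → 𝕜)) (F : (ι → 𝕜) → 𝕜) (u : ι → 𝕜) : Prop :=
  ∀ v ∈ M, ∀ v₁ ∈ M, D3 F v u = D3 F v₁ u

/-- A basis of orthogonal idempotents of the algebra at the point `v₀`. -/
def IsIdempotentBasis (η : Matrix ι ι 𝕜) (F : (ι → 𝕜) → 𝕜) (v₀ : ι → 𝕜)
    (b : Module.Basis ι 𝕜 (ι → 𝕜)) : Prop :=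
  ∀ i j, prodAt η F v₀ (b i) (b j) = if i = j then b i else 0

theorem IsIdempotentBasis.repr_prodAt {b : Module.Basis ι 𝕜 (ι → 𝕜)}
    (hb : IsIdempotentBasis η F v₀ b) (x y : ι → 𝕜) (i : ι) :
    b.repr (prodAt η F v₀ x y) i = b.repr x i * b.repr y i := by
  conv_lhs => rw [← b.sum_repr x, ← b.sum_repr y]
  simp only [map_sum, map_smul, LinearMap.sum_apply, LinearMap.smul_apply, hb _ _]
  simp [Finsupp.single_apply, apply_ite, mul_comm]

namespace IsUnitalSolution

theorem exists_idempotentBasis (h : IsUnitalSolution M η F e) (hss : IsSemisimpleOn M η F)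
    (hv : v ∈ M) : ∃ b, IsIdempotentBasis η F v b := by
  obtain ⟨π, hπ, hmul⟩ := hss v hv
  refine ⟨Module.Basis.mk hπ (hπ.span_eq_top_of_card_eq_finrank' (by simp)).ge, fun i j => ?_⟩
  rw [Module.Basis.mk_apply, Module.Basis.mk_apply, ← mulAt_eq_prodAt h.isOpen h.smooth hv, hmul]

theorem prodAt_eq_of_isConstDirection (h : IsUnitalSolution M η F e) (hu : IsConstDirection M F u)
    (hv : v ∈ M) (hv₀ : v₀ ∈ M) (x : ι → 𝕜) : prodAt η F v u x = prodAt η F v₀ u x :=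
  eq_of_low_eq h.metric_nondeg fun z => by
    rw [low_prodAt h.metric_nondeg, low_prodAt h.metric_nondeg, D3_symm_left h.isOpen h.smooth hv,
      D3_symm_left h.isOpen h.smooth hv₀, hu v hv v₀ hv₀]

theorem isConstDirection_of_prodAt (h : IsUnitalSolution M η F e)
    (hu : ∀ v ∈ M, ∀ v' ∈ M, ∀ x, prodAt η F v u x = prodAt η F v' u x) :
    IsConstDirection M F u := by
  intro v hv v' hv'
  ext z x
  rw [D3_symm_left h.isOpen h.smooth hv, D3_symm_left h.isOpen h.smooth hv',
    ← low_prodAt h.metric_nondeg, ← low_prodAt h.metric_nondeg, hu v hv v' hv']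

theorem isConstDirection_unity (h : IsUnitalSolution M η F e) : IsConstDirection M F e :=
  h.isConstDirection_of_prodAt fun v hv v' hv' x => by rw [h.unity_prod hv, h.unity_prod hv']

theorem low_eq_low_prod (h : IsUnitalSolution M η F e) (hv : v ∈ M) (x y : ι → 𝕜) :
    low η x y = low η e (prodAt η F v x y) := by
  rw [low_prodAt h.metric_nondeg, h.D3_unity hv]

section IdempotentBasis

variable {b : Module.Basis ι 𝕜 (ι → 𝕜)}

theorem repr_unity (h : IsUnitalSolution M η F e) (hb : IsIdempotentBasis η F v₀ b) (hv₀ : v₀ ∈ M)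
    (i : ι) : b.repr e i = 1 := by
  have := hb.repr_prodAt e (b i) i
  rw [h.unity_prod hv₀] at this
  simpa using this.symm

theorem low_basis (h : IsUnitalSolution M η F e) (hb : IsIdempotentBasis η F v₀ b) (hv₀ : v₀ ∈ M)
    (i j : ι) : low η (b i) (b j) = if i = j then low η (b i) (b i) else 0 := by
  split_ifs with hij
  · rw [hij]
  · rw [h.low_eq_low_prod hv₀, hb, if_neg hij, map_zero]

theorem low_basis_ne_zero (h : IsUnitalSolution M η F e) (hb : IsIdempotentBasis η F v₀ b)
    (hv₀ : v₀ ∈ M) (i : ι) : low η (b i) (b i) ≠ 0 := by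
  intro h0
  refine b.ne_zero i (eq_of_low_eq h.metric_nondeg fun z => ?_)
  conv_lhs => rw [← b.sum_repr z]
  rw [map_sum, LinearMap.sum_apply, map_zero]
  refine Finset.sum_eq_zero fun j _ => ?_
  rw [map_smul, LinearMap.smul_apply, h.low_basis hb hv₀]
  split_ifs with hji
  · rw [hji, h0, smul_zero]
  · rw [smul_zero]

/-- In the coordinates of `b` the algebra at `v₀` is `ι → 𝕜` with pointwise product. Constant
directions form a subalgebra: multiplication by a product is the composite of two constant
operators, by associativity at each point. -/
theorem exists_class_partition (h : IsUnitalSolution M η F e) (hb : IsIdempotentBasis η F v₀ b)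
    (hv₀ : v₀ ∈ M) : ∃ (m : ℕ) (cls : ι → Fin m), Function.Surjective cls ∧
      (∀ u, IsConstDirection M F u → ∀ i j, cls i = cls j → b.repr u i = b.repr u j) ∧
      ∀ s, IsConstDirection M F (b.equivFun.symm fun i => if cls i = s then 1 else 0) := by
  have hone : b.equivFun.symm 1 = e := by
    rw [LinearEquiv.symm_apply_eq]
    ext i
    rw [Module.Basis.equivFun_apply, h.repr_unity hb hv₀, Pi.one_apply]
  have hmul : ∀ x y, b.equivFun.symm (x * y)
      = prodAt η F v₀ (b.equivFun.symm x) (b.equivFun.symm y) := by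
    intro x y
    rw [LinearEquiv.symm_apply_eq]
    ext i
    have hx : ∀ x : ι → 𝕜, b.repr (b.equivFun.symm x) i = x i := fun x =>
      congrFun (b.equivFun.apply_symm_apply x) i
    rw [Module.Basis.equivFun_apply, hb.repr_prodAt, hx, hx, Pi.mul_apply]
  let S : Subalgebra 𝕜 (ι → 𝕜) :=
    { carrier := {a | IsConstDirection M F (b.equivFun.symm a)}
      mul_mem' := fun {x y} hx hy => h.isConstDirection_of_prodAt fun v hv v' hv' z => by
        have key : ∀ v ∈ M, prodAt η F v (b.equivFun.symm (x * y)) z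
            = prodAt η F v₀ (b.equivFun.symm x) (prodAt η F v₀ (b.equivFun.symm y) z) := by
          intro v hv
          rw [hmul, ← h.prodAt_eq_of_isConstDirection hx hv hv₀, h.prod_assoc hv,
            h.prodAt_eq_of_isConstDirection hx hv hv₀, h.prodAt_eq_of_isConstDirection hy hv hv₀]
        rw [key v hv, key v' hv']
      add_mem' := fun {x y} hx hy v hv v' hv' => by
        rw [map_add, map_add, map_add, hx v hv v' hv', hy v hv v' hv']
      algebraMap_mem' := fun k v hv v' hv' => by
        rw [Algebra.algebraMap_eq_smul_one, map_smul, hone, map_smul, map_smul,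
          h.isConstDirection_unity v hv v' hv'] }
  obtain ⟨m, cls, hsurj, hcls, hind⟩ := exists_partition_of_subalgebra S
  refine ⟨m, cls, hsurj, fun u hu => hcls (b.equivFun u) ?_, hind⟩
  change IsConstDirection M F (b.equivFun.symm (b.equivFun u))
  rwa [LinearEquiv.symm_apply_apply]

end IdempotentBasis

/-! ### Homogeneous semisimple solutions -/

/-- The third derivative of `∂_E F` in a direction with constant multiplication operator. -/
theorem D3_apply_affine_of_isConstDirection (h : IsUnitalSolution M η F e)
    (hu : IsConstDirection M F u) (hv : v ∈ M) (x z : ι → 𝕜) :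
    D3 (fun y => fderiv 𝕜 F y (A *ᵥ y + r)) v x u z
      = D3 F v u (A *ᵥ x) z + D3 F v (A *ᵥ u) x z + D3 F v u x (A *ᵥ z) := by
  have hM := h.isOpen
  have hF := h.smooth
  -- As `D3 F y u` does not depend on `y`, it can be frozen at `v`; the first term is then affine in
  -- `y`, and no fourth derivative of `F` appears.
  have hD2 : ∀ y ∈ M, D2 (fun y => fderiv 𝕜 F y (mulVecL A y + r)) y u z
      = D3 F v u (mulVecL A y + r) z + D2 F y (A *ᵥ u) z + D2 F y u (A *ᵥ z) := by
    intro y hy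
    rw [D2_apply_affine hM hF _ _ hy, D3_symm_left hM hF hy, hu y hy v hv]
    rfl
  change D3 (fun y => fderiv 𝕜 F y (mulVecL A y + r)) v x u z = _
  rw [← fderiv_D2_eq_D3 hM (smoothOn_fderiv_apply_affine hM hF _ _) hv,
    fderiv_congr_of_isOpen hM hD2 hv]
  have s2 : ∀ p q, DifferentiableAt 𝕜 (fun y => D2 F y p q) v := fun p q =>
    differentiableAt_of_smoothOn hM (((smoothOn_D2 hM hF).clm_apply contDiffOn_const).clm_apply
      contDiffOn_const) hv
  have s1 : HasFDerivAt (fun y => D3 F v u (mulVecL A y + r) z)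
      (((D3 F v u).flip z).comp (mulVecL A)) v :=
    ((D3 F v u).flip z).hasFDerivAt.comp v ((mulVecL A).hasFDerivAt.add_const r)
  rw [fderiv_fun_add (s1.differentiableAt.fun_add (s2 _ _)) (s2 _ _),
    fderiv_fun_add s1.differentiableAt (s2 _ _), s1.fderiv, _root_.add_apply, _root_.add_apply,
    fderiv_D2_eq_D3 hM hF hv, fderiv_D2_eq_D3 hM hF hv, D3_symm_left hM hF hv x,
    D3_symm_left hM hF hv x]
  rfl

/-- The action of the linear part of `E` on directions with constant multiplication operator. -/
theorem prodAt_mulVec (h : IsUnitalSolution M η F e) (hA : A *ᵥ e = w - c • e)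
    (hf : ∀ v ∈ M, ∀ x y z, D3 (fun y => fderiv 𝕜 F y (A *ᵥ y + r)) v x y z
      = 2 * D3 F v x y (prodAt η F v w z))
    (hu : IsConstDirection M F u) (hv : v ∈ M) (z : ι → 𝕜) :
    prodAt η F v (A *ᵥ u) z = prodAt η F v u (prodAt η F v w z) - c • prodAt η F v u z
      + A *ᵥ prodAt η F v u z - prodAt η F v u (A *ᵥ z) := by
  have hM := h.isOpen
  have hF := h.smooth
  have hη := h.metric_nondeg
  have hlow : ∀ x y z, D3 F v x y z = low η y (prodAt η F v x z) := fun x y z => by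
    rw [low_prodAt hη, D3_symm_left hM hF hv]
  have key : ∀ u, IsConstDirection M F u → ∀ x z,
      2 * low η x (prodAt η F v u (prodAt η F v w z)) = low η (A *ᵥ x) (prodAt η F v u z)
        + low η x (prodAt η F v (A *ᵥ u) z) + low η x (prodAt η F v u (A *ᵥ z)) := by
    intro u hu x z
    have h1 := hf v hv x u z
    rw [h.D3_apply_affine_of_isConstDirection hu hv, D3_symm_left hM hF hv x u, hlow, hlow, hlow,
      hlow] at h1
    exact h1.symm
  -- The relation `key` for the unity computes the adjoint of `A`; it serves to eliminate `A *ᵥ x`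
  -- from `key` for a general `u`.
  have hadj : ∀ x z, low η (A *ᵥ x) z
      = low η x (prodAt η F v w z) + c * low η x z - low η x (A *ᵥ z) := by
    intro x z
    have h1 := key e h.isConstDirection_unity x z
    rw [h.unity_prod hv, h.unity_prod hv, h.unity_prod hv, hA, map_sub, map_smul,
      LinearMap.sub_apply, LinearMap.smul_apply, h.unity_prod hv, map_sub, map_smul,
      smul_eq_mul] at h1
    linear_combination -h1
  refine eq_of_low_eq hη fun x => ?_
  have h1 := key u hu x z
  have h2 : prodAt η F v w (prodAt η F v u z) = prodAt η F v u (prodAt η F v w z) := by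
    rw [← h.prod_assoc hv, h.prod_comm hv w u, h.prod_assoc hv]
  rw [hadj, h2] at h1
  simp only [map_sub, map_add, map_smul, smul_eq_mul]
  linear_combination -h1

theorem isConstDirection_mulVec (h : IsUnitalSolution M η F e) (hA : A *ᵥ e = w - c • e)
    (hw : IsConstDirection M F w)
    (hf : ∀ v ∈ M, ∀ x y z, D3 (fun y => fderiv 𝕜 F y (A *ᵥ y + r)) v x y z
      = 2 * D3 F v x y (prodAt η F v w z))
    (hu : IsConstDirection M F u) : IsConstDirection M F (A *ᵥ u) :=
  h.isConstDirection_of_prodAt fun v hv v' hv' z => by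
    rw [h.prodAt_mulVec hA hf hu hv, h.prodAt_mulVec hA hf hu hv',
      h.prodAt_eq_of_isConstDirection hw hv hv', h.prodAt_eq_of_isConstDirection hu hv hv',
      h.prodAt_eq_of_isConstDirection hu hv hv', h.prodAt_eq_of_isConstDirection hu hv hv']

/-- A semisimple solution has an adapted block system. -/
theorem exists_isBlockSystem (h : IsUnitalSolution M η F e) (hMc : Convex ℝ M)
    (hss : IsSemisimpleOn M η F) (hA : A *ᵥ e = w - c • e) (hw : IsConstDirection M F w)
    (hf : ∀ v ∈ M, ∀ x y z, D3 (fun y => fderiv 𝕜 F y (A *ᵥ y + r)) v x y z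
      = 2 * D3 F v x y (prodAt η F v w z)) :
    ∃ (m : ℕ) (N : Fin m → ℕ) (ψ : (ι → 𝕜) ≃ₗ[𝕜] ((Σ s : Fin m, Fin (N s)) → 𝕜))
      (d : (Σ s : Fin m, Fin (N s)) → 𝕜) (κ : Fin m → 𝕜),
      IsBlockSystem M η F e A r w c ψ d κ := by
  obtain ⟨v₀, hv₀⟩ := h.isConnected.nonempty
  obtain ⟨b, hb⟩ := h.exists_idempotentBasis hss hv₀
  obtain ⟨m, cls, hsurj, hcls, hind⟩ := h.exists_class_partition hb hv₀
  obtain ⟨N, σ, hN, hσ⟩ := exists_sigma_equiv cls hsurj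
  let es : Fin m → ι → 𝕜 := fun s => b.equivFun.symm fun i => if cls i = s then 1 else 0
  have hes : ∀ s i, b.repr (es s) i = if cls i = s then 1 else 0 := fun s i =>
    congrFun (b.equivFun.apply_symm_apply fun i => if cls i = s then (1 : 𝕜) else 0) i
  have hext : ∀ x y : ι → 𝕜, (∀ i, b.repr x i = b.repr y i) → x = y := fun x y hxy =>
    b.repr.injective (Finsupp.ext hxy)
  have hact : ∀ s z i, b.repr (A *ᵥ es s) i * b.repr z i
      = b.repr (es s) i * (b.repr w i * b.repr z i) - c * (b.repr (es s) i * b.repr z i)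
        + b.repr (A *ᵥ prodAt η F v₀ (es s) z) i - b.repr (es s) i * b.repr (A *ᵥ z) i := by
    intro s z i
    have h1 := congrArg (fun x => b.repr x i) (h.prodAt_mulVec hA hf (u := es s) (hind s) hv₀ z)
    simpa only [map_sub, map_add, map_smul, Finsupp.sub_apply, Finsupp.add_apply,
      Finsupp.smul_apply, smul_eq_mul, hb.repr_prodAt] using h1
  have hprod : ∀ s t, s ≠ t → prodAt η F v₀ (es s) (es t) = 0 := by
    intro s t hst
    refine hext _ _ fun i => ?_
    rw [hb.repr_prodAt, hes, hes]
    by_cases hi : cls i = s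
    · simp [hi, hst]
    · simp [hi]
  choose rep hrep using hsurj
  -- The eigenvalue of `A` on `es s`. Any representative gives the same value, since `A *ᵥ es s` is
  -- again a constant direction; off the class its coordinates vanish, by `hact` applied to another
  -- `es t`, whose product with `es s` is zero.
  let κ : Fin m → 𝕜 := fun s => b.repr (A *ᵥ es s) (rep s)
  have hAes : ∀ s i, b.repr (A *ᵥ es s) i = if cls i = s then κ s else 0 := by
    intro s i
    split_ifs with hi
    · exact hcls _ (h.isConstDirection_mulVec hA hw hf (hind s)) _ _ (by rw [hi, hrep])
    · have h1 := hact s (es (cls i)) i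
      rw [hprod s _ (Ne.symm hi), hes, hes, if_neg hi, if_pos rfl] at h1
      simpa using h1
  have hsum : ∑ s, es s = e := by
    refine hext _ _ fun i => ?_
    rw [h.repr_unity hb hv₀, map_sum, Finsupp.finsetSum_apply]
    simp [hes]
  have hAe : ∀ i, b.repr (A *ᵥ e) i = κ (cls i) := by
    intro i
    rw [← hsum, Matrix.mulVec_sum, map_sum, Finsupp.finsetSum_apply]
    simp [hAes]
  have hwi : ∀ i, b.repr w i = c + κ (cls i) := by
    intro i
    have h1 := hAe i
    rw [hA, map_sub, map_smul, Finsupp.sub_apply, Finsupp.smul_apply, h.repr_unity hb hv₀] at h1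
    rw [← h1]
    simp
  have hesb : ∀ j, prodAt η F v₀ (es (cls j)) (b j) = b j := by
    intro j
    refine hext _ _ fun i => ?_
    rw [hb.repr_prodAt, hes, Module.Basis.repr_self, Finsupp.single_apply]
    by_cases hij : j = i
    · simp [hij]
    · simp [hij]
  let ψ : (ι → 𝕜) ≃ₗ[𝕜] ((Σ s : Fin m, Fin (N s)) → 𝕜) :=
    b.equivFun.trans (LinearEquiv.funCongrLeft 𝕜 𝕜 σ)
  have hψ : ∀ z x, ψ z x = b.repr z (σ x) := fun _ _ => rfl
  have hbvec : ∀ x, bvec ψ x = b (σ x) := by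
    intro x
    rw [bvec, LinearEquiv.symm_apply_eq]
    ext y
    rw [hψ, Module.Basis.repr_self, Finsupp.single_apply, Pi.single_apply]
    simp [eq_comm]
  refine ⟨m, N, ψ, fun x => low η (b (σ x)) (b (σ x)), κ, hMc, h, hN, ?_, ?_, ?_, ?_, ?_, ?_, ?_,
    ?_⟩
  -- At every point, not only at `v₀`, the constant direction `es x.1` fixes one basis vector and
  -- kills the other, so their product vanishes.
  · intro v hv x y hxy z
    rw [D3_symm_right h.isOpen h.smooth hv, D3_symm_left h.isOpen h.smooth hv,
      ← low_prodAt h.metric_nondeg, hbvec, hbvec]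
    have h0 : prodAt η F v₀ (es x.1) (b (σ y)) = 0 := by
      refine hext _ _ fun i => ?_
      rw [hb.repr_prodAt, hes, Module.Basis.repr_self, Finsupp.single_apply]
      by_cases hi : σ y = i
      · rw [← hi, hσ, if_neg (Ne.symm hxy)]
        simp
      · simp [hi]
    have h1 : prodAt η F v (es x.1) (b (σ x)) = b (σ x) := by
      rw [h.prodAt_eq_of_isConstDirection (hind _) hv hv₀, ← hσ x]
      exact hesb _
    rw [← h1, h.prod_comm hv (es x.1), h.prod_assoc hv,
      h.prodAt_eq_of_isConstDirection (hind _) hv hv₀ (b (σ y)), h0, map_zero, map_zero]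
  · intro x y
    rw [hbvec, hbvec, h.low_basis hb hv₀]
    simp
  · exact fun x => h.low_basis_ne_zero hb hv₀ _
  · intro x y hxy
    rw [hbvec, hψ]
    -- For a coordinate outside the class of `σ x` every term of the relation vanishes except that
    -- of `A` applied to `es · b (σ x) = b (σ x)`.
    have h1 := hact (cls (σ x)) (b (σ x)) (σ y)
    have hne : σ x ≠ σ y := fun hh => hxy (by rw [σ.injective hh])
    rw [hesb, hes, if_neg (by rw [hσ, hσ]; exact Ne.symm hxy), Module.Basis.repr_self,
      Finsupp.single_apply, if_neg hne] at h1
    simpa using h1.symm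
  · intro s
    ext a
    simp only [comp, hψ, Pi.smul_apply, hAe, h.repr_unity hb hv₀, hσ, smul_eq_mul, mul_one]
  · intro s
    ext a
    simp only [comp, hψ, Pi.smul_apply, Pi.add_apply, hwi, h.repr_unity hb hv₀, hσ, smul_eq_mul,
      mul_one]
  · intro v hv x y z
    have h1 : prodAt η F v w (bvec ψ z) = (c + κ z.1) • bvec ψ z := by
      rw [h.prodAt_eq_of_isConstDirection hw hv hv₀, hbvec]
      refine hext _ _ fun i => ?_
      rw [hb.repr_prodAt, map_smul, Finsupp.smul_apply, Module.Basis.repr_self,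
        Finsupp.single_apply, hwi]
      by_cases hi : σ z = i
      · rw [← hi, hσ]
        simp
      · simp [hi]
    rw [hf v hv, h1, map_smul, smul_eq_mul]
  · intro u hu s
    refine ⟨b.repr u (rep s), ?_⟩
    ext a
    simp only [comp, hψ, Pi.smul_apply, h.repr_unity hb hv₀, smul_eq_mul, mul_one]
    exact hcls u hu _ _ (by rw [hσ, hrep])

end IsUnitalSolution

end Semisimple

/-! ### Semisimplicity from simple spectrum, and decomposition of homogeneous solutions. -/

section Normal

set_option maxSynthPendingDepth 6

open Matrix

variable {𝕜 : Type} [RCLike 𝕜] {ι : Type} [Fintype ι] [DecidableEq ι]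
  {M : Set (ι → 𝕜)} {η : Matrix ι ι 𝕜} {F G : (ι → 𝕜) → 𝕜} {e w : ι → 𝕜}
  {A : Matrix ι ι 𝕜} {r : ι → 𝕜} {c κ : 𝕜} {v : ι → 𝕜} {E : (ι → 𝕜) → (ι → 𝕜)}
  {B : HydroBracket 𝕜 ι}

namespace IsUnitalSolution

/-- If the operator of multiplication by `E` has a simple spectrum, the algebras are semisimple. -/
theorem isSemisimpleOn_of_pencil (h : IsUnitalSolution M η F e)
    (hg : IsIntersectionForm M η F E B) (hp : IsSemisimplePencil M η B) :
    IsSemisimpleOn M η F := by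
  intro v hv
  have hη := h.metric_nondeg
  obtain ⟨ρ, hρ, hdet⟩ := hp v hv
  have heig : ∀ i, ∃ f : ι → 𝕜, f ≠ 0 ∧ prodAt η F v (E v) f = ρ i • f := by
    intro i
    obtain ⟨x, hx, hx0⟩ := Matrix.exists_mulVec_eq_zero_iff.2 (hdet i)
    have hf : η *ᵥ x = ∑ β, x β • η β := by
      ext α
      simp only [Matrix.mulVec, dotProduct, Finset.sum_apply, Pi.smul_apply, smul_eq_mul]
      exact Finset.sum_congr rfl fun β _ => by rw [h.metric_symm.apply β α, mul_comm]
    -- The kernel vector `x` is a covector, as `g` and `η` have upper indices; the equation `g x = ρ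
    -- η x` says that the vector `η x` is an eigenvector of multiplication by `E`.
    refine ⟨η *ᵥ x, fun h0 => hx (Matrix.eq_zero_of_mulVec_eq_zero hη h0), ?_⟩
    rw [Matrix.sub_mulVec, sub_eq_zero, Matrix.smul_mulVec] at hx0
    rw [← hx0]
    ext α
    rw [← low_row hη α (prodAt η F v (E v) (η *ᵥ x)), low_prodAt hη,
      D3_symm_right h.isOpen h.smooth hv, hf]
    simp only [Matrix.mulVec, dotProduct, hg v hv, sum_cUp h.isOpen h.smooth hv, map_sum, map_smul,
      _root_.sum_apply, _root_.smul_apply, smul_eq_mul]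
    exact Finset.sum_congr rfl fun β _ => mul_comm _ _
  choose f hf0 hf using heig
  have hli : LinearIndependent 𝕜 f := Module.End.eigenvectors_linearIndependent'
    (prodAt η F v (E v)) ρ hρ f fun i => ⟨Module.End.mem_eigenspace_iff.2 (hf i), hf0 i⟩
  -- The product of two eigenvectors lies in both eigenspaces, hence is zero.
  have hzero : ∀ i j, i ≠ j → prodAt η F v (f i) (f j) = 0 := by
    intro i j hij
    have h1 : prodAt η F v (E v) (prodAt η F v (f i) (f j))
        = ρ i • prodAt η F v (f i) (f j) := by
      rw [← h.prod_assoc hv, hf, map_smul, LinearMap.smul_apply]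
    have h2 : prodAt η F v (E v) (prodAt η F v (f i) (f j))
        = ρ j • prodAt η F v (f i) (f j) := by
      rw [h.prod_comm hv (f i), ← h.prod_assoc hv, hf, map_smul, LinearMap.smul_apply]
    have h3 : (ρ i - ρ j) • prodAt η F v (f i) (f j) = 0 := by
      rw [sub_smul, ← h1, ← h2, sub_self]
    exact (smul_eq_zero.1 h3).resolve_left (sub_ne_zero.2 (hρ.ne hij))
  let b := Module.Basis.mk hli (hli.span_eq_top_of_card_eq_finrank' (by simp)).ge
  have hb : ∀ i, b i = f i := fun i => Module.Basis.mk_apply _ _ i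
  -- Expanding the unity in `f i = f i · e` leaves only the square of `f i`; so `f i` scaled by the
  -- coordinate of `e` is an idempotent.
  have hsq : ∀ i, b.repr e i • prodAt η F v (f i) (f i) = f i := by
    intro i
    conv_rhs => rw [← h.prod_unity hv (f i), ← b.sum_repr e]
    rw [map_sum, Finset.sum_eq_single i]
    · rw [map_smul, hb]
    · intro j _ hji
      rw [map_smul, hb, hzero i j hji.symm, smul_zero]
    · simp
  have hne : ∀ i, b.repr e i ≠ 0 := fun i h0 => hf0 i (by rw [← hsq i, h0, zero_smul])
  refine ⟨fun i => b.repr e i • f i, hli.units_smul fun i => Units.mk0 _ (hne i), fun i j => ?_⟩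
  rw [mulAt_eq_prodAt h.isOpen h.smooth hv, map_smul, map_smul, LinearMap.smul_apply]
  split_ifs with hij
  · rw [← hij, hsq]
  · rw [hzero i j hij, smul_zero, smul_zero]

/-- The third derivatives of `∂_E F`, when `∂_E F = 2 F^w` up to a quadratic polynomial. -/
theorem D3_apply_of_isTwist (h : IsUnitalSolution M η F e) (hE : ∀ v ∈ M, E v = A *ᵥ v + r)
    (hw : IsConstDirection M F w) (hG : IsTwist M η F w G)
    (hq : IsQuadraticOn M (fun v => fderiv 𝕜 F v (E v) - 2 * G v)) (hv : v ∈ M) (x y z : ι → 𝕜) :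
    D3 (fun u => fderiv 𝕜 F u (A *ᵥ u + r)) v x y z = 2 * D3 F v x y (prodAt η F v w z) := by
  have hM := h.isOpen
  have hF := h.smooth
  obtain ⟨hGs, ρ, -, hρ⟩ := hG
  have hf : ContDiffOn 𝕜 ∞ (fun u => fderiv 𝕜 F u (A *ᵥ u + r)) M :=
    smoothOn_fderiv_apply_affine hM hF (mulVecL A) r
  have h2G : ContDiffOn 𝕜 ∞ (fun u => 2 * G u) M := contDiffOn_const.mul hGs
  have hfG : D3 (fun u => fderiv 𝕜 F u (A *ᵥ u + r)) v = (2 : 𝕜) • D3 G v := by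
    rw [← D3_const_mul hM hGs 2 hv, ← sub_eq_zero, ← D3_sub hM hf h2G hv,
      ← hq.D3_eq_zero hM hv]
    exact D3_congr hM (fun u hu => by rw [hE u hu]) hv
  rw [hfG, _root_.smul_apply, _root_.smul_apply, _root_.smul_apply, smul_eq_mul]
  congr 1
  refine vec_induction (p := fun z => D3 G v x y z = D3 F v x y (prodAt η F v w z))
    (fun γ => ?_) (by simp) (fun z z' hz hz' => ?_) (fun k z hz => ?_) z
  · set t := prodAt η F v w (Pi.single γ 1)
    let L : (ι → 𝕜) →L[𝕜] 𝕜 := ∑ ν, ((1 / 2) * ρ γ ν) •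
      ContinuousLinearMap.proj (R := 𝕜) (φ := fun _ => 𝕜) ν
    -- The vector `w·∂_γ` is the same at all points, so `∂_γ G` is a derivative of `F` in a constant
    -- direction plus a linear form, which the Hessian does not see.
    have hd : ∀ u ∈ M, fderiv 𝕜 G u (Pi.single γ 1) = fderiv 𝕜 F u t + L u := by
      intro u hu
      have h1 := hρ u hu γ
      rw [twist_sum hM h.metric_symm hF hu, h.prodAt_eq_of_isConstDirection hw hu hv] at h1
      rw [← pd, h1]
      simp only [L, Finset.mul_sum, _root_.sum_apply, _root_.smul_apply,
        ContinuousLinearMap.proj_apply, smul_eq_mul, mul_assoc]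
      rfl
    have hL : D2 (fun u => L u) v = 0 := by
      have : fderiv 𝕜 (fun u => L u) = fun _ => L := funext fun u => L.fderiv
      rw [D2, this]
      simp
    rw [← fderiv3_eq_D3 hM hGs hv,
      fderiv_fderiv_eq_D2 hM (smoothOn_fderiv_apply hM hGs _) hv, D2_congr hM hd hv,
      D2_add hM (smoothOn_fderiv_apply hM hF t) L.contDiff.contDiffOn hv, hL, add_zero,
      D2_fderiv_apply hM hF hv, D3_symm_left hM hF hv, D3_symm_right hM hF hv]
  · simp only [map_add, hz, hz']
  · simp only [map_smul, hz]

theorem isConstDirection_of_isQuadraticDirection (h : IsUnitalSolution M η F e)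
    (hw : IsQuadraticDirection M F w) : IsConstDirection M F w := by
  obtain ⟨C, hC⟩ := (isQuadraticDirection_iff h.isOpen h.isConnected.isPreconnected h.smooth).1 hw
  exact fun v hv v' hv' => by rw [hC v hv, hC v' hv']

theorem exists_isDecomposition (h : IsUnitalSolution M η F e) (hMc : Convex ℝ M)
    (hss : IsSemisimpleOn M η F) (hE : IsLinearFieldOn M E) (hw : IsQuadraticDirection M F w)
    (hG : IsTwist M η F w G) (hq : IsQuadraticOn M (fun v => fderiv 𝕜 F v (E v) - 2 * G v))
    (hlie : ∀ v ∈ M, VectorField.lieBracket 𝕜 (fun _ => e) E v = w - c • e) :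
    ∃ (m : ℕ) (N : Fin m → ℕ) (ψ : (ι → 𝕜) ≃ₗ[𝕜] ((Σ s : Fin m, Fin (N s)) → 𝕜))
      (ηs : ∀ s, Matrix (Fin (N s)) (Fin (N s)) 𝕜) (Fs : ∀ s, (Fin (N s) → 𝕜) → 𝕜)
      (Es : ∀ s, (Fin (N s) → 𝕜) → (Fin (N s) → 𝕜)) (κ : Fin m → 𝕜),
      IsDecomposition M η F e E w c ψ ηs Fs Es κ := by
  obtain ⟨A, r, hE⟩ := hE
  obtain ⟨v₀, hv₀⟩ := h.isConnected.nonempty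
  have hA : A *ᵥ e = w - c • e := by
    rw [← hlie v₀ hv₀, lieBracket_const_affine h.isOpen hE hv₀]
  have hwc := h.isConstDirection_of_isQuadraticDirection hw
  obtain ⟨m, N, ψ, d, κ, H⟩ := h.exists_isBlockSystem hMc hss hA hwc
    fun v hv => h.D3_apply_of_isTwist hE hwc hG hq hv
  choose C K Φ hΦ using H.exists_isFactorPotential
  exact ⟨m, N, ψ, blockMetric d, Φ, blockField ψ A r, κ, H.isDecomposition hE hΦ⟩

end IsUnitalSolution

/-- Raising the summation index of `b̄` gives back `b^{βε}`. With `A = c + b̄` the coefficient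
becomes `A - c`, the shape required by both normal forms. -/
theorem IsPotential.Γ_eq_cUp {b : Matrix ι ι 𝕜} (hM : IsOpen M) (hη : η.det ≠ 0)
    (hF : IsPotential M η b B F) (hv : v ∈ M) (α β γ : ι) :
    B.Γ v α β γ = ∑ ε, cUp η F α ε γ v * (η * b * η⁻¹) β ε := by
  have h1 : ∑ ε, (η * b * η⁻¹) β ε • η ε = (η * b) β := by
    have : (η * b * η⁻¹ * η) = η * b := by
      rw [Matrix.mul_assoc, Matrix.nonsing_inv_mul _ (isUnit_iff_ne_zero.2 hη), Matrix.mul_one]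
    ext ε
    rw [← congrFun (congrFun this β) ε, Matrix.mul_apply, Finset.sum_apply]
    rfl
  have h2 : ∑ ε, cUp η F α ε γ v * (η * b * η⁻¹) β ε
      = D3 F v (Pi.single γ 1) (η α) ((η * b) β) := by
    rw [← h1, map_sum]
    refine Finset.sum_congr rfl fun ε _ => ?_
    rw [cUp_eq_D3 hM hF.1 hv, map_smul, smul_eq_mul, mul_comm, D3_symm_right hM hF.1 hv,
      D3_symm_left hM hF.1 hv]
  rw [h2, hF.2.1 v hv, D3_eq_sum (D3 F v (Pi.single γ 1)), Finset.sum_comm]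
  refine Finset.sum_congr rfl fun l _ => Finset.sum_congr rfl fun ε _ => ?_
  rw [c₃_eq_D3 hM hF.1 hv, D3_symm_left hM hF.1 hv]
  ring

end Normal

/-! ### Tau-structures compatible with spatial translations -/

section Translation

set_option maxSynthPendingDepth 6

open Matrix

variable {𝕜 : Type} [RCLike 𝕜] {ι : Type} [Fintype ι] [DecidableEq ι]
  {M : Set (ι → 𝕜)} {η : Matrix ι ι 𝕜} {B₂ : HydroBracket 𝕜 ι} {F : (ι → 𝕜) → 𝕜} {e w r : ι → 𝕜}
  {A : Matrix ι ι 𝕜} {c κ : 𝕜} {v : ι → 𝕜} {E : (ι → 𝕜) → (ι → 𝕜)} {o : ι}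

/-- Multiplication by `w = k e` is the scalar `k`, so `∂_E F` and `2kF` have the same third
derivative. -/
theorem IsUnitalSolution.isQuadraticOn_fderiv_apply (h : IsUnitalSolution M η F e)
    (hE : ∀ v ∈ M, E v = A *ᵥ v + r)
    (hf : ∀ v ∈ M, ∀ x y z, D3 (fun u => fderiv 𝕜 F u (A *ᵥ u + r)) v x y z
      = 2 * D3 F v x y (prodAt η F v w z)) {k : 𝕜} (hw : w = k • e) :
    IsQuadraticOn M (fun v => fderiv 𝕜 F v (E v) - 2 * k * F v) := by
  have hM := h.isOpen
  have hF := h.smooth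
  have hs : ContDiffOn 𝕜 ∞ (fun u => fderiv 𝕜 F u (A *ᵥ u + r)) M :=
    smoothOn_fderiv_apply_affine hM hF (mulVecL A) r
  have hkF : ContDiffOn 𝕜 ∞ (fun u => 2 * k * F u) M := contDiffOn_const.mul hF
  have hEA : ∀ v ∈ M, fderiv 𝕜 F v (E v) - 2 * k * F v
      = fderiv 𝕜 F v (A *ᵥ v + r) - 2 * k * F v := fun v hv => by rw [hE v hv]
  refine isQuadraticOn_of_D3 hM h.isConnected.isPreconnected ((hs.sub hkF).congr hEA)
    fun v hv => ?_
  rw [D3_congr hM hEA hv, D3_sub hM hs hkF hv, D3_const_mul hM hF _ hv]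
  ext x y z
  simp only [_root_.sub_apply, _root_.smul_apply, hf v hv, hw, map_smul, LinearMap.smul_apply,
    h.unity_prod hv, smul_eq_mul, _root_.zero_apply]
  ring

/-- The normal forms of a bracket when the direction `w` is a multiple of the unity. -/
theorem IsUnitalSolution.normalForms (h : IsUnitalSolution M η F e)
    (hE : ∀ v ∈ M, E v = A *ᵥ v + r) (hA : A *ᵥ e = w - c • e)
    (hf : ∀ v ∈ M, ∀ x y z, D3 (fun u => fderiv 𝕜 F u (A *ᵥ u + r)) v x y z
      = 2 * D3 F v x y (prodAt η F v w z))
    (hg : IsIntersectionForm M η F E B₂)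
    (hΓ : ∀ v ∈ M, ∀ α β γ, B₂.Γ v α β γ = ∑ ε, cUp η F α ε γ v * (A - c • 1) β ε)
    (hw : w = (c + κ) • e) :
    (κ ≠ 0 → IsFrobeniusNormalForm M η (fun v => κ * F v) (κ⁻¹ • e)
      (fun v => κ⁻¹ • E v) (1 - 2 * c / κ) B₂) ∧
    (κ = 0 → IsDegenerateNormalForm M η F e E (2 * c) B₂) := by
  have hq := h.isQuadraticOn_fderiv_apply hE hf hw
  have hAe : A *ᵥ e = κ • e := by rw [hA, hw, add_smul, add_sub_cancel_left]
  refine ⟨fun hκ => IsFrobenius.normalForm h hE hκ (h.isFrobenius hE hAe hκ hq) hg hΓ,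
    fun hκ => ?_⟩
  rw [hκ, add_zero] at hq
  rw [hκ, zero_smul] at hAe
  exact (h.isDegenerateFrobenius hE hAe hq).normalForm hE hg hΓ

/-- The decomposition of a bracket of intersection form. -/
theorem IsUnitalSolution.exists_isDirectSum (h : IsUnitalSolution M η F e) (hMc : Convex ℝ M)
    (hss : IsSemisimpleOn M η F) (hE : ∀ v ∈ M, E v = A *ᵥ v + r) (hA : A *ᵥ e = w - c • e)
    (hw : IsConstDirection M F w)
    (hf : ∀ v ∈ M, ∀ x y z, D3 (fun u => fderiv 𝕜 F u (A *ᵥ u + r)) v x y z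
      = 2 * D3 F v x y (prodAt η F v w z))
    (hg : IsIntersectionForm M η F E B₂)
    (hΓ : ∀ v ∈ M, ∀ α β γ, B₂.Γ v α β γ = ∑ ε, cUp η F α ε γ v * (A - c • 1) β ε) :
    ∃ (m : ℕ) (N : Fin m → ℕ) (ψ : (ι → 𝕜) ≃ₗ[𝕜] ((Σ s : Fin m, Fin (N s)) → 𝕜))
      (ηs : ∀ s, Matrix (Fin (N s)) (Fin (N s)) 𝕜) (Fs : ∀ s, (Fin (N s) → 𝕜) → 𝕜)
      (Es : ∀ s, (Fin (N s) → 𝕜) → (Fin (N s) → 𝕜)) (κ : Fin m → 𝕜)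
      (Bs : ∀ s, HydroBracket 𝕜 (Fin (N s))),
      IsDecomposition M η F e E w c ψ ηs Fs Es κ ∧ IsDirectSum ψ M B₂ Bs ∧
      ∀ s,
        (κ s ≠ 0 → IsFrobeniusNormalForm (factor ψ M s) (ηs s)
          (fun y => κ s * Fs s y) ((κ s)⁻¹ • comp ψ s e)
          (fun y => (κ s)⁻¹ • Es s y) (1 - 2 * c / κ s) (Bs s)) ∧
        (κ s = 0 → IsDegenerateNormalForm (factor ψ M s) (ηs s) (Fs s)
          (comp ψ s e) (Es s) (2 * c) (Bs s)) := by
  obtain ⟨m, N, ψ, d, κ, H⟩ := h.exists_isBlockSystem hMc hss hA hw hf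
  choose C K Φ hΦ using H.exists_isFactorPotential
  exact ⟨m, N, ψ, blockMetric d, Φ, blockField ψ A r, κ, fun s => blockBracket ψ A r c d s (Φ s),
    H.isDecomposition hE hΦ, H.isDirectSum_blockBracket hE hΦ hg hΓ, fun s =>
    ⟨H.isFrobeniusNormalForm_blockBracket hΦ s, H.isDegenerateNormalForm_blockBracket hΦ s⟩⟩

namespace TauStructure

variable (T : TauStructure M η B₂)

theorem exists_isPotential (hM : IsOpen M) (hMc : Convex ℝ M) (hMn : M.Nonempty) (hη : η.det ≠ 0)
    (hB : IsBihamiltonianOn M (flatBracket η) B₂) (hT : T.IsNormalized) :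
    ∃ F, IsPotential M η T.b B₂ F := by
  obtain ⟨F, hF, h⟩ := T.exists_D3_eq hM hMc hη hT hMn
  exact ⟨F, T.isPotential_of_D3_eq hM hMc.isPreconnected hη hB hF h⟩

/-- Multiplication by `w` is the constant operator `∇E + bᵀ`. -/
theorem prodAt_direction (hU : IsUnitalSolution M η F (Pi.single o 1))
    (hB : IsBihamiltonianOn M (flatBracket η) B₂) (hTC : T.IsTranslationCompatible o)
    (hF : IsPotential M η T.b B₂ F) (hE : ∀ v α, E v α = ∑ ε, B₂.g v α ε * η⁻¹ o ε)
    (hA : ∀ v ∈ M, E v = A *ᵥ v + r) (hv : v ∈ M) (y : ι → 𝕜) :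
    prodAt η F v (A *ᵥ Pi.single o 1 + (T.a 1 1 o o)⁻¹ • Pi.single o 1) y
      = (A + (T.b)ᵀ) *ᵥ y := by
  -- The transpose of `b` sends `∂_o` to the row `T.b o`, which is a multiple of the unity. With the
  -- self-adjointness of `A + bᵀ` this determines the operator by its value on the unity.
  have hb : (A + (T.b)ᵀ) *ᵥ Pi.single o 1
      = A *ᵥ Pi.single o 1 + (T.a 1 1 o o)⁻¹ • Pi.single o 1 := by
    rw [Matrix.add_mulVec, ← T.b_translation hU hTC hF]
    congr 1
    rw [Matrix.mulVec_single_one]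
    rfl
  refine eq_of_low_eq hU.metric_nondeg fun z => ?_
  rw [low_prodAt hU.metric_nondeg, low_symm hU.metric_symm z, ← hU.D3_unity hv,
    (T.D3_fderiv_euler hU hB hF hE hA).1 v hv, hb, D3_symm_left hU.isOpen hU.smooth hv,
    D3_symm_right hU.isOpen hU.smooth hv, D3_symm_left hU.isOpen hU.smooth hv]

end TauStructure

end Translation

end TauFrobenius

end

/-! ### Assembly of the main theorem. -/

open TauFrobenius in
theorem mainTheorem10 {𝕜 : Type} [RCLike 𝕜] {n : ℕ} (M : Set (Fin n → 𝕜))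
    (hMo : IsOpen M) (hMc : Convex ℝ M) (hMn : M.Nonempty) :
    -- Tau-symmetric bihamiltonian structures, in flat coordinates of the first metric.
    (∀ (η : Matrix (Fin n) (Fin n) 𝕜) (B₂ : HydroBracket 𝕜 (Fin n)),
      η.det ≠ 0 → IsBihamiltonianOn M (flatBracket η) B₂ →
      -- Every tau-structure can be normalized to `h_{α,-1} = v_α`.
      (∀ T : TauStructure M η B₂, ∃ (A : Matrix (Fin n) (Fin n) 𝕜) (T' : TauStructure M η B₂),
        A.det ≠ 0 ∧ T'.φ = T.φ ∧ (∀ α p v, T'.h α p v = ∑ β, A α β * T.h β p v) ∧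
          T'.IsNormalized) ∧
      ∀ T : TauStructure M η B₂, T.IsNormalized →
        -- Existence of the potential, uniqueness up to quadratic polynomials, associativity.
        (∃ F, IsPotential M η T.b B₂ F) ∧
        (∀ F, IsPotential M η T.b B₂ F →
          IsWDVVOn M η F ∧
          ∀ F' : (Fin n → 𝕜) → 𝕜,
            IsPotential M η T.b B₂ F' ↔
              ContDiffOn 𝕜 ∞ F' M ∧ IsQuadraticOn M (fun v => F' v - F v)) ∧
        -- Compatibility with spatial translations; `e = ∂/∂v^o`, `E` is the gradient of `v_o` with
        -- respect to the second metric.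
        ∀ o : Fin n, T.IsTranslationCompatible o →
          ∀ (e : Fin n → 𝕜) (E : (Fin n → 𝕜) → (Fin n → 𝕜)),
            e = Pi.single o 1 → (∀ v α, E v α = ∑ ε, B₂.g v α ε * η⁻¹ o ε) →
          ∃ c : 𝕜, c ≠ 0 ∧ (∀ α, T.b o α = c * e α) ∧
            (∃ r : Fin n → 𝕜, ∀ v ∈ M, E v = c • v + (η * T.b * η⁻¹).mulVec v + r) ∧
            ∀ w : Fin n → 𝕜, w = (2 * c) • e + (η * T.b * η⁻¹).mulVec e →
            (∀ v ∈ M, VectorField.lieBracket 𝕜 (fun _ => e) E v = w - c • e) ∧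
            ∀ F, IsPotential M η T.b B₂ F →
              IsUnitalSolution M η F e ∧
              IsIntersectionForm M η F E B₂ ∧
              IsQuadraticDirection M F w ∧
              (∃ G, IsTwist M η F w G ∧
                IsQuadraticOn M (fun v => fderiv 𝕜 F v (E v) - 2 * G v)) ∧
              -- Frobenius and degenerate Frobenius normal forms.
              (∀ κ : 𝕜, w = (c + κ) • e →
                (κ ≠ 0 → IsFrobeniusNormalForm M η (fun v => κ * F v) (κ⁻¹ • e)
                  (fun v => κ⁻¹ • E v) (1 - 2 * c / κ) B₂) ∧
                (κ = 0 → IsDegenerateNormalForm M η F e E (2 * c) B₂)) ∧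
              (IsRigidOn M η F → ∃ κ : 𝕜, w = (c + κ) • e) ∧
              -- Semisimple case: direct sum of the normal forms.
              (IsSemisimplePencil M η B₂ →
                IsSemisimpleOn M η F ∧
                ∃ (m : ℕ) (N : Fin m → ℕ)
                  (ψ : (Fin n → 𝕜) ≃ₗ[𝕜] ((Σ s : Fin m, Fin (N s)) → 𝕜))
                  (ηs : ∀ s, Matrix (Fin (N s)) (Fin (N s)) 𝕜)
                  (Fs : ∀ s, (Fin (N s) → 𝕜) → 𝕜)
                  (Es : ∀ s, (Fin (N s) → 𝕜) → (Fin (N s) → 𝕜))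
                  (κ : Fin m → 𝕜)
                  (Bs : ∀ s, HydroBracket 𝕜 (Fin (N s))),
                  IsDecomposition M η F e E w c ψ ηs Fs Es κ ∧
                  IsDirectSum ψ M B₂ Bs ∧
                  ∀ s,
                    (κ s ≠ 0 → IsFrobeniusNormalForm (factor ψ M s) (ηs s)
                      (fun y => κ s * Fs s y) ((κ s)⁻¹ • comp ψ s e)
                      (fun y => (κ s)⁻¹ • Es s y) (1 - 2 * c / κ s) (Bs s)) ∧
                    (κ s = 0 → IsDegenerateNormalForm (factor ψ M s) (ηs s) (Fs s)
                      (comp ψ s e) (Es s) (2 * c) (Bs s)))) ∧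
    -- Decomposition of semisimple solutions of the associativity equations.
    (∀ (η : Matrix (Fin n) (Fin n) 𝕜) (F G : (Fin n → 𝕜) → 𝕜) (e w : Fin n → 𝕜)
      (E : (Fin n → 𝕜) → (Fin n → 𝕜)) (c : 𝕜),
      IsUnitalSolution M η F e → IsSemisimpleOn M η F → IsLinearFieldOn M E →
      IsQuadraticDirection M F w → IsTwist M η F w G →
      IsQuadraticOn M (fun v => fderiv 𝕜 F v (E v) - 2 * G v) →
      (∀ v ∈ M, VectorField.lieBracket 𝕜 (fun _ => e) E v = w - c • e) →
      ∃ (m : ℕ) (N : Fin m → ℕ)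
        (ψ : (Fin n → 𝕜) ≃ₗ[𝕜] ((Σ s : Fin m, Fin (N s)) → 𝕜))
        (ηs : ∀ s, Matrix (Fin (N s)) (Fin (N s)) 𝕜)
        (Fs : ∀ s, (Fin (N s) → 𝕜) → 𝕜)
        (Es : ∀ s, (Fin (N s) → 𝕜) → (Fin (N s) → 𝕜))
        (κ : Fin m → 𝕜),
        IsDecomposition M η F e E w c ψ ηs Fs Es κ) := by
  refine ⟨fun η B₂ hη hB => ⟨fun T => T.exists_normalized hMo, fun T hT => ⟨
    T.exists_isPotential hMo hMc hMn hη hB hT, fun F hF => ⟨T.isWDVVOn_of_isPotential hMo hη hT hF,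
    T.isPotential_iff hMo hMc.isPreconnected hη hB hF⟩, ?_⟩⟩, ?_⟩
  · intro o hTC e E he hE
    subst he
    have hηs := hB.metric_symm hMn
    have hconn : IsConnected M := hMc.isConnected hMn
    obtain ⟨F₀, hF₀⟩ := T.exists_isPotential hMo hMc hMn hη hB hT
    have hU₀ := T.isUnitalSolution hMo hconn hη hηs hT hTC hF₀
    obtain ⟨r, hr⟩ := T.euler_affine hU₀ hB hTC hF₀ hE
    -- `c` and `A` involve only the tau-structure: the auxiliary potential `F₀` is used to derive
    -- the formulas for `E` and `b`, which then serve every potential `F`.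
    set c := (T.a 1 1 o o)⁻¹ with hc
    set A := c • (1 : Matrix (Fin n) (Fin n) 𝕜) + η * T.b * η⁻¹ with hA
    have hAv : ∀ v, A.mulVec v = c • v + (η * T.b * η⁻¹).mulVec v := fun v => by
      rw [hA, Matrix.add_mulVec, Matrix.smul_mulVec, Matrix.one_mulVec]
    refine ⟨c, inv_ne_zero (T.a_translation_ne_zero hTC hMn), fun α => ?_,
      ⟨r, fun v hv => by rw [hr v hv, hAv]⟩, fun w hw => ?_⟩
    · rw [T.b_translation hU₀ hTC hF₀]
      rfl
    have hAw : A.mulVec (Pi.single o 1) = w - c • Pi.single o 1 := by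
      rw [hAv, hw, two_mul, add_smul]
      abel
    refine ⟨fun v hv => by rw [lieBracket_const_affine hMo hr hv, hAw], fun F hF => ?_⟩
    have hU := T.isUnitalSolution hMo hconn hη hηs hT hTC hF
    have hprod : ∀ v ∈ M, ∀ y, prodAt η F v w y = (A + (T.b).transpose).mulVec y := by
      intro v hv y
      rw [← T.prodAt_direction hU hB hTC hF hE hr hv, hAw, sub_add_cancel]
    have hwc : IsConstDirection M F w := hU.isConstDirection_of_prodAt fun v hv v' hv' y => by
      rw [hprod v hv, hprod v' hv']
    have hfE := (T.D3_fderiv_euler hU hB hF hE hr).2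
    have hEr : ∀ v ∈ M, fderiv 𝕜 F v (E v) = fderiv 𝕜 F v (A.mulVec v + r) := fun v hv => by
      rw [hr v hv]
    have hf : ∀ v ∈ M, ∀ x y z, D3 (fun u => fderiv 𝕜 F u (A.mulVec u + r)) v x y z
        = 2 * D3 F v x y (prodAt η F v w z) := fun v hv x y z => by
      rw [← D3_congr hMo hEr hv, hfE v hv, hprod v hv]
    have hg := T.isIntersectionForm hU hB hF hE
    have hΓ : ∀ v ∈ M, ∀ α β γ,
        B₂.Γ v α β γ = ∑ ε, cUp η F α ε γ v * (A - c • 1) β ε := fun v hv α β γ => by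
      rw [hF.Γ_eq_cUp hMo hη hv, hA, add_sub_cancel_left]
    have hquad : IsQuadraticDirection M F w :=
      (isQuadraticDirection_iff hMo hconn.isPreconnected hF.1).2
        ⟨D3 F hMn.some w, fun v hv => hwc v hv _ hMn.some_mem⟩
    refine ⟨hU, hg, hquad, ?_, fun κ hκ => hU.normalForms hr hAw hf hg hΓ hκ, fun hrig => ?_,
      fun hp => ?_⟩
    · exact exists_isTwist hMo hconn.isPreconnected hηs hF.1
        ((smoothOn_fderiv_apply_affine hMo hF.1 (mulVecL A) r).congr hEr)
        (mulVecL (A + (T.b).transpose)) hprod hfE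
    · obtain ⟨k, hk⟩ := hU.eq_smul_of_isRigidOn hrig hquad
      -- Rigidity gives `w = k e`, and `κ` is what remains of `k` after removing `c`.
      exact ⟨k - c, by rw [add_sub_cancel, hk]⟩
    · have hss := hU.isSemisimpleOn_of_pencil hg hp
      exact ⟨hss, hU.exists_isDirectSum hMc hss hr hAw hwc hf hg hΓ⟩
  · intro η F G e w E c hU hss hE hw hG hq hlie
    exact hU.exists_isDecomposition hMc hss hE hw hG hq hlie
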